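/- **Language.** Linearity types are $Y ::= \phi\mid\bullet\mid\circ$; value types are $A,B ::= \alpha\mid A\to^Y C$; computation types are $C,D ::= A\,!\,\{R\}$. A row $R$ is a finite collection $K$ of entries $\ell : A_\ell\twoheadrightarrow^Y B_\ell$ (the types $A_\ell,B_\ell$ are fixed by a global signature, so an entry is written $\ell:Y$), taken up to reordering, optionally followed by a row variable: $R ::= K\mid K;\mu$. A type is $\tau ::= A\mid R\mid Y$. Let $\mathrm{dom}\,R$ be the set of labels of $R$ and $\langle R\rangle$ the set of its entries together with its row variable. A row is well-formed if no label occurs twice in it. A constraint set is a finite set of predicates $\tau_1\preceq\tau_2$, $R_1\leqslant R_2$, $R\perp\mathcal L$, where $\mathcal L$ is a finite set of labels. **Entailment** $P\vdash\pi$ is the least relation such that: $P\vdash\pi$ for $\pi\in P$; $P\vdash\tau\preceq\tau$; $P\vdash\tau\preceq\circ$; $P\vdash\bullet\preceq\tau$; $P\vdash (A\to^Y C)\preceq\tau$ iff $P\vdash Y\preceq\tau$; $P\vdash\tau\preceq R$ iff $P\vdash\tau\preceq Y$ for every entry $\ell:Y$ of $R$ and $P\vdash\tau\preceq\mu$ if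 $\mu$ is the row variable of $R$ (these two are rules in both directions); $P\vdash R_1\leqslant R_2$ if $\langle R_1\rangle\subseteq\langle R_2\rangle$; $P\vdash R\perp\mathcal L$ if $\mathrm{dom}\,R\cap\mathcal L=\emptyset$. All rows are required to be well-formed: a substitution $\theta$ is *admissible for* $P$ if it maps variables to well-formed types and all rows in $\theta P$ are well-formed. Put $\mathrm{Sat}(P)=\{\theta \text{ admissible for } P\mid \emptyset\vdash\pi\text{ for all }\pi\in\theta P\}$; $P$ is *satisfiable* if $\mathrm{Sat}(P)\neq\emptyset$. For a set of variables $N$, let $\mathrm{Sat}(Q)\theta$ (relative to $N$ and $P$) be the set of substitutions $s$ admissible for $P$ that agree on $N$ with $\theta'\theta$ (first $\theta$, then $\theta'$) for some $\theta'\in\mathrm{Sat}(Q)$. **Factorisation.** $\mathrm{factorise}$ maps $\tau\preceq\tau$, $\tau\preceq\circ$, $\bullet\preceq\tau$ to $\emptyset$; $(A\to^YC)\preceq\tau$ to $\mathrm{factorise}(Y\preceq\tau)$; $\tau\preceq R$ to the union of $\mathrm{factorise}(\tau\preceq Y)$ over the entries $\ell:Y$ of $R$ and of $\mathrm{factorise}(\tau\preceq\mu)$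 for its row variable $\mu$; $R_1\leqslant R_2$ to $\emptyset$ if $\langle R_1\rangle\subseteq\langle R_2\rangle$; $R\perp\mathcal L$ to $\emptyset$ if $\mathrm{dom}\,R\cap\mathcal L=\emptyset$; every other $\pi$ to $\{\pi\}$. It is extended to sets by unions, to schemes by $\mathrm{factorise}((\forall\bar\alpha.P\Rightarrow A)\preceq\tau)=\mathrm{factorise}(P')\cup\mathrm{factorise}(A'\preceq\tau)$ where $P',A'$ instantiate $\bar\alpha$ by fresh variables, and to contexts by $\mathrm{factorise}(\Gamma\preceq\tau)=\bigcup_{(x:\sigma)\in\Gamma}\mathrm{factorise}(\sigma\preceq\tau)$. Write $F$ for $\mathrm{factorise}$ and $U(\Gamma)=F(\Gamma\preceq\bullet)$. **Generated constraint sets.** Terms are $V ::= x\mid\lambda x.M$; $M,N ::= V\,W\mid\mathsf{return}\,V\mid\mathsf{do}\,\ell\,V\mid\mathsf{let}\,x=V\,\mathsf{in}\,M\mid\mathsf{let}\,x\leftarrow M\,\mathsf{in}\,N\mid\mathsf{handle}\,M\,\mathsf{with}\,H$; $H=\{\mathsf{return}\,x\mapsto M\}\uplus\{\ell_i\,p_i\,r_i\mapsto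 N_i\}_{i=1}^n$ with distinct $\ell_i$. Type inference $\Gamma\vdash V:A\dashv\theta,P,\Sigma$ (similarly for $M:C$ and $H:C\Rightarrow D$) takes a context $\Gamma$ of type schemes $\forall\bar\alpha.P\Rightarrow A$ and a term, and yields a type, a substitution, a constraint set and the set $\Sigma$ of used term variables. Below, $\mathrm{mgu}$ is the principal unifier computed by first-order unification with rows, $\Gamma|_\Sigma$ is restriction, $\overline\Sigma$ is complement, bound term variables are distinct from those in $\Gamma$, and $\alpha,\mu,\phi,\phi_i$ are fresh. - $x$ with $x:\forall\bar\alpha.P\Rightarrow A$ in $\Gamma$: the type is $A$ and the constraints are $P$, with $\bar\alpha$ replaced by fresh variables; $\theta=\iota$, $\Sigma=\{x\}$. - $\lambda x.M$: if $\Gamma,x:\alpha\vdash M:C\dashv\theta,P,\Sigma$, then $\theta\alpha\to^\phi C$, $\theta$, $P\cup F(\theta\Gamma|_\Sigma\preceq\phi)\cup U(\theta(x:\alpha)|_{\overline\Sigma})$, $\Sigma\setminus x$. - $V\,W$: if $\Gamma\vdash V:A\dashv\theta_1,P_1,\Sigma_1$, $\theta_1\Gamma\vdash W:B\dashv\theta_2,P_2,\Sigma_2$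 and $\theta_3=\mathrm{mgu}(\theta_2A,\,B\to^\phi\alpha\,!\,\{\mu\})$, then $\theta_3(\alpha\,!\,\{\mu\})$, $\theta_3\theta_2\theta_1$, $\theta_3(\theta_2P_1\cup P_2)\cup U(\theta_3\theta_2\theta_1\Gamma|_{\Sigma_1\cap\Sigma_2})$, $\Sigma_1\cup\Sigma_2$. - $\mathsf{return}\,V$: if $\Gamma\vdash V:A\dashv\theta,P,\Sigma$, then $A\,!\,\{\mu\}$, $\theta,P,\Sigma$. - $\mathsf{do}\,\ell\,V$: if $\Gamma\vdash V:A\dashv\theta_1,P,\Sigma$ and $\theta_2=\mathrm{mgu}(A,A_\ell)$, then $B_\ell\,!\,\{\mu\}$, $\theta_2\theta_1$, $\theta_2P\cup F((\ell:\phi)\leqslant\mu)$, $\Sigma$. - $\mathsf{let}\,x=V\,\mathsf{in}\,M$: if $\Gamma\vdash V:A\dashv\theta_1,P_1,\Sigma_1$, $\sigma$ quantifies $P_1\Rightarrow A$ over its variables not free in $\theta_1\Gamma$, and $\theta_1\Gamma,x:\sigma\vdash M:C\dashv\theta_2,P_2,\Sigma_2$, then $C$, $\theta_2\theta_1$, $P_2\cup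 U(\theta_2\theta_1\Gamma|_{\Sigma_1\cap\Sigma_2})\cup U(\theta_2(x:\sigma)|_{\overline{\Sigma_2}})$, $\Sigma_1\cup(\Sigma_2\setminus x)$. - $\mathsf{let}\,x\leftarrow M\,\mathsf{in}\,N$: if $\Gamma\vdash M:A\,!\,\{R_1\}\dashv\theta_1,P_1,\Sigma_1$ and $\theta_1\Gamma,x:A\vdash N:B\,!\,\{R_2\}\dashv\theta_2,P_2,\Sigma_2$, then $B\,!\,\{\mu\}$, $\theta_2\theta_1$, $\theta_2P_1\cup P_2\cup U(\theta_2\theta_1\Gamma|_{\Sigma_1\cap\Sigma_2})\cup U(\theta_2(x:A)|_{\overline{\Sigma_2}})\cup F(\theta_2\theta_1\Gamma|_{\Sigma_2}\preceq\theta_2R_1)\cup F(\theta_2R_1\leqslant\mu)\cup F(R_2\leqslant\mu)$, $\Sigma_1\cup(\Sigma_2\setminus x)$. - $\mathsf{handle}\,M\,\mathsf{with}\,H$: if $\Gamma\vdash H:A\,!\,\{R_1\}\Rightarrow D\dashv\theta_1,P_1,\Sigma_1$, $\theta_1\Gamma\vdash M:A'\,!\,\{R\}\dashv\theta_2,P_2,\Sigma_2$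 and $\theta_3=\mathrm{mgu}(\theta_2A,A')$, then $\theta_3\theta_2D$, $\theta_3\theta_2\theta_1$, $\theta_3(\theta_2P_1\cup P_2)\cup F(\theta_3R\leqslant\theta_3\theta_2R_1)\cup U(\theta_3\theta_2\theta_1\Gamma|_{\Sigma_1\cap\Sigma_2})$, $\Sigma_1\cup\Sigma_2$. - $H$: if $\Gamma,x:\alpha\vdash M:D\dashv\theta_0,P_0,\Sigma_0$ and, for $i=1,\dots,n$ in turn, $\theta_{i-1}(\Gamma,p_i:A_{\ell_i},r_i:B_{\ell_i}\to^{\phi_i}D)\vdash N_i:D_i\dashv\theta_i',P_i,\Sigma_i$, $\theta_i''=\mathrm{mgu}(D_i,\theta_i'\theta_{i-1}D)$, $\theta_i=\theta_i''\theta_i'\theta_{i-1}$, then, with $\theta_nD=B\,!\,\{R\}$ and $\Sigma=(\Sigma_0\setminus x)\cup\bigcup_i(\Sigma_i\setminus\{p_i,r_i\})$: the type is $\theta_n(\alpha\,!\,\{(\ell_i:\phi_i)_i;\mu\})\Rightarrow\theta_nD$, the substitution is $\theta_n$, the used variables are $\Sigma$, and the constraints are $\bigcup_{i=0}^n\theta_nP_i\cup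 U(\theta_n\Gamma|_\Sigma)\cup F(\mu\leqslant R)\cup F(\mu\perp\{\ell_i\}_i)\cup U(\theta_n(x:\alpha)|_{\overline{\Sigma_0}})\cup\bigcup_iU(\theta_n(p_i:A_{\ell_i},r_i:B_{\ell_i}\to^{\phi_i}D)|_{\overline{\Sigma_i}})$. $P$ is *generated by type inference* if it is the constraint set of such a derivation, for some value, computation or handler and some context $\Gamma$ (possibly empty) in whose qualifiers no row stands on the left, and no value type on the right, of $\preceq$. **The solver.** $\mathrm{solve}(P_0)$ starts from $(\theta,P,Q)=(\iota,\emptyset,P_0)$, where $P$ holds solved and $Q$ unsolved predicates. While $Q\ne\emptyset$, it removes some $\pi$ from $Q$: - $\tau_1\preceq\tau_2$ is moved to $P$. - $K\perp\mathcal L$ and $K;\mu\perp\mathcal L$: fail unless $\mathrm{dom}\,K\cap\mathcal L=\emptyset$; in the second case put $\mu\perp\mathcal L$ into $P$. - $R_1\leqslant R_2$, where $R_i$ is $K_i$ or $K_i;\mu_i$: unify the linearities of the labels shared by $K_1$ and $K_2$ (fail on $\bullet$ against $\circ$), giving $\theta'$, and let $K_i'=\theta'K_i$. - If $K_1'\subseteq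 K_2'$: apply $\theta'$ to $P$ and $Q$, replace $\theta$ by $\theta'\theta$, and, if $R_1$ has a row variable $\mu_1$ that is not also the row variable of $R_2$, put $\mu_1\leqslant R$ into $P$, where $R$ is $K_2'\setminus K_1'$ followed by the row variable of $R_2$ (if any). - If $K_1'\not\subseteq K_2'$: fail if $R_2$ has no row variable or the same one as $R_1$; otherwise let $\mu$ be fresh and $\theta''=[((K_1'\setminus K_2');\mu)/\mu_2]\theta'$, replace $\theta$ by $\theta''\theta$, $Q$ by $\theta''(Q\cup P)$, and $P$ by $\{\mu_1\leqslant(K_2'\setminus K_1');\mu\}$ if $R_1$ has a row variable $\mu_1$ and by $\emptyset$ otherwise. - It fails when the new $\theta$ creates a row with a duplicated label in $\theta P_0$. When $Q=\emptyset$, it computes the transitive closure of the linearity predicates in $\mathrm{factorise}(P)$ by adding them one at a time, fails if this contains $\circ\preceq\bullet$, and otherwise returns $(\theta,P)$. **Theorem (Correctness of constraint solving).** Let $P$ be a constraint set with well-formed rows that is generated by type inference, and let $N$ be a finite set of variables in use that contains those of $P$; fresh variables are chosen outside $N$ and distinct from each other. Then $\mathrm{solve}(P)$ always terminates: whatever the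 choices of predicates and fresh variables, there is no infinite run, and every maximal run fails or returns a result. Moreover: - if $\mathrm{solve}(P)$ fails, then $P$ is not satisfiable; - if $\mathrm{solve}(P)$ returns $(\theta,Q)$, then $P$ is satisfiable and $\mathrm{Sat}(P)=\mathrm{Sat}(Q)\theta$ (relative to $N$ and $P$). -/

import Mathlib

namespace Qeff

/-! ## Types, rows and predicates

The syntax is parametric in the names `ν` of type variables.  Type variables come in three kinds:
value type variables, row variables and linearity variables.  Labels and term variables are
natural numbers. -/

inductive Kind
  | ty
  | row
  | lin
  deriving DecidableEq

/-- Linearity types `Y ::= φ | • | ∘`. -/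
inductive Lin (ν : Type)
  | var (φ : ν)
  | unl
  | any
  deriving DecidableEq

/-- Concrete rows.  The parameter and result types of an operation are fixed by its label through
the global signature, so an entry `ℓ : A ↠^Y B` is recorded as `(ℓ, Y)`.  Multisets
identify rows up to reordering, but they still see duplicated labels. -/
abbrev CRow (ν : Type) := Multiset (ℕ × Lin ν)

/-- Row types: a concrete part, and possibly a row variable at the end. -/
structure Row (ν : Type) where
  labels : CRow ν
  tail : Option ν
  deriving DecidableEq

/-- Value types `A ::= α | A →^Y (B ! {R})`. -/
inductive Ty (ν : Type)
  | var (α : ν)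
  | arrow (A : Ty ν) (Y : Lin ν) (B : Ty ν) (R : Row ν)
  deriving DecidableEq

/-- Computation types `A ! {R}`. -/
structure CTy (ν : Type) where
  val : Ty ν
  eff : Row ν

/-- The category `τ ::= A | R | Y`. -/
inductive Typ (ν : Type)
  | val (A : Ty ν)
  | row (R : Row ν)
  | lin (Y : Lin ν)
  deriving DecidableEq

/-- Predicates `τ₁ ≼ τ₂`, `R₁ ⩽ R₂` and `R ⊥ L`. -/
inductive Pred (ν : Type)
  | lin (τ₁ τ₂ : Typ ν)
  | sub (R₁ R₂ : Row ν)
  | lack (R : Row ν) (L : Finset ℕ)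
  deriving DecidableEq

/-- Predicate sets over ordinary type variables. -/
abbrev PSet := Finset (Pred ℕ)

/-- The row consisting of just a row variable. -/
def Row.var {ν : Type} (μ : ν) : Row ν := ⟨0, some μ⟩

/-- The labels of a concrete row. -/
def CRow.dom {ν : Type} (K : CRow ν) : Finset ℕ := (K.map Prod.fst).toFinset

/-- `K \ K'`. -/
def CRow.diff {ν : Type} [DecidableEq ν] (K K' : CRow ν) : CRow ν := K.filter (fun e => e ∉ K')

/-! ## Free type variables -/

section FreeVariables

variable {ν : Type} [DecidableEq ν]

def Lin.fv : Lin ν → Finset (Kind × ν)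
  | .var φ => {(Kind.lin, φ)}
  | .unl => ∅
  | .any => ∅

def Row.fv (R : Row ν) : Finset (Kind × ν) :=
  R.labels.toFinset.biUnion (fun e => e.2.fv) ∪
    (match R.tail with
      | some μ => {(Kind.row, μ)}
      | none => ∅)

def Ty.fv : Ty ν → Finset (Kind × ν)
  | .var α => {(Kind.ty, α)}
  | .arrow A Y B R => A.fv ∪ Y.fv ∪ B.fv ∪ R.fv

def Typ.fv : Typ ν → Finset (Kind × ν)
  | .val A => A.fv
  | .row R => R.fv
  | .lin Y => Y.fv

def Pred.fv : Pred ν → Finset (Kind × ν)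
  | .lin τ₁ τ₂ => τ₁.fv ∪ τ₂.fv
  | .sub R₁ R₂ => R₁.fv ∪ R₂.fv
  | .lack R _ => R.fv

end FreeVariables

def PSet.fv (P : PSet) : Finset (Kind × ℕ) := P.biUnion Pred.fv

/-! ## Substitutions -/

/-- Kind-respecting simultaneous substitutions. -/
@[ext] structure Subst (ν ν' : Type) where
  ty : ν → Ty ν'
  row : ν → Row ν'
  lin : ν → Lin ν'

section Substitution

variable {ν ν' ν'' : Type}

def Lin.subst (θ : Subst ν ν') : Lin ν → Lin ν'
  | .var φ => θ.lin φ
  | .unl => .unl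
  | .any => .any

def CRow.subst (θ : Subst ν ν') (K : CRow ν) : CRow ν' :=
  K.map (fun e => (e.1, e.2.subst θ))

def Row.subst (θ : Subst ν ν') (R : Row ν) : Row ν' :=
  match R.tail with
  | some μ => ⟨CRow.subst θ R.labels + (θ.row μ).labels, (θ.row μ).tail⟩
  | none => ⟨CRow.subst θ R.labels, none⟩

def Ty.subst (θ : Subst ν ν') : Ty ν → Ty ν'
  | .var α => θ.ty α
  | .arrow A Y B R => .arrow (A.subst θ) (Y.subst θ) (B.subst θ) (R.subst θ)

def CTy.subst (θ : Subst ν ν') (C : CTy ν) : CTy ν' := ⟨C.val.subst θ, C.eff.subst θ⟩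

def Typ.subst (θ : Subst ν ν') : Typ ν → Typ ν'
  | .val A => .val (A.subst θ)
  | .row R => .row (R.subst θ)
  | .lin Y => .lin (Y.subst θ)

def Pred.subst (θ : Subst ν ν') : Pred ν → Pred ν'
  | .lin τ₁ τ₂ => .lin (τ₁.subst θ) (τ₂.subst θ)
  | .sub R₁ R₂ => .sub (R₁.subst θ) (R₂.subst θ)
  | .lack R L => .lack (R.subst θ) L

/-- The substitution that renames every variable. -/
def Subst.ren (f : Kind → ν → ν') : Subst ν ν' where
  ty α := .var (f .ty α)
  row μ := .var (f .row μ)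
  lin φ := .var (f .lin φ)

/-- The identity substitution `ι`. -/
def Subst.id : Subst ν ν := Subst.ren (fun _ x => x)

/-- `θ'.comp θ` is the composition `θ'θ`: first `θ`, then `θ'`. -/
def Subst.comp (θ' : Subst ν' ν'') (θ : Subst ν ν') : Subst ν ν'' where
  ty α := (θ.ty α).subst θ'
  row μ := (θ.row μ).subst θ'
  lin φ := (θ.lin φ).subst θ'

variable [DecidableEq ν]

/-- `[A/α]`. -/
def Subst.oneTy (α : ν) (A : Ty ν) : Subst ν ν :=
  { Subst.id with ty := Function.update Subst.id.ty α A }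

/-- `[R/μ]`. -/
def Subst.oneRow (μ : ν) (R : Row ν) : Subst ν ν :=
  { Subst.id with row := Function.update Subst.id.row μ R }

/-- `[Y/φ]`. -/
def Subst.oneLin (φ : ν) (Y : Lin ν) : Subst ν ν :=
  { Subst.id with lin := Function.update Subst.id.lin φ Y }

end Substitution

def PSet.subst (θ : Subst ℕ ℕ) (P : PSet) : PSet := P.image (Pred.subst θ)

/-- Two substitutions agree on a set of type variables. -/
def Subst.AgreeOn (N : Finset (Kind × ℕ)) (s t : Subst ℕ ℕ) : Prop :=
  (∀ α, (Kind.ty, α) ∈ N → s.ty α = t.ty α) ∧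
  (∀ μ, (Kind.row, μ) ∈ N → s.row μ = t.row μ) ∧
  (∀ φ, (Kind.lin, φ) ∈ N → s.lin φ = t.lin φ)

/-! ## Well-formedness: no duplicated labels in a row -/

section WellFormed

variable {ν : Type}

def Row.WF (R : Row ν) : Prop := (R.labels.map Prod.fst).Nodup

def Ty.WF : Ty ν → Prop
  | .var _ => True
  | .arrow A _ B R => A.WF ∧ B.WF ∧ R.WF

def Typ.WF : Typ ν → Prop
  | .val A => A.WF
  | .row R => R.WF
  | .lin _ => True

def Pred.WF : Pred ν → Prop
  | .lin τ₁ τ₂ => τ₁.WF ∧ τ₂.WF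
  | .sub R₁ R₂ => R₁.WF ∧ R₂.WF
  | .lack R _ => R.WF

end WellFormed

def PSet.WF (P : PSet) : Prop := ∀ π ∈ P, π.WF

def Subst.WF (s : Subst ℕ ℕ) : Prop := (∀ α, (s.ty α).WF) ∧ ∀ μ, (s.row μ).WF

/-! ## Entailment and solutions -/

/-- `rowset R₁ ⊆ rowset R₂`, where the elements of a row are its labels with their
signatures and its row variable. -/
def Row.Sub {ν : Type} (R₁ R₂ : Row ν) : Prop :=
  (∀ e ∈ R₁.labels, e ∈ R₂.labels) ∧ ∀ μ, R₁.tail = some μ → R₂.tail = some μ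

/-- The entailment `P ⊢ π`.  The rules for functions and for rows go both ways. -/
inductive Entails (P : PSet) : Pred ℕ → Prop
  | subsume {π : Pred ℕ} : π ∈ P → Entails P π
  | refl (τ : Typ ℕ) : Entails P (.lin τ τ)
  | lin (τ : Typ ℕ) : Entails P (.lin τ (.lin .any))
  | unl (τ : Typ ℕ) : Entails P (.lin (.lin .unl) τ)
  | func {A : Ty ℕ} {Y : Lin ℕ} {B : Ty ℕ} {R : Row ℕ} {τ : Typ ℕ} :
      Entails P (.lin (.lin Y) τ) → Entails P (.lin (.val (.arrow A Y B R)) τ)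
  | func_inv {A : Ty ℕ} {Y : Lin ℕ} {B : Ty ℕ} {R : Row ℕ} {τ : Typ ℕ} :
      Entails P (.lin (.val (.arrow A Y B R)) τ) → Entails P (.lin (.lin Y) τ)
  | row {τ : Typ ℕ} {R : Row ℕ} :
      (∀ e ∈ R.labels, Entails P (.lin τ (.lin e.2))) →
      (∀ μ, R.tail = some μ → Entails P (.lin τ (.row (Row.var μ)))) →
      Entails P (.lin τ (.row R))
  | row_inv_label {τ : Typ ℕ} {R : Row ℕ} {e : ℕ × Lin ℕ} :
      e ∈ R.labels → Entails P (.lin τ (.row R)) → Entails P (.lin τ (.lin e.2))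
  | row_inv_tail {τ : Typ ℕ} {R : Row ℕ} {μ : ℕ} :
      R.tail = some μ → Entails P (.lin τ (.row R)) → Entails P (.lin τ (.row (Row.var μ)))
  | sub {R₁ R₂ : Row ℕ} : R₁.Sub R₂ → Entails P (.sub R₁ R₂)
  | lack {R : Row ℕ} {L : Finset ℕ} : Disjoint (CRow.dom R.labels) L → Entails P (.lack R L)

/-- `P ⊢ Q`. -/
def EntailsSet (P Q : PSet) : Prop := ∀ π ∈ Q, Entails P π

/-- `s` is a well-formed substitution, and it creates no duplicated labels in the rows of `P`. -/
def Subst.WFFor (s : Subst ℕ ℕ) (P : PSet) : Prop := s.WF ∧ (PSet.subst s P).WF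

/-- The solutions of `P`: the substitutions `s` with `· ⊢ sP`, where all rows are
well-formed. -/
def Sat (P : PSet) : Set (Subst ℕ ℕ) :=
  {s | s.WFFor P ∧ EntailsSet ∅ (PSet.subst s P)}

def Satisfiable (P : PSet) : Prop := (Sat P).Nonempty

/-- The set of compositions `tθ` with `t ∈ T`, as substitutions for the constraint set `P`:
all rows are well-formed, and only the variables in `N` count. -/
def composeSet (N : Finset (Kind × ℕ)) (P : PSet) (T : Set (Subst ℕ ℕ)) (θ : Subst ℕ ℕ) :
    Set (Subst ℕ ℕ) :=
  {s | s.WFFor P ∧ ∃ t ∈ T, s.AgreeOn N (t.comp θ)}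

/-! ## Factorisation -/

/-- Factorisation of `τ ≼ τ'` when neither side can be decomposed. -/
def factAtom (τ τ' : Typ ℕ) : PSet :=
  if τ = τ' ∨ τ' = .lin .any ∨ τ = .lin .unl then ∅ else {.lin τ τ'}

/-- Factorisation of `τ ≼ τ'` when the left side cannot be decomposed. -/
def factRight (τ τ' : Typ ℕ) : PSet :=
  if τ = τ' ∨ τ' = .lin .any ∨ τ = .lin .unl then ∅ else
  match τ' with
  | .row R =>
      R.labels.toFinset.biUnion (fun e => factAtom τ (.lin e.2)) ∪
        (match R.tail with
          | some μ => factAtom τ (.row (Row.var μ))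
          | none => ∅)
  | τ' => factAtom τ τ'

def factLin (τ τ' : Typ ℕ) : PSet :=
  if τ = τ' ∨ τ' = .lin .any ∨ τ = .lin .unl then ∅ else
  match τ with
  | .val (.arrow _ Y _ _) => factRight (.lin Y) τ'
  | τ => factRight τ τ'

instance (R₁ R₂ : Row ℕ) : Decidable (R₁.Sub R₂) :=
  decidable_of_iff ((∀ e ∈ R₁.labels, e ∈ R₂.labels) ∧
      (R₁.tail = none ∨ R₁.tail = R₂.tail)) (by
    unfold Row.Sub
    refine and_congr_right (fun _ => ?_)
    cases R₁.tail <;> simp [eq_comm])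

def factorise : Pred ℕ → PSet
  | .lin τ τ' => factLin τ τ'
  | .sub R₁ R₂ => if R₁.Sub R₂ then ∅ else {.sub R₁ R₂}
  | .lack R L => if Disjoint (CRow.dom R.labels) L then ∅ else {.lack R L}

def factoriseSet (P : PSet) : PSet := P.biUnion factorise

/-! ## Unification of linearity types and of shared labels -/

/-- Unification of two linearity types; `none` is failure. -/
def ulin : Lin ℕ → Lin ℕ → Option (Subst ℕ ℕ)
  | .unl, .unl => some Subst.id
  | .any, .any => some Subst.id
  | .unl, .any => none
  | .any, .unl => none
  | .var φ, Y => if Y = .var φ then some Subst.id else some (Subst.oneLin φ Y)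
  | Y, .var φ => some (Subst.oneLin φ Y)

/-- `ULab K₁ K₂ r`: unifying the linearities of the shared labels of `K₁` and `K₂` can
return `r`, where `none` is failure.  Rows are unordered, so shared labels may be met in any
order. -/
inductive ULab : CRow ℕ → CRow ℕ → Option (Subst ℕ ℕ) → Prop
  | nil_left (K : CRow ℕ) : ULab 0 K (some Subst.id)
  | nil_right (K : CRow ℕ) : ULab K 0 (some Subst.id)
  | shared {ℓ : ℕ} {Y₁ Y₂ : Lin ℕ} {K₁ K₂ : CRow ℕ} {θ : Subst ℕ ℕ} {r : Option (Subst ℕ ℕ)} :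
      ulin Y₁ Y₂ = some θ →
      ULab (CRow.subst θ K₁) (CRow.subst θ K₂) r →
      ULab ((ℓ, Y₁) ::ₘ K₁) ((ℓ, Y₂) ::ₘ K₂) (r.map (fun θ' => θ'.comp θ))
  | clash {ℓ : ℕ} {Y₁ Y₂ : Lin ℕ} {K₁ K₂ : CRow ℕ} :
      ulin Y₁ Y₂ = none → ULab ((ℓ, Y₁) ::ₘ K₁) ((ℓ, Y₂) ::ₘ K₂) none
  | skip_left {ℓ : ℕ} {Y : Lin ℕ} {K₁ K₂ : CRow ℕ} {r : Option (Subst ℕ ℕ)} :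
      ℓ ∉ CRow.dom K₂ → ULab K₁ K₂ r → ULab ((ℓ, Y) ::ₘ K₁) K₂ r
  | skip_right {ℓ : ℕ} {Y : Lin ℕ} {K₁ K₂ : CRow ℕ} {r : Option (Subst ℕ ℕ)} :
      ℓ ∉ CRow.dom K₁ → ULab K₁ K₂ r → ULab K₁ ((ℓ, Y) ::ₘ K₂) r

/-! ## The constraint solver

The solver is a transition system.  `run N θ P Q` is a call of the row solver with current
substitution `θ`, solved predicates `P` and unsolved predicates `Q`; `N` holds the variables
used so far.  `close θ Q T W` computes the transitive closure `T` of the linearity predicates of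
the factorised set, of which `W` is still to be processed. -/

inductive Config
  | run (N : Finset (Kind × ℕ)) (θ : Subst ℕ ℕ) (P Q : PSet)
  | close (θ : Subst ℕ ℕ) (Q : PSet) (T : Finset (Typ ℕ × Typ ℕ)) (W : PSet)
  | done (θ : Subst ℕ ℕ) (Q : PSet)
  | fail

/-- The case `K₁;t₁ ⩽ K₂;t₂` of the row solver, after the shared labels have been unified by
`θ'`.  `P` and `Q` are the solved predicates and the remaining unsolved ones, and `μ` is the fresh
row variable.  `none` is failure. -/
def subCase (θ : Subst ℕ ℕ) (P Q : PSet) (μ : ℕ) (K₁ : CRow ℕ) (t₁ : Option ℕ) (K₂ : CRow ℕ)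
    (t₂ : Option ℕ) (θ' : Subst ℕ ℕ) : Option (Subst ℕ ℕ × PSet × PSet) :=
  let K₁' := CRow.subst θ' K₁
  let K₂' := CRow.subst θ' K₂
  let P' := PSet.subst θ' P
  let Q' := PSet.subst θ' Q
  match t₁, t₂ with
  | none, none =>
      if ∀ e ∈ K₁', e ∈ K₂' then some (θ'.comp θ, P', Q') else none
  | some μ₁, none =>
      if ∀ e ∈ K₁', e ∈ K₂' then
        some (θ'.comp θ, insert (.sub (Row.var μ₁) ⟨CRow.diff K₂' K₁', none⟩) P', Q')
      else none
  | none, some μ₂ =>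
      if ∀ e ∈ K₁', e ∈ K₂' then some (θ'.comp θ, P', Q')
      else
        let θ'' := (Subst.oneRow μ₂ ⟨CRow.diff K₁' K₂', some μ⟩).comp θ'
        some (θ''.comp θ, ∅, PSet.subst θ'' (Q ∪ P))
  | some μ₁, some μ₂ =>
      if μ₁ = μ₂ then
        if ∀ e ∈ K₁', e ∈ K₂' then some (θ'.comp θ, P', Q') else none
      else if ∀ e ∈ K₁', e ∈ K₂' then
        some (θ'.comp θ, insert (.sub (Row.var μ₁) ⟨CRow.diff K₂' K₁', some μ₂⟩) P', Q')
      else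
        let θ'' := (Subst.oneRow μ₂ ⟨CRow.diff K₁' K₂', some μ⟩).comp θ'
        some (θ''.comp θ, {.sub (Row.var μ₁) ⟨CRow.diff K₂' K₁', some μ⟩},
          PSet.subst θ'' (Q ∪ P))

/-- One unfolding of the row solver, by cases on the predicate it looks at. -/
inductive RowStep (θ : Subst ℕ ℕ) (P Q : PSet) (μ : ℕ) :
    Pred ℕ → Option (Subst ℕ ℕ × PSet × PSet) → Prop
  | lin (τ₁ τ₂ : Typ ℕ) : RowStep θ P Q μ (.lin τ₁ τ₂) (some (θ, insert (.lin τ₁ τ₂) P, Q))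
  | sub {K₁ K₂ : CRow ℕ} {t₁ t₂ : Option ℕ} {r : Option (Subst ℕ ℕ)} :
      ULab K₁ K₂ r →
      RowStep θ P Q μ (.sub ⟨K₁, t₁⟩ ⟨K₂, t₂⟩) (r.bind (subCase θ P Q μ K₁ t₁ K₂ t₂))
  | lack_closed (K : CRow ℕ) (L : Finset ℕ) :
      RowStep θ P Q μ (.lack ⟨K, none⟩ L)
        (if Disjoint (CRow.dom K) L then some (θ, P, Q) else none)
  | lack_open (K : CRow ℕ) (μ₁ : ℕ) (L : Finset ℕ) :
      RowStep θ P Q μ (.lack ⟨K, some μ₁⟩ L)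
        (if Disjoint (CRow.dom K) L then some (θ, insert (.lack (Row.var μ₁) L) P, Q) else none)

/-- Add the pair `τ₁ ≼ τ₂` to a transitively closed relation `T`. -/
def closeStep (T : Finset (Typ ℕ × Typ ℕ)) (τ₁ τ₂ : Typ ℕ) : Finset (Typ ℕ × Typ ℕ) :=
  let T' := T ∪ {(τ₁, τ₁), (τ₂, τ₂)}
  T ∪ ((T'.filter (fun p => p.2 = τ₁)).image Prod.fst) ×ˢ
    ((T'.filter (fun p => p.1 = τ₂)).image Prod.snd)

/-- The transitions of the solver for the constraint set `P₀`.  As all rows have to be well-formed,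
it also fails when the current substitution duplicates a label in some row of `P₀`. -/
inductive Step (P₀ : PSet) : Config → Config → Prop
  | row {N : Finset (Kind × ℕ)} {θ θ' : Subst ℕ ℕ} {P P' Q Q' : PSet} {π : Pred ℕ} {μ : ℕ} :
      π ∈ Q → (Kind.row, μ) ∉ N →
      RowStep θ P (Q.erase π) μ π (some (θ', P', Q')) →
      (PSet.subst θ' P₀).WF →
      Step P₀ (.run N θ P Q) (.run (insert (Kind.row, μ) N) θ' P' Q')
  | row_fail {N : Finset (Kind × ℕ)} {θ : Subst ℕ ℕ} {P Q : PSet} {π : Pred ℕ} {μ : ℕ} :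
      π ∈ Q → (Kind.row, μ) ∉ N →
      RowStep θ P (Q.erase π) μ π none →
      Step P₀ (.run N θ P Q) .fail
  | row_dup {N : Finset (Kind × ℕ)} {θ θ' : Subst ℕ ℕ} {P P' Q Q' : PSet} {π : Pred ℕ} {μ : ℕ} :
      π ∈ Q → (Kind.row, μ) ∉ N →
      RowStep θ P (Q.erase π) μ π (some (θ', P', Q')) →
      ¬ (PSet.subst θ' P₀).WF →
      Step P₀ (.run N θ P Q) .fail
  | row_done {N : Finset (Kind × ℕ)} {θ : Subst ℕ ℕ} {P : PSet} :
      Step P₀ (.run N θ P ∅) (.close θ P ∅ (factoriseSet P))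
  | close_lin {θ : Subst ℕ ℕ} {Q W : PSet} {T : Finset (Typ ℕ × Typ ℕ)} {τ₁ τ₂ : Typ ℕ} :
      Pred.lin τ₁ τ₂ ∈ W →
      Step P₀ (.close θ Q T W) (.close θ Q (closeStep T τ₁ τ₂) (W.erase (.lin τ₁ τ₂)))
  | close_sub {θ : Subst ℕ ℕ} {Q W : PSet} {T : Finset (Typ ℕ × Typ ℕ)} {R₁ R₂ : Row ℕ} :
      Pred.sub R₁ R₂ ∈ W →
      Step P₀ (.close θ Q T W) (.close θ Q T (W.erase (.sub R₁ R₂)))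
  | close_lack {θ : Subst ℕ ℕ} {Q W : PSet} {T : Finset (Typ ℕ × Typ ℕ)} {R : Row ℕ}
      {L : Finset ℕ} :
      Pred.lack R L ∈ W →
      Step P₀ (.close θ Q T W) (.close θ Q T (W.erase (.lack R L)))
  | accept {θ : Subst ℕ ℕ} {Q : PSet} {T : Finset (Typ ℕ × Typ ℕ)} :
      (Typ.lin Lin.any, Typ.lin Lin.unl) ∉ T →
      Step P₀ (.close θ Q T ∅) (.done θ Q)
  | reject {θ : Subst ℕ ℕ} {Q : PSet} {T : Finset (Typ ℕ × Typ ℕ)} :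
      (Typ.lin Lin.any, Typ.lin Lin.unl) ∈ T →
      Step P₀ (.close θ Q T ∅) .fail

/-- The call `solve(P)`, in a context where the variables in `N` are in use. -/
def solveInit (N : Finset (Kind × ℕ)) (P : PSet) : Config := .run N Subst.id ∅ P

/-- `solve(P)` always terminates: there is no infinite run, whatever the choices of predicates and
fresh variables, and no run gets stuck before it fails or returns a result. -/
def SolveTerminates (N : Finset (Kind × ℕ)) (P : PSet) : Prop :=
  Acc (fun c' c => Step P c c') (solveInit N P) ∧
  ∀ c, Relation.ReflTransGen (Step P) (solveInit N P) c →
    (∃ c', Step P c c') ∨ c = .fail ∨ ∃ θ Q, c = .done θ Q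

/-- `solve(P)` fails. -/
def SolveFails (N : Finset (Kind × ℕ)) (P : PSet) : Prop :=
  Relation.ReflTransGen (Step P) (solveInit N P) .fail

/-- `solve(P)` returns `(θ, Q)`. -/
def SolveReturns (N : Finset (Kind × ℕ)) (P : PSet) (θ : Subst ℕ ℕ) (Q : PSet) : Prop :=
  Relation.ReflTransGen (Step P) (solveInit N P) (.done θ Q)

/-! ## Unification -/

/-- Unification predicates. -/
inductive UEq
  | val (A B : Ty ℕ)
  | comp (C D : CTy ℕ)
  | row (R R' : Row ℕ)
  | lin (Y Y' : Lin ℕ)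

def UEq.subst (θ : Subst ℕ ℕ) : UEq → UEq
  | .val A B => .val (A.subst θ) (B.subst θ)
  | .comp C D => .comp (C.subst θ) (D.subst θ)
  | .row R R' => .row (R.subst θ) (R'.subst θ)
  | .lin Y Y' => .lin (Y.subst θ) (Y'.subst θ)

/-- `Unify N U θ N'`: unification of `U` succeeds with `θ`; the variables in use are `N` before
and `N'` after. -/
inductive Unify : Finset (Kind × ℕ) → List UEq → Subst ℕ ℕ → Finset (Kind × ℕ) → Prop
  | nil {N : Finset (Kind × ℕ)} : Unify N [] Subst.id N
  | var_refl {N N' : Finset (Kind × ℕ)} {U : List UEq} {θ : Subst ℕ ℕ} {α : ℕ} :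
      Unify N U θ N' → Unify N (.val (.var α) (.var α) :: U) θ N'
  | var_left {N N' : Finset (Kind × ℕ)} {U : List UEq} {θ : Subst ℕ ℕ} {α : ℕ} {A : Ty ℕ} :
      (Kind.ty, α) ∉ A.fv →
      Unify N (U.map (UEq.subst (Subst.oneTy α A))) θ N' →
      Unify N (.val (.var α) A :: U) (θ.comp (Subst.oneTy α A)) N'
  | var_right {N N' : Finset (Kind × ℕ)} {U : List UEq} {θ : Subst ℕ ℕ} {α : ℕ} {A : Ty ℕ} :
      Unify N (.val (.var α) A :: U) θ N' → Unify N (.val A (.var α) :: U) θ N'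
  | comp {N N' : Finset (Kind × ℕ)} {U : List UEq} {θ : Subst ℕ ℕ} {C D : CTy ℕ} :
      Unify N (.val C.val D.val :: .row C.eff D.eff :: U) θ N' →
      Unify N (.comp C D :: U) θ N'
  | arrow {N N' : Finset (Kind × ℕ)} {U : List UEq} {θ : Subst ℕ ℕ} {A A' B B' : Ty ℕ}
      {Y Y' : Lin ℕ} {R R' : Row ℕ} :
      Unify N (.val A A' :: .comp ⟨B, R⟩ ⟨B', R'⟩ :: .lin Y Y' :: U) θ N' →
      Unify N (.val (.arrow A Y B R) (.arrow A' Y' B' R') :: U) θ N'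
  | lin {N N' : Finset (Kind × ℕ)} {U : List UEq} {θ θ' : Subst ℕ ℕ} {Y Y' : Lin ℕ} :
      ulin Y Y' = some θ →
      Unify N (U.map (UEq.subst θ)) θ' N' →
      Unify N (.lin Y Y' :: U) (θ'.comp θ) N'
  | row_closed {N N' : Finset (Kind × ℕ)} {U : List UEq} {θ θ' : Subst ℕ ℕ} {K₁ K₂ : CRow ℕ} :
      ULab K₁ K₂ (some θ) →
      (∀ e, e ∈ CRow.subst θ K₁ ↔ e ∈ CRow.subst θ K₂) →
      Unify N (U.map (UEq.subst θ)) θ' N' →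
      Unify N (.row ⟨K₁, none⟩ ⟨K₂, none⟩ :: U) (θ'.comp θ) N'
  | row_same_tail {N N' : Finset (Kind × ℕ)} {U : List UEq} {θ θ' : Subst ℕ ℕ} {K₁ K₂ : CRow ℕ}
      {μ : ℕ} :
      ULab K₁ K₂ (some θ) →
      (∀ e, e ∈ CRow.subst θ K₁ ↔ e ∈ CRow.subst θ K₂) →
      Unify N (U.map (UEq.subst θ)) θ' N' →
      Unify N (.row ⟨K₁, some μ⟩ ⟨K₂, some μ⟩ :: U) (θ'.comp θ) N'
  | row_open_closed {N N' : Finset (Kind × ℕ)} {U : List UEq} {θ θ' θ'' : Subst ℕ ℕ}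
      {K₁ K₂ : CRow ℕ} {μ₁ : ℕ} :
      ULab K₁ K₂ (some θ) →
      (∀ e ∈ CRow.subst θ K₁, e ∈ CRow.subst θ K₂) →
      θ' = Subst.oneRow μ₁ ⟨CRow.diff (CRow.subst θ K₂) (CRow.subst θ K₁), none⟩ →
      Unify N (U.map (UEq.subst (θ'.comp θ))) θ'' N' →
      Unify N (.row ⟨K₁, some μ₁⟩ ⟨K₂, none⟩ :: U) (θ''.comp (θ'.comp θ)) N'
  | row_closed_open {N N' : Finset (Kind × ℕ)} {U : List UEq} {θ : Subst ℕ ℕ}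
      {K₁ K₂ : CRow ℕ} {μ₁ : ℕ} :
      Unify N (.row ⟨K₁, some μ₁⟩ ⟨K₂, none⟩ :: U) θ N' →
      Unify N (.row ⟨K₂, none⟩ ⟨K₁, some μ₁⟩ :: U) θ N'
  | row_open {N N' : Finset (Kind × ℕ)} {U : List UEq} {θ θ' θ'' : Subst ℕ ℕ}
      {K₁ K₂ : CRow ℕ} {μ₁ μ₂ μ : ℕ} :
      μ₁ ≠ μ₂ →
      ULab K₁ K₂ (some θ) →
      (Kind.row, μ) ∉ N →
      θ' = (Subst.oneRow μ₁ ⟨CRow.diff (CRow.subst θ K₂) (CRow.subst θ K₁), some μ⟩).comp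
        (Subst.oneRow μ₂ ⟨CRow.diff (CRow.subst θ K₁) (CRow.subst θ K₂), some μ⟩) →
      Unify (insert (Kind.row, μ) N) (U.map (UEq.subst (θ'.comp θ))) θ'' N' →
      Unify N (.row ⟨K₁, some μ₁⟩ ⟨K₂, some μ₂⟩ :: U) (θ''.comp (θ'.comp θ)) N'

/-! ## Type schemes and contexts -/

/-- Type schemes `∀ ᾱ. P ⇒ A`.  Variables `Sum.inl n` are free and variables `Sum.inr n` are bound
by the quantifier prefix. -/
structure Scheme where
  quals : Finset (Pred (ℕ ⊕ ℕ))
  body : Ty (ℕ ⊕ ℕ)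

/-- All variables that occur in a scheme. -/
def Scheme.vars (σ : Scheme) : Finset (Kind × (ℕ ⊕ ℕ)) := σ.quals.biUnion Pred.fv ∪ σ.body.fv

/-- The free variables of a scheme. -/
def Scheme.fv (σ : Scheme) : Finset (Kind × ℕ) :=
  σ.vars.biUnion (fun x => match x with
    | (k, .inl n) => {(k, n)}
    | (_, .inr _) => ∅)

/-- The quantified variables of a scheme. -/
def Scheme.bv (σ : Scheme) : Finset (Kind × ℕ) :=
  σ.vars.biUnion (fun x => match x with
    | (k, .inr n) => {(k, n)}
    | (_, .inl _) => ∅)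

/-- A substitution of free variables, which leaves bound variables alone. -/
def Subst.lift (θ : Subst ℕ ℕ) : Subst (ℕ ⊕ ℕ) (ℕ ⊕ ℕ) where
  ty := Sum.elim (fun n => (θ.ty n).subst (Subst.ren (fun _ => Sum.inl))) (fun n => .var (.inr n))
  row := Sum.elim (fun n => (θ.row n).subst (Subst.ren (fun _ => Sum.inl)))
    (fun n => .var (.inr n))
  lin := Sum.elim (fun n => (θ.lin n).subst (Subst.ren (fun _ => Sum.inl)))
    (fun n => .var (.inr n))

def Scheme.subst (θ : Subst ℕ ℕ) (σ : Scheme) : Scheme :=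
  ⟨σ.quals.image (Pred.subst θ.lift), σ.body.subst θ.lift⟩

/-- A value type as a scheme without quantifiers and qualifiers. -/
def Scheme.mono (A : Ty ℕ) : Scheme := ⟨∅, A.subst (Subst.ren (fun _ => Sum.inl))⟩

/-- The substitution that renames the bound variables to `f`. -/
def instSubst (f : Kind → ℕ → ℕ) : Subst (ℕ ⊕ ℕ) ℕ :=
  Subst.ren (fun k => Sum.elim (fun n => n) (f k))

def Scheme.instQuals (f : Kind → ℕ → ℕ) (σ : Scheme) : PSet :=
  σ.quals.image (Pred.subst (instSubst f))

def Scheme.instBody (f : Kind → ℕ → ℕ) (σ : Scheme) : Ty ℕ := σ.body.subst (instSubst f)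

/-- `f` names the bound variables of `σ` by distinct variables outside `N`. -/
def FreshInst (N : Finset (Kind × ℕ)) (σ : Scheme) (f : Kind → ℕ → ℕ) : Prop :=
  (∀ x ∈ σ.bv, (x.1, f x.1 x.2) ∉ N) ∧
  ∀ x ∈ σ.bv, ∀ y ∈ σ.bv, x.1 = y.1 → f x.1 x.2 = f y.1 y.2 → x = y

/-- The names that `f` gives to the bound variables of `σ`. -/
def freshNames (σ : Scheme) (f : Kind → ℕ → ℕ) : Finset (Kind × ℕ) :=
  σ.bv.image (fun x => (x.1, f x.1 x.2))

/-- Type contexts. -/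
abbrev Env := List (ℕ × Scheme)

def Env.dom (Γ : Env) : Finset ℕ := (Γ.map Prod.fst).toFinset

def Env.fv : Env → Finset (Kind × ℕ)
  | [] => ∅
  | (_, σ) :: Γ => σ.fv ∪ Env.fv Γ

def Env.subst (θ : Subst ℕ ℕ) (Γ : Env) : Env := Γ.map (fun p => (p.1, p.2.subst θ))

/-- `Γ|_S`. -/
def Env.restrict (Γ : Env) (S : Finset ℕ) : Env := Γ.filter (fun p => p.1 ∈ S)

/-- `Γ` restricted to the complement of `S`. -/
def Env.unused (Γ : Env) (S : Finset ℕ) : Env := Γ.filter (fun p => p.1 ∉ S)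

/-- `gen(Γ, P ⇒ A)`: quantify the variables that are not free in `Γ`. -/
def gen (Γ : Env) (P : PSet) (A : Ty ℕ) : Scheme :=
  let g : Subst ℕ (ℕ ⊕ ℕ) :=
    Subst.ren (fun k n => if (k, n) ∈ Env.fv Γ then Sum.inl n else Sum.inr n)
  ⟨P.image (Pred.subst g), A.subst g⟩

/-- `MakeLeq N Γ τ Q N'`: the factorisation of `Γ ≼ τ` is `Q`; quantified variables of `Γ` are
instantiated by fresh ones. -/
inductive MakeLeq : Finset (Kind × ℕ) → Env → Typ ℕ → PSet → Finset (Kind × ℕ) → Prop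
  | nil {N : Finset (Kind × ℕ)} {τ : Typ ℕ} : MakeLeq N [] τ ∅ N
  | cons {N N' : Finset (Kind × ℕ)} {x : ℕ} {σ : Scheme} {Γ : Env} {τ : Typ ℕ} {Q : PSet}
      {f : Kind → ℕ → ℕ} :
      FreshInst N σ f →
      MakeLeq (N ∪ freshNames σ f) Γ τ Q N' →
      MakeLeq N ((x, σ) :: Γ) τ
        (factoriseSet (σ.instQuals f) ∪ factorise (.lin (.val (σ.instBody f)) τ) ∪ Q) N'

/-- The factorisation of `Γ ≼ •`. -/
def MakeUnl (N : Finset (Kind × ℕ)) (Γ : Env) (Q : PSet) (N' : Finset (Kind × ℕ)) : Prop :=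
  MakeLeq N Γ (.lin .unl) Q N'

/-! ## Terms -/

mutual

inductive Val
  | var (x : ℕ)
  | lam (x : ℕ) (M : Comp)

inductive Comp
  | app (V W : Val)
  | ret (V : Val)
  | perform (ℓ : ℕ) (V : Val)
  | letval (x : ℕ) (V : Val) (M : Comp)
  | seq (x : ℕ) (M N : Comp)
  | handle (M : Comp) (H : Handler)

/-- A handler: the clause `return x ↦ M` and the operation clauses. -/
inductive Handler
  | mk (x : ℕ) (M : Comp) (cs : Clauses)

/-- Operation clauses `ℓ p r ↦ M`. -/
inductive Clauses
  | nil
  | cons (ℓ p r : ℕ) (M : Comp) (cs : Clauses)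

end

/-! ## Type inference -/

/-- The global context that gives the parameter and result types of the operations. -/
abbrev Sig := List (ℕ × (Ty ℕ × Ty ℕ))

def Sig.fv : Sig → Finset (Kind × ℕ)
  | [] => ∅
  | (_, A, B) :: S => A.fv ∪ B.fv ∪ Sig.fv S

/-- What the inference for an operation clause `ℓ p r ↦ M` records: the signature of `ℓ`, the fresh
linearity variable `φ`, the predicates and the used term variables. -/
structure OpInfo where
  label : ℕ
  param : ℕ
  resume : ℕ
  argTy : Ty ℕ
  resTy : Ty ℕ
  φ : ℕ
  preds : PSet
  used : Finset ℕ

/-- The context `p : A_ℓ, r : B_ℓ →^φ D` of an operation clause. -/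
def OpInfo.env (i : OpInfo) (D : CTy ℕ) : Env :=
  [(i.param, Scheme.mono i.argTy),
    (i.resume, Scheme.mono (.arrow i.resTy (.var i.φ) D.val D.eff))]

mutual

/-- `InferV S N Γ V A θ P Σ N'`: from `Γ` and `V`, inference produces the type `A`, the
substitution `θ`, the predicate set `P` and the set `Σ` of used term variables.  `N` and `N'` hold
the type variables in use before and after. -/
inductive InferV (S : Sig) : Finset (Kind × ℕ) → Env → Val → Ty ℕ → Subst ℕ ℕ → PSet →
    Finset ℕ → Finset (Kind × ℕ) → Prop
  | var {N : Finset (Kind × ℕ)} {Γ : Env} {x : ℕ} {σ : Scheme} {f : Kind → ℕ → ℕ} :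
      Γ.lookup x = some σ →
      FreshInst N σ f →
      InferV S N Γ (.var x) (σ.instBody f) Subst.id (σ.instQuals f) {x} (N ∪ freshNames σ f)
  | lam {N N₁ N₂ N₃ : Finset (Kind × ℕ)} {Γ : Env} {x α φ : ℕ} {M : Comp} {C : CTy ℕ}
      {θ : Subst ℕ ℕ} {P Q₁ Q₂ : PSet} {used : Finset ℕ} :
      x ∉ Env.dom Γ →
      (Kind.ty, α) ∉ N → (Kind.lin, φ) ∉ N →
      InferC S ({(Kind.ty, α), (Kind.lin, φ)} ∪ N) ((x, Scheme.mono (.var α)) :: Γ) M C θ P used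
        N₁ →
      MakeLeq N₁ (Env.restrict (Env.subst θ Γ) used) (.lin (.var φ)) Q₁ N₂ →
      MakeUnl N₂ (Env.unused (Env.subst θ [(x, Scheme.mono (.var α))]) used) Q₂ N₃ →
      InferV S N Γ (.lam x M) (.arrow (θ.ty α) (.var φ) C.val C.eff) θ (P ∪ (Q₁ ∪ Q₂))
        (used.erase x) N₃

/-- Inference for computations. -/
inductive InferC (S : Sig) : Finset (Kind × ℕ) → Env → Comp → CTy ℕ → Subst ℕ ℕ → PSet →
    Finset ℕ → Finset (Kind × ℕ) → Prop
  | app {N N₁ N₂ N₃ N₄ : Finset (Kind × ℕ)} {Γ : Env} {V W : Val} {A B : Ty ℕ}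
      {θ₁ θ₂ θ₃ : Subst ℕ ℕ} {P₁ P₂ Q : PSet} {used₁ used₂ : Finset ℕ} {α μ φ : ℕ} :
      InferV S N Γ V A θ₁ P₁ used₁ N₁ →
      InferV S N₁ (Env.subst θ₁ Γ) W B θ₂ P₂ used₂ N₂ →
      (Kind.ty, α) ∉ N₂ → (Kind.row, μ) ∉ N₂ → (Kind.lin, φ) ∉ N₂ →
      Unify ({(Kind.ty, α), (Kind.row, μ), (Kind.lin, φ)} ∪ N₂)
        [.val (A.subst θ₂) (.arrow B (.var φ) (.var α) (Row.var μ))] θ₃ N₃ →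
      MakeUnl N₃ (Env.restrict (Env.subst θ₃ (Env.subst θ₂ (Env.subst θ₁ Γ))) (used₁ ∩ used₂)) Q
        N₄ →
      InferC S N Γ (.app V W) (CTy.subst θ₃ ⟨.var α, Row.var μ⟩) (θ₃.comp (θ₂.comp θ₁))
        (PSet.subst θ₃ (PSet.subst θ₂ P₁ ∪ P₂) ∪ Q) (used₁ ∪ used₂) N₄
  | ret {N N₁ : Finset (Kind × ℕ)} {Γ : Env} {V : Val} {A : Ty ℕ} {θ : Subst ℕ ℕ} {P : PSet}
      {used : Finset ℕ} {μ : ℕ} :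
      InferV S N Γ V A θ P used N₁ →
      (Kind.row, μ) ∉ N₁ →
      InferC S N Γ (.ret V) ⟨A, Row.var μ⟩ θ P used (insert (Kind.row, μ) N₁)
  | perform {N N₁ N₂ : Finset (Kind × ℕ)} {Γ : Env} {ℓ : ℕ} {V : Val} {A Aℓ Bℓ : Ty ℕ}
      {θ₁ θ₂ : Subst ℕ ℕ} {P : PSet} {used : Finset ℕ} {μ φ : ℕ} :
      S.lookup ℓ = some (Aℓ, Bℓ) →
      InferV S N Γ V A θ₁ P used N₁ →
      Unify N₁ [.val A Aℓ] θ₂ N₂ →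
      (Kind.row, μ) ∉ N₂ → (Kind.lin, φ) ∉ N₂ →
      InferC S N Γ (.perform ℓ V) ⟨Bℓ, Row.var μ⟩ (θ₂.comp θ₁)
        (PSet.subst θ₂ P ∪ factorise (.sub ⟨{(ℓ, .var φ)}, none⟩ (Row.var μ))) used
        ({(Kind.row, μ), (Kind.lin, φ)} ∪ N₂)
  | letval {N N₁ N₂ N₃ N₄ : Finset (Kind × ℕ)} {Γ : Env} {x : ℕ} {V : Val} {M : Comp} {A : Ty ℕ}
      {C : CTy ℕ} {θ₁ θ₂ : Subst ℕ ℕ} {P₁ P₂ Q₁ Q₂ : PSet} {used₁ used₂ : Finset ℕ} {σ : Scheme} :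
      x ∉ Env.dom Γ →
      InferV S N Γ V A θ₁ P₁ used₁ N₁ →
      σ = gen (Env.subst θ₁ Γ) P₁ A →
      InferC S N₁ ((x, σ) :: Env.subst θ₁ Γ) M C θ₂ P₂ used₂ N₂ →
      MakeUnl N₂ (Env.restrict (Env.subst θ₂ (Env.subst θ₁ Γ)) (used₁ ∩ used₂)) Q₁ N₃ →
      MakeUnl N₃ (Env.unused (Env.subst θ₂ [(x, σ)]) used₂) Q₂ N₄ →
      InferC S N Γ (.letval x V M) C (θ₂.comp θ₁) (P₂ ∪ (Q₁ ∪ Q₂)) (used₁ ∪ used₂.erase x) N₄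
  | seq {N N₁ N₂ N₃ N₄ N₅ : Finset (Kind × ℕ)} {Γ : Env} {x : ℕ} {L M : Comp} {A B : Ty ℕ}
      {R₁ R₂ : Row ℕ} {θ₁ θ₂ : Subst ℕ ℕ} {P₁ P₂ Q₁ Q₂ Q₃ : PSet} {used₁ used₂ : Finset ℕ}
      {μ : ℕ} :
      x ∉ Env.dom Γ →
      InferC S N Γ L ⟨A, R₁⟩ θ₁ P₁ used₁ N₁ →
      InferC S N₁ ((x, Scheme.mono A) :: Env.subst θ₁ Γ) M ⟨B, R₂⟩ θ₂ P₂ used₂ N₂ →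
      (Kind.row, μ) ∉ N₂ →
      MakeUnl (insert (Kind.row, μ) N₂)
        (Env.restrict (Env.subst θ₂ (Env.subst θ₁ Γ)) (used₁ ∩ used₂)) Q₁ N₃ →
      MakeUnl N₃ (Env.unused (Env.subst θ₂ [(x, Scheme.mono A)]) used₂) Q₂ N₄ →
      MakeLeq N₄ (Env.restrict (Env.subst θ₂ (Env.subst θ₁ Γ)) used₂) (.row (R₁.subst θ₂)) Q₃
        N₅ →
      InferC S N Γ (.seq x L M) ⟨B, Row.var μ⟩ (θ₂.comp θ₁)
        (PSet.subst θ₂ P₁ ∪ P₂ ∪ (Q₁ ∪ Q₂ ∪ Q₃ ∪ factorise (.sub (R₁.subst θ₂) (Row.var μ)) ∪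
          factorise (.sub R₂ (Row.var μ))))
        (used₁ ∪ used₂.erase x) N₅
  | handle {N N₁ N₂ N₃ N₄ : Finset (Kind × ℕ)} {Γ : Env} {M : Comp} {H : Handler} {A A' : Ty ℕ}
      {R R₁ : Row ℕ} {D : CTy ℕ} {θ₁ θ₂ θ₃ : Subst ℕ ℕ} {P₁ P₂ Q : PSet}
      {used₁ used₂ : Finset ℕ} :
      InferH S N Γ H ⟨A, R₁⟩ D θ₁ P₁ used₁ N₁ →
      InferC S N₁ (Env.subst θ₁ Γ) M ⟨A', R⟩ θ₂ P₂ used₂ N₂ →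
      Unify N₂ [.val (A.subst θ₂) A'] θ₃ N₃ →
      MakeUnl N₃ (Env.restrict (Env.subst θ₃ (Env.subst θ₂ (Env.subst θ₁ Γ))) (used₁ ∩ used₂)) Q
        N₄ →
      InferC S N Γ (.handle M H) (CTy.subst θ₃ (CTy.subst θ₂ D)) (θ₃.comp (θ₂.comp θ₁))
        (PSet.subst θ₃ (PSet.subst θ₂ P₁ ∪ P₂) ∪
          (factorise (.sub (R.subst θ₃) ((R₁.subst θ₂).subst θ₃)) ∪ Q))
        (used₁ ∪ used₂) N₄

/-- Inference for handlers, with the handler type `C ⇉ D`. -/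
inductive InferH (S : Sig) : Finset (Kind × ℕ) → Env → Handler → CTy ℕ → CTy ℕ → Subst ℕ ℕ →
    PSet → Finset ℕ → Finset (Kind × ℕ) → Prop
  | mk {N N₀ N₁ N₂ N₃ N₄ : Finset (Kind × ℕ)} {Γ : Env} {x : ℕ} {M : Comp} {cs : Clauses}
      {D : CTy ℕ} {θ₀ θ : Subst ℕ ℕ} {P₀ Q₁ Q₂ Q₃ : PSet} {used₀ used : Finset ℕ} {α μ : ℕ}
      {ops : List OpInfo} :
      x ∉ Env.dom Γ →
      (Kind.ty, α) ∉ N → (Kind.row, μ) ∉ N →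
      InferC S ({(Kind.ty, α), (Kind.row, μ)} ∪ N) ((x, Scheme.mono (.var α)) :: Γ) M D θ₀ P₀
        used₀ N₀ →
      InferOps S N₀ Γ D θ₀ cs θ ops N₁ →
      (ops.map OpInfo.label).Nodup →
      used = used₀.erase x ∪
        ops.foldr (fun i T => (i.used \ {i.param, i.resume}) ∪ T) ∅ →
      MakeUnl N₁ (Env.restrict (Env.subst θ Γ) used) Q₁ N₂ →
      MakeUnl N₂ (Env.unused (Env.subst θ [(x, Scheme.mono (.var α))]) used₀) Q₂ N₃ →
      MakeUnl N₃ (ops.flatMap (fun i => Env.unused (Env.subst θ (i.env D)) i.used)) Q₃ N₄ →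
      InferH S N Γ (.mk x M cs)
        (CTy.subst θ ⟨.var α,
          ⟨((ops.map (fun i => (i.label, Lin.var i.φ)) : List (ℕ × Lin ℕ)) : CRow ℕ), some μ⟩⟩)
        (D.subst θ) θ
        (PSet.subst θ P₀ ∪ ops.foldr (fun i T => PSet.subst θ i.preds ∪ T) ∅ ∪ Q₁ ∪
          factorise (.sub (Row.var μ) (D.eff.subst θ)) ∪
          factorise (.lack (Row.var μ) (ops.map OpInfo.label).toFinset) ∪ (Q₂ ∪ Q₃))
        used N₄

/-- Inference for the operation clauses of a handler, in order.  `θ` is the substitution so far,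
and `D` is the computation type of the return clause. -/
inductive InferOps (S : Sig) : Finset (Kind × ℕ) → Env → CTy ℕ → Subst ℕ ℕ → Clauses →
    Subst ℕ ℕ → List OpInfo → Finset (Kind × ℕ) → Prop
  | nil {N : Finset (Kind × ℕ)} {Γ : Env} {D : CTy ℕ} {θ : Subst ℕ ℕ} :
      InferOps S N Γ D θ .nil θ [] N
  | cons {N N₁ N₂ N₃ : Finset (Kind × ℕ)} {Γ : Env} {D D' : CTy ℕ}
      {θ θ' θ'' θn : Subst ℕ ℕ} {M : Comp} {cs : Clauses} {i : OpInfo} {ops : List OpInfo} :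
      S.lookup i.label = some (i.argTy, i.resTy) →
      i.param ∉ Env.dom Γ → i.resume ∉ Env.dom Γ → i.param ≠ i.resume →
      (Kind.lin, i.φ) ∉ N →
      InferC S (insert (Kind.lin, i.φ) N) (Env.subst θ (i.env D ++ Γ)) M D' θ' i.preds i.used
        N₁ →
      Unify N₁ [.comp D' (CTy.subst θ' (CTy.subst θ D))] θ'' N₂ →
      InferOps S N₂ Γ D (θ''.comp (θ'.comp θ)) cs θn ops N₃ →
      InferOps S N Γ D θ (.cons i.label i.param i.resume M cs) θn (i :: ops) N₃

end

/-- A predicate in which rows do not stand on the left of `≼` and value types do not stand on the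
right of it. -/
def Pred.Directed {ν : Type} : Pred ν → Prop
  | .lin τ₁ τ₂ => (∀ R, τ₁ ≠ .row R) ∧ ∀ A, τ₂ ≠ .val A
  | .sub _ _ => True
  | .lack _ _ => True

/-- The constraint set `P` is generated by type inference for some value, computation or handler,
in some context whose qualifiers are directed. -/
def Generated (P : PSet) : Prop :=
  ∃ (S : Sig) (N N' : Finset (Kind × ℕ)) (Γ : Env) (θ : Subst ℕ ℕ) (used : Finset ℕ),
    Sig.fv S ⊆ N ∧ Env.fv Γ ⊆ N ∧ (∀ p ∈ Γ, ∀ π ∈ p.2.quals, π.Directed) ∧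
    ((∃ V A, InferV S N Γ V A θ P used N') ∨
      (∃ M C, InferC S N Γ M C θ P used N') ∨
      (∃ H C D, InferH S N Γ H C D θ P used N'))

end Qeff

/-!
Every step of the solver replaces a predicate by an equivalent residual, up to the value of the
fresh row variable. Hence the solutions of the input are, at every moment, the solutions of the
solved and unsolved predicates together, precomposed with the current substitution.

An inclusion that instantiates a row variable adds labels to its row. All labels that are ever added
occur in inclusions of the input, and a well-formed row contains each of them at most once, so the
total number of labels in the images of the row variables of the input is bounded. Steps that leave
this number unchanged decrease the number of unsolved predicates.

When nothing is left to solve, the empty row solves every predicate between rows. Sending the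
linearity variables above `∘` in the transitive closure to `∘`, and the others to `•`, solves the
linearity predicates unless the closure contains `∘ ≼ •`. The closure is complete for entailment
because factorisation splits `τ₁ ≼ τ₂` into comparisons of variables and constants as long as no row
stands on the left, and no value type on the right, of `≼`. Inference only generates such
predicates, and the solver preserves this.
-/

namespace Qeff

/-! ## Substitution -/

section Substitution

variable {ν ν' ν'' : Type}

theorem Lin.subst_id (Y : Lin ν) : Y.subst Subst.id = Y := by cases Y <;> rfl

theorem Lin.subst_comp (t : Subst ν' ν'') (θ : Subst ν ν') (Y : Lin ν) :
    (Y.subst θ).subst t = Y.subst (t.comp θ) := by cases Y <;> rfl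

theorem CRow.subst_id (K : CRow ν) : CRow.subst Subst.id K = K := by
  simp [CRow.subst, Lin.subst_id]

theorem CRow.subst_add (θ : Subst ν ν') (K K' : CRow ν) :
    CRow.subst θ (K + K') = CRow.subst θ K + CRow.subst θ K' := by simp [CRow.subst]

theorem CRow.subst_comp (t : Subst ν' ν'') (θ : Subst ν ν') (K : CRow ν) :
    CRow.subst t (CRow.subst θ K) = CRow.subst (t.comp θ) K := by
  simp [CRow.subst, Lin.subst_comp]

theorem CRow.mem_subst {θ : Subst ν ν'} {K : CRow ν} {e : ℕ × Lin ν'} :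
    e ∈ CRow.subst θ K ↔ ∃ e' ∈ K, (e'.1, e'.2.subst θ) = e := by simp [CRow.subst]

theorem CRow.subst_mono {θ : Subst ν ν'} {K K' : CRow ν} (h : K ≤ K') :
    CRow.subst θ K ≤ CRow.subst θ K' := Multiset.map_le_map h

theorem CRow.subst_congr_lin {s t : Subst ν ν'} (h : s.lin = t.lin) (K : CRow ν) :
    CRow.subst s K = CRow.subst t K := by
  have hY : ∀ Y : Lin ν, Y.subst s = Y.subst t := fun Y => by cases Y <;> simp [Lin.subst, h]
  simp [CRow.subst, hY]

theorem CRow.map_fst_subst (θ : Subst ν ν') (K : CRow ν) :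
    (CRow.subst θ K).map Prod.fst = K.map Prod.fst := by
  simp [CRow.subst, Multiset.map_map]

theorem CRow.mem_dom {K : CRow ν} {ℓ : ℕ} : ℓ ∈ CRow.dom K ↔ ∃ Y, (ℓ, Y) ∈ K := by
  simp [CRow.dom]

theorem CRow.disjoint_dom {K : CRow ν} {L : Finset ℕ} :
    Disjoint (CRow.dom K) L ↔ ∀ e ∈ K, e.1 ∉ L := by
  simp [Finset.disjoint_left, CRow.mem_dom]

theorem CRow.mem_diff [DecidableEq ν] {K K' : CRow ν} {e : ℕ × Lin ν} :
    e ∈ CRow.diff K K' ↔ e ∈ K ∧ e ∉ K' := by simp [CRow.diff]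

theorem CRow.diff_le [DecidableEq ν] (K K' : CRow ν) : CRow.diff K K' ≤ K :=
  Multiset.filter_le _ _

attribute [ext] Row

theorem Row.subst_labels (θ : Subst ν ν') (R : Row ν) :
    (R.subst θ).labels =
      CRow.subst θ R.labels + R.tail.elim 0 (fun μ => (θ.row μ).labels) := by
  obtain ⟨K, _ | μ⟩ := R <;> simp [Row.subst]

theorem Row.subst_tail (θ : Subst ν ν') (R : Row ν) :
    (R.subst θ).tail = R.tail.bind (fun μ => (θ.row μ).tail) := by
  obtain ⟨K, _ | μ⟩ := R <;> simp [Row.subst]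

theorem Row.mem_subst {θ : Subst ν ν'} {R : Row ν} {e : ℕ × Lin ν'} :
    e ∈ (R.subst θ).labels ↔
      (∃ e' ∈ R.labels, (e'.1, e'.2.subst θ) = e) ∨
        ∃ μ, R.tail = some μ ∧ e ∈ (θ.row μ).labels := by
  rw [Row.subst_labels, Multiset.mem_add, CRow.mem_subst]
  cases R.tail <;> simp

theorem Row.subst_var (θ : Subst ν ν') (μ : ν) : (Row.var μ).subst θ = θ.row μ := by
  simp [Row.ext_iff, Row.subst_labels, Row.subst_tail, Row.var, CRow.subst]

theorem Row.subst_id (R : Row ν) : R.subst Subst.id = R := by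
  rw [Row.ext_iff, Row.subst_labels, Row.subst_tail, CRow.subst_id]
  cases R.tail <;> simp [Subst.id, Subst.ren, Row.var]

theorem Row.subst_comp (t : Subst ν' ν'') (θ : Subst ν ν') (R : Row ν) :
    (R.subst θ).subst t = R.subst (t.comp θ) := by
  obtain ⟨K, _ | μ⟩ := R
  · simp [Row.subst, CRow.subst_comp]
  · simp only [Row.ext_iff, Row.subst_labels, Row.subst_tail, CRow.subst_add, CRow.subst_comp,
      Option.elim_some, Option.bind_some, Subst.comp, add_assoc, and_self]

theorem Ty.subst_id (A : Ty ν) : A.subst Subst.id = A := by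
  induction A with
  | var α => rfl
  | arrow A Y B R hA hB => simp [Ty.subst, hA, hB, Lin.subst_id, Row.subst_id]

theorem Ty.subst_comp (t : Subst ν' ν'') (θ : Subst ν ν') (A : Ty ν) :
    (A.subst θ).subst t = A.subst (t.comp θ) := by
  induction A with
  | var α => rfl
  | arrow A Y B R hA hB => simp [Ty.subst, hA, hB, Lin.subst_comp, Row.subst_comp]

theorem Typ.subst_id (τ : Typ ν) : τ.subst Subst.id = τ := by
  cases τ <;> simp [Typ.subst, Ty.subst_id, Row.subst_id, Lin.subst_id]

theorem Typ.subst_comp (t : Subst ν' ν'') (θ : Subst ν ν') (τ : Typ ν) :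
    (τ.subst θ).subst t = τ.subst (t.comp θ) := by
  cases τ <;> simp [Typ.subst, Ty.subst_comp, Row.subst_comp, Lin.subst_comp]

theorem Pred.subst_id (π : Pred ν) : π.subst Subst.id = π := by
  cases π <;> simp [Pred.subst, Typ.subst_id, Row.subst_id]

theorem Pred.subst_comp (t : Subst ν' ν'') (θ : Subst ν ν') (π : Pred ν) :
    (π.subst θ).subst t = π.subst (t.comp θ) := by
  cases π <;> simp [Pred.subst, Typ.subst_comp, Row.subst_comp]

theorem Subst.comp_id (θ : Subst ν ν') : θ.comp Subst.id = θ := by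
  ext1
  · rfl
  · exact funext (Row.subst_var θ)
  · rfl

theorem Subst.id_comp (θ : Subst ν ν') : Subst.id.comp θ = θ := by
  ext1
  · exact funext fun _ => Ty.subst_id _
  · exact funext fun _ => Row.subst_id _
  · exact funext fun _ => Lin.subst_id _

theorem Subst.comp_assoc {ν₃ : Type} (θ₃ : Subst ν'' ν₃) (θ₂ : Subst ν' ν'') (θ₁ : Subst ν ν') :
    (θ₃.comp θ₂).comp θ₁ = θ₃.comp (θ₂.comp θ₁) := by
  ext1
  · exact funext fun _ => (Ty.subst_comp _ _ _).symm
  · exact funext fun _ => (Row.subst_comp _ _ _).symm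
  · exact funext fun _ => (Lin.subst_comp _ _ _).symm

theorem PSet.subst_id (P : PSet) : PSet.subst Subst.id P = P := by
  rw [PSet.subst, show Pred.subst Subst.id = id from funext Pred.subst_id, Finset.image_id]

theorem PSet.mem_subst {θ : Subst ℕ ℕ} {P : PSet} {π : Pred ℕ} :
    π ∈ PSet.subst θ P ↔ ∃ κ ∈ P, κ.subst θ = π := by simp [PSet.subst]

end Substitution

/-! ## Free variables -/

section FreeVariables

variable {ν ν' ν'' : Type}

section FV

variable [DecidableEq ν]

theorem Row.mem_fv {R : Row ν} {x : Kind × ν} :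
    x ∈ R.fv ↔ (∃ e ∈ R.labels, x ∈ e.2.fv) ∨ ∃ μ, R.tail = some μ ∧ x = (Kind.row, μ) := by
  unfold Row.fv
  cases R.tail <;> simp [or_comm]

theorem Row.fv_subset_iff {R : Row ν} {N : Finset (Kind × ν)} :
    R.fv ⊆ N ↔ (∀ e ∈ R.labels, e.2.fv ⊆ N) ∧ ∀ μ, R.tail = some μ → (Kind.row, μ) ∈ N := by
  constructor
  · exact fun h => ⟨fun e he _ hx => h (Row.mem_fv.2 (.inl ⟨e, he, hx⟩)),
      fun μ hμ => h (Row.mem_fv.2 (.inr ⟨μ, hμ, rfl⟩))⟩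
  · rintro ⟨hlabels, htail⟩ x hx
    rcases Row.mem_fv.1 hx with ⟨e, he, hxe⟩ | ⟨μ, hμ, rfl⟩
    · exact hlabels e he hxe
    · exact htail μ hμ

theorem Row.fv_var (μ : ν) : (Row.var μ).fv = {(Kind.row, μ)} := by simp [Row.fv, Row.var]

end FV

section MapsVars

variable [DecidableEq ν''] [DecidableEq ν'] {θ : Subst ν ν'} {N : Finset (Kind × ν)}

/-- The substitution `θ` sends the variables in `N` to types over the variables in `N'`. -/
def Subst.MapsVars (θ : Subst ν ν') (N : Finset (Kind × ν)) (N' : Finset (Kind × ν')) : Prop :=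
  (∀ α, (Kind.ty, α) ∈ N → (θ.ty α).fv ⊆ N') ∧
  (∀ μ, (Kind.row, μ) ∈ N → (θ.row μ).fv ⊆ N') ∧
  (∀ φ, (Kind.lin, φ) ∈ N → (θ.lin φ).fv ⊆ N')

variable {N' : Finset (Kind × ν')}

theorem Lin.fv_subst (h : θ.MapsVars N N') {Y : Lin ν} (hY : Y.fv ⊆ N) :
    (Y.subst θ).fv ⊆ N' := by
  cases Y with
  | var φ => exact h.2.2 φ (hY (by simp [Lin.fv]))
  | unl => simp [Lin.subst, Lin.fv]
  | any => simp [Lin.subst, Lin.fv]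

theorem CRow.fv_subst (h : θ.MapsVars N N') {K : CRow ν} (hK : ∀ e ∈ K, e.2.fv ⊆ N) :
    ∀ e ∈ CRow.subst θ K, e.2.fv ⊆ N' := by
  intro e he
  obtain ⟨e', he', rfl⟩ := CRow.mem_subst.1 he
  exact Lin.fv_subst h (hK e' he')

section

variable [DecidableEq ν]

theorem Row.fv_subst (h : θ.MapsVars N N') {R : Row ν} (hR : R.fv ⊆ N) :
    (R.subst θ).fv ⊆ N' := by
  rw [Row.fv_subset_iff] at hR ⊢
  refine ⟨fun e he => ?_, fun μ hμ => ?_⟩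
  · rcases Row.mem_subst.1 he with ⟨e', he', rfl⟩ | ⟨μ, hμ, he'⟩
    · exact Lin.fv_subst h (hR.1 e' he')
    · exact (Row.fv_subset_iff.1 (h.2.1 μ (hR.2 μ hμ))).1 e he'
  · rw [Row.subst_tail, Option.bind_eq_some_iff] at hμ
    obtain ⟨μ', hμ', htail⟩ := hμ
    exact (Row.fv_subset_iff.1 (h.2.1 μ' (hR.2 μ' hμ'))).2 μ htail

theorem Ty.fv_subst (h : θ.MapsVars N N') {A : Ty ν} (hA : A.fv ⊆ N) :
    (A.subst θ).fv ⊆ N' := by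
  induction A with
  | var α => exact h.1 α (hA (by simp [Ty.fv]))
  | arrow A Y B R ihA ihB =>
    simp only [Ty.fv, Ty.subst, Finset.union_subset_iff] at hA ⊢
    obtain ⟨⟨⟨hA, hY⟩, hB⟩, hR⟩ := hA
    exact ⟨⟨⟨ihA hA, Lin.fv_subst h hY⟩, ihB hB⟩, Row.fv_subst h hR⟩

theorem Typ.fv_subst (h : θ.MapsVars N N') {τ : Typ ν} (hτ : τ.fv ⊆ N) :
    (τ.subst θ).fv ⊆ N' := by
  cases τ with
  | val A => exact Ty.fv_subst h hτ
  | row R => exact Row.fv_subst h hτ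
  | lin Y => exact Lin.fv_subst h hτ

theorem Pred.fv_subst (h : θ.MapsVars N N') {π : Pred ν} (hπ : π.fv ⊆ N) :
    (π.subst θ).fv ⊆ N' := by
  cases π with
  | lin τ₁ τ₂ =>
    simp only [Pred.fv, Pred.subst, Finset.union_subset_iff] at hπ ⊢
    exact ⟨Typ.fv_subst h hπ.1, Typ.fv_subst h hπ.2⟩
  | sub R₁ R₂ =>
    simp only [Pred.fv, Pred.subst, Finset.union_subset_iff] at hπ ⊢
    exact ⟨Row.fv_subst h hπ.1, Row.fv_subst h hπ.2⟩
  | lack R L => exact Row.fv_subst h hπ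

end

theorem Subst.MapsVars.comp {N'' : Finset (Kind × ν'')} {θ' : Subst ν' ν''}
    (h' : θ'.MapsVars N' N'') (h : θ.MapsVars N N') : (θ'.comp θ).MapsVars N N'' :=
  ⟨fun α hα => Ty.fv_subst h' (h.1 α hα), fun μ hμ => Row.fv_subst h' (h.2.1 μ hμ),
    fun φ hφ => Lin.fv_subst h' (h.2.2 φ hφ)⟩

end MapsVars

section Elementary

variable [DecidableEq ν]

theorem Subst.MapsVars.id {N N' : Finset (Kind × ν)} (h : N ⊆ N') :
    Subst.id.MapsVars N N' := by
  refine ⟨fun α hα => ?_, fun μ hμ => ?_, fun φ hφ => ?_⟩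
  · simpa [Subst.id, Subst.ren, Ty.fv] using h hα
  · simpa [Subst.id, Subst.ren, Row.fv_var] using h hμ
  · simpa [Subst.id, Subst.ren, Lin.fv] using h hφ

theorem Subst.MapsVars.oneLin {N : Finset (Kind × ν)} {φ : ν} {Y : Lin ν} (hY : Y.fv ⊆ N) :
    (Subst.oneLin φ Y).MapsVars N N := by
  have hid : Subst.id.MapsVars N N := .id subset_rfl
  refine ⟨hid.1, hid.2.1, fun ψ hψ => ?_⟩
  by_cases h : ψ = φ
  · subst h; simpa [Subst.oneLin] using hY
  · simpa [Subst.oneLin, h] using hid.2.2 ψ hψ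

theorem Subst.MapsVars.oneRow {N N' : Finset (Kind × ν)} {μ : ν} {R : Row ν} (h : N ⊆ N')
    (hR : R.fv ⊆ N') : (Subst.oneRow μ R).MapsVars N N' := by
  have hid : Subst.id.MapsVars N N' := .id h
  refine ⟨hid.1, fun ξ hξ => ?_, hid.2.2⟩
  by_cases h' : ξ = μ
  · subst h'; simpa [Subst.oneRow] using hR
  · simpa [Subst.oneRow, h'] using hid.2.1 ξ hξ

end Elementary

section AgreeOn

variable {s t u : Subst ℕ ℕ} {N : Finset (Kind × ℕ)}

theorem Lin.subst_congr (h : s.AgreeOn N t) {Y : Lin ℕ} (hY : Y.fv ⊆ N) :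
    Y.subst s = Y.subst t := by
  cases Y with
  | var φ => exact h.2.2 φ (hY (by simp [Lin.fv]))
  | unl => rfl
  | any => rfl

theorem CRow.subst_congr (h : s.AgreeOn N t) {K : CRow ℕ} (hK : ∀ e ∈ K, e.2.fv ⊆ N) :
    CRow.subst s K = CRow.subst t K :=
  Multiset.map_congr rfl fun e he => by rw [Lin.subst_congr h (hK e he)]

theorem Row.subst_congr (h : s.AgreeOn N t) {R : Row ℕ} (hR : R.fv ⊆ N) :
    R.subst s = R.subst t := by
  obtain ⟨hlabels, htail⟩ := Row.fv_subset_iff.1 hR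
  obtain ⟨K, _ | μ⟩ := R
  · simp only [Row.subst, CRow.subst_congr h hlabels]
  · simp only [Row.subst, CRow.subst_congr h hlabels, h.2.1 μ (htail μ rfl)]

theorem Ty.subst_congr (h : s.AgreeOn N t) {A : Ty ℕ} (hA : A.fv ⊆ N) :
    A.subst s = A.subst t := by
  induction A with
  | var α => exact h.1 α (hA (by simp [Ty.fv]))
  | arrow A Y B R ihA ihB =>
    simp only [Ty.fv, Finset.union_subset_iff] at hA
    obtain ⟨⟨⟨hA, hY⟩, hB⟩, hR⟩ := hA
    simp only [Ty.subst, ihA hA, ihB hB, Lin.subst_congr h hY, Row.subst_congr h hR]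

theorem Typ.subst_congr (h : s.AgreeOn N t) {τ : Typ ℕ} (hτ : τ.fv ⊆ N) :
    τ.subst s = τ.subst t := by
  cases τ with
  | val A => exact congrArg _ (Ty.subst_congr h hτ)
  | row R => exact congrArg _ (Row.subst_congr h hτ)
  | lin Y => exact congrArg _ (Lin.subst_congr h hτ)

theorem Pred.subst_congr (h : s.AgreeOn N t) {π : Pred ℕ} (hπ : π.fv ⊆ N) :
    π.subst s = π.subst t := by
  cases π with
  | lin τ₁ τ₂ =>
    simp only [Pred.fv, Finset.union_subset_iff] at hπ
    simp only [Pred.subst, Typ.subst_congr h hπ.1, Typ.subst_congr h hπ.2]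
  | sub R₁ R₂ =>
    simp only [Pred.fv, Finset.union_subset_iff] at hπ
    simp only [Pred.subst, Row.subst_congr h hπ.1, Row.subst_congr h hπ.2]
  | lack R L => simp only [Pred.subst, Row.subst_congr h (show R.fv ⊆ N from hπ)]

theorem PSet.subst_congr (h : s.AgreeOn N t) {P : PSet} (hP : P.fv ⊆ N) :
    PSet.subst s P = PSet.subst t P :=
  Finset.image_congr fun _ hπ =>
    Pred.subst_congr h ((Finset.subset_biUnion_of_mem Pred.fv hπ).trans hP)

theorem Subst.AgreeOn.refl (s : Subst ℕ ℕ) : s.AgreeOn N s :=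
  ⟨fun _ _ => rfl, fun _ _ => rfl, fun _ _ => rfl⟩

theorem Subst.AgreeOn.symm (h : s.AgreeOn N t) : t.AgreeOn N s :=
  ⟨fun α hα => (h.1 α hα).symm, fun μ hμ => (h.2.1 μ hμ).symm, fun φ hφ => (h.2.2 φ hφ).symm⟩

theorem Subst.AgreeOn.trans (h : s.AgreeOn N t) (h' : t.AgreeOn N u) : s.AgreeOn N u :=
  ⟨fun α hα => (h.1 α hα).trans (h'.1 α hα), fun μ hμ => (h.2.1 μ hμ).trans (h'.2.1 μ hμ),
    fun φ hφ => (h.2.2 φ hφ).trans (h'.2.2 φ hφ)⟩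

theorem Subst.AgreeOn.comp_right {N₀ : Finset (Kind × ℕ)} {θ : Subst ℕ ℕ} (h : s.AgreeOn N t)
    (hθ : θ.MapsVars N₀ N) : (s.comp θ).AgreeOn N₀ (t.comp θ) :=
  ⟨fun α hα => Ty.subst_congr h (hθ.1 α hα), fun μ hμ => Row.subst_congr h (hθ.2.1 μ hμ),
    fun φ hφ => Lin.subst_congr h (hθ.2.2 φ hφ)⟩

end AgreeOn

end FreeVariables

/-! ## Well-formedness -/

section WellFormedness

variable {ν ν' : Type}

theorem CRow.nodup_map_fst_of_le {K K' : CRow ν} (h : K ≤ K') (h' : (K'.map Prod.fst).Nodup) :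
    (K.map Prod.fst).Nodup := Multiset.nodup_of_le (Multiset.map_le_map h) h'

theorem CRow.eq_of_fst_eq {K : CRow ν} (h : (K.map Prod.fst).Nodup) {ℓ : ℕ} {Y Y' : Lin ν}
    (hY : (ℓ, Y) ∈ K) (hY' : (ℓ, Y') ∈ K) : Y = Y' :=
  congrArg Prod.snd (Multiset.inj_on_of_nodup_map h _ hY _ hY' rfl)

theorem CRow.notMem_of_nodup_add {K K' : CRow ν} (h : ((K + K').map Prod.fst).Nodup) {ℓ : ℕ}
    {Y Y' : Lin ν} (hY : (ℓ, Y) ∈ K) : (ℓ, Y') ∉ K' := by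
  intro hY'
  rw [Multiset.map_add, Multiset.nodup_add] at h
  exact Multiset.disjoint_left.1 h.2.2 (Multiset.mem_map_of_mem Prod.fst hY)
    (show ℓ ∈ _ from Multiset.mem_map_of_mem Prod.fst hY')

theorem CRow.nodup_map_fst_subst {t : Subst ν ν'} {K : CRow ν} :
    ((CRow.subst t K).map Prod.fst).Nodup ↔ (K.map Prod.fst).Nodup := by
  rw [CRow.map_fst_subst]

theorem PSet.wf_subst {θ : Subst ℕ ℕ} {P : PSet} :
    (PSet.subst θ P).WF ↔ ∀ π ∈ P, (π.subst θ).WF := Finset.forall_mem_image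

section OfSubst

variable {t : Subst ν ν'}

theorem Row.WF.of_subst {R : Row ν} (h : (R.subst t).WF) : R.WF := by
  unfold Row.WF at *
  rw [Row.subst_labels] at h
  exact CRow.nodup_map_fst_subst.1 (CRow.nodup_map_fst_of_le (Multiset.le_add_right _ _) h)

theorem Ty.WF.of_subst {A : Ty ν} (h : (A.subst t).WF) : A.WF := by
  induction A with
  | var α => trivial
  | arrow A Y B R ihA ihB => exact ⟨ihA h.1, ihB h.2.1, Row.WF.of_subst h.2.2⟩

theorem Typ.WF.of_subst {τ : Typ ν} (h : (τ.subst t).WF) : τ.WF := by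
  cases τ with
  | val A => exact Ty.WF.of_subst h
  | row R => exact Row.WF.of_subst h
  | lin Y => trivial

theorem Pred.WF.of_subst {π : Pred ν} (h : (π.subst t).WF) : π.WF := by
  cases π with
  | lin τ₁ τ₂ => exact ⟨Typ.WF.of_subst h.1, Typ.WF.of_subst h.2⟩
  | sub R₁ R₂ => exact ⟨Row.WF.of_subst h.1, Row.WF.of_subst h.2⟩
  | lack R L => exact Row.WF.of_subst (R := R) h

theorem PSet.WF.of_subst_comp {P : PSet} {t θ : Subst ℕ ℕ} (h : (PSet.subst (t.comp θ) P).WF) :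
    (PSet.subst θ P).WF :=
  PSet.wf_subst.2 fun π hπ => Pred.WF.of_subst (t := t) <| by
    rw [Pred.subst_comp]
    exact PSet.wf_subst.1 h π hπ

end OfSubst

/-- The substitution `t` sends the variables in `N` to well-formed types. -/
def Subst.WFOn (t : Subst ν ν') (N : Finset (Kind × ν)) : Prop :=
  (∀ α, (Kind.ty, α) ∈ N → (t.ty α).WF) ∧ ∀ μ, (Kind.row, μ) ∈ N → (t.row μ).WF

section WFOn

theorem Lin.wfOn (t : Subst ν ν') (Y : Lin ν) : t.WFOn Y.fv := by
  cases Y <;> simp [Subst.WFOn, Lin.fv]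

variable [DecidableEq ν] {t : Subst ν ν'}

theorem Subst.WFOn.union {N N' : Finset (Kind × ν)} (h : t.WFOn N) (h' : t.WFOn N') :
    t.WFOn (N ∪ N') :=
  ⟨fun α hα => (Finset.mem_union.1 hα).elim (h.1 α) (h'.1 α),
    fun μ hμ => (Finset.mem_union.1 hμ).elim (h.2 μ) (h'.2 μ)⟩

theorem Row.WF.wfOn {R : Row ν} (h : (R.subst t).WF) : t.WFOn R.fv := by
  refine ⟨fun α hα => ?_, fun μ hμ => ?_⟩
  · rcases Row.mem_fv.1 hα with ⟨e, _, hα⟩ | ⟨μ, _, hα⟩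
    · exact (Lin.wfOn t e.2).1 α hα
    · cases hα
  · rcases Row.mem_fv.1 hμ with ⟨e, _, hμ⟩ | ⟨μ', htail, hμ⟩
    · exact (Lin.wfOn t e.2).2 μ hμ
    · cases hμ
      unfold Row.WF at *
      rw [Row.subst_labels, htail] at h
      exact CRow.nodup_map_fst_of_le (Multiset.le_add_left _ _) h

theorem Ty.WF.wfOn {A : Ty ν} (h : (A.subst t).WF) : t.WFOn A.fv := by
  induction A with
  | var α => simpa [Subst.WFOn, Ty.fv, Ty.subst] using h
  | arrow A Y B R ihA ihB =>
    exact (((ihA h.1).union (Lin.wfOn t Y)).union (ihB h.2.1)).union (Row.WF.wfOn h.2.2)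

theorem Typ.WF.wfOn {τ : Typ ν} (h : (τ.subst t).WF) : t.WFOn τ.fv := by
  cases τ with
  | val A => exact Ty.WF.wfOn h
  | row R => exact Row.WF.wfOn h
  | lin Y => exact Lin.wfOn t Y

theorem Pred.WF.wfOn {π : Pred ν} (h : (π.subst t).WF) : t.WFOn π.fv := by
  cases π with
  | lin τ₁ τ₂ => exact (Typ.WF.wfOn h.1).union (Typ.WF.wfOn h.2)
  | sub R₁ R₂ => exact (Row.WF.wfOn h.1).union (Row.WF.wfOn h.2)
  | lack R L => exact Row.WF.wfOn (R := R) h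

theorem PSet.WF.wfOn {P : PSet} {t : Subst ℕ ℕ} (h : (PSet.subst t P).WF) : t.WFOn P.fv := by
  refine ⟨fun α hα => ?_, fun μ hμ => ?_⟩
  · obtain ⟨π, hπ, hα⟩ := Finset.mem_biUnion.1 hα
    exact (Pred.WF.wfOn (PSet.wf_subst.1 h π hπ)).1 α hα
  · obtain ⟨π, hπ, hμ⟩ := Finset.mem_biUnion.1 hμ
    exact (Pred.WF.wfOn (PSet.wf_subst.1 h π hπ)).2 μ hμ

end WFOn

section SubstUnlabelled

variable {t : Subst ν ν'}

theorem Row.WF.subst_of_labels_eq_zero (ht : ∀ μ, (t.row μ).labels = 0) {R : Row ν} (h : R.WF) :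
    (R.subst t).WF := by
  unfold Row.WF at *
  rw [Row.subst_labels]
  cases R.tail <;> simpa [ht, CRow.map_fst_subst] using h

theorem Ty.WF.subst_of_labels_eq_zero (ht : ∀ μ, (t.row μ).labels = 0) (ht' : ∀ α, (t.ty α).WF)
    {A : Ty ν} (h : A.WF) : (A.subst t).WF := by
  induction A with
  | var α => exact ht' α
  | arrow A Y B R ihA ihB =>
    exact ⟨ihA h.1, ihB h.2.1, Row.WF.subst_of_labels_eq_zero ht h.2.2⟩

theorem Typ.WF.subst_of_labels_eq_zero (ht : ∀ μ, (t.row μ).labels = 0) (ht' : ∀ α, (t.ty α).WF)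
    {τ : Typ ν} (h : τ.WF) : (τ.subst t).WF := by
  cases τ with
  | val A => exact Ty.WF.subst_of_labels_eq_zero ht ht' h
  | row R => exact Row.WF.subst_of_labels_eq_zero ht h
  | lin Y => trivial

theorem Pred.WF.subst_of_labels_eq_zero (ht : ∀ μ, (t.row μ).labels = 0) (ht' : ∀ α, (t.ty α).WF)
    {π : Pred ν} (h : π.WF) : (π.subst t).WF := by
  cases π with
  | lin τ₁ τ₂ =>
    exact ⟨Typ.WF.subst_of_labels_eq_zero ht ht' h.1, Typ.WF.subst_of_labels_eq_zero ht ht' h.2⟩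
  | sub R₁ R₂ =>
    exact ⟨Row.WF.subst_of_labels_eq_zero ht h.1, Row.WF.subst_of_labels_eq_zero ht h.2⟩
  | lack R L => exact Row.WF.subst_of_labels_eq_zero (R := R) ht h

end SubstUnlabelled

end WellFormedness

/-! ## Entailment and factorisation -/

section Factorisation

variable {t : Subst ℕ ℕ} {τ τ' : Typ ℕ}

/-- The type that stands for `τ` on the left of `≼`: a function type is replaced by its
linearity. -/
def Typ.strip : Typ ℕ → Typ ℕ
  | .val (.arrow _ Y _ _) => .lin Y
  | τ => τ

/-- The types that stand for `τ` on the right of `≼`: a row is replaced by the linearities of its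
labels and its row variable. -/
def Typ.parts : Typ ℕ → Set (Typ ℕ)
  | .row R => {b | (∃ e ∈ R.labels, b = .lin e.2) ∨ ∃ μ, R.tail = some μ ∧ b = .row (Row.var μ)}
  | τ => {τ}

/-- The condition under which factorisation discards `τ ≼ τ'`. -/
def Typ.TrivialLE (τ τ' : Typ ℕ) : Prop := τ = τ' ∨ τ' = .lin .any ∨ τ = .lin .unl

theorem Typ.TrivialLE.entails (h : Typ.TrivialLE τ τ') : Entails ∅ ((Pred.lin τ τ').subst t) := by
  rcases h with rfl | rfl | rfl
  · exact .refl _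
  · exact .lin _
  · exact .unl _

theorem mem_factAtom {κ : Pred ℕ} :
    κ ∈ factAtom τ τ' ↔ ¬ Typ.TrivialLE τ τ' ∧ κ = .lin τ τ' := by
  unfold factAtom Typ.TrivialLE
  split_ifs with h <;> simp [h]

theorem mem_factRight {κ : Pred ℕ} :
    κ ∈ factRight τ τ' ↔ ¬ Typ.TrivialLE τ τ' ∧
      ∃ b ∈ τ'.parts, ¬ Typ.TrivialLE τ b ∧ κ = .lin τ b := by
  unfold factRight
  split_ifs with h
  · exact iff_of_false (Finset.notMem_empty κ) fun h' => h'.1 h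
  refine Iff.trans ?_ (and_iff_right h).symm
  rcases τ' with A | R | Y
  · simp [mem_factAtom, Typ.parts]
  · rcases hR : R.tail with _ | μ <;>
      simp [mem_factAtom, Typ.parts, hR, or_and_right, exists_or]
  · simp [mem_factAtom, Typ.parts]

theorem mem_factLin {κ : Pred ℕ} :
    κ ∈ factLin τ τ' ↔ ¬ Typ.TrivialLE τ τ' ∧ ¬ Typ.TrivialLE τ.strip τ' ∧
      ∃ b ∈ τ'.parts, ¬ Typ.TrivialLE τ.strip b ∧ κ = .lin τ.strip b := by
  rw [← mem_factRight]
  unfold factLin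
  split_ifs with h
  · exact iff_of_false (Finset.notMem_empty κ) fun h' => h'.1 h
  refine Iff.trans ?_ (and_iff_right h).symm
  rcases τ with (α | ⟨A, Y, B, R⟩) | R | Y <;> rfl

theorem entails_strip_iff : Entails ∅ ((Pred.lin τ.strip τ').subst t) ↔
    Entails ∅ ((Pred.lin τ τ').subst t) := by
  rcases τ with (α | ⟨A, Y, B, R⟩) | R | Y
  · rfl
  · exact ⟨.func, .func_inv⟩
  · rfl
  · rfl

theorem entails_row_subst_iff {R : Row ℕ} :
    Entails ∅ (.lin τ (.row (R.subst t))) ↔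
      (∀ e ∈ R.labels, Entails ∅ (.lin τ (.lin (e.2.subst t)))) ∧
        ∀ μ, R.tail = some μ → Entails ∅ (.lin τ (.row (t.row μ))) := by
  refine ⟨fun h => ⟨fun e he => ?_, fun μ hμ => .row (fun e he => ?_) fun ν hν => ?_⟩,
    fun h => .row (fun e he => ?_) fun ν hν => ?_⟩
  · exact Entails.row_inv_label (Row.mem_subst.2 (.inl ⟨e, he, rfl⟩)) h
  · exact Entails.row_inv_label (Row.mem_subst.2 (.inr ⟨μ, hμ, he⟩)) h
  · exact Entails.row_inv_tail (by rw [Row.subst_tail, hμ]; exact hν) h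
  · rcases Row.mem_subst.1 he with ⟨e', he', rfl⟩ | ⟨μ, hμ, he⟩
    · exact h.1 e' he'
    · exact Entails.row_inv_label he (h.2 μ hμ)
  · rw [Row.subst_tail, Option.bind_eq_some_iff] at hν
    obtain ⟨μ, hμ, hν⟩ := hν
    exact Entails.row_inv_tail hν (h.2 μ hμ)

theorem entails_parts_iff : (∀ b ∈ τ'.parts, Entails ∅ ((Pred.lin τ b).subst t)) ↔
    Entails ∅ ((Pred.lin τ τ').subst t) := by
  rcases τ' with A | R | Y
  · simp [Typ.parts]
  · simp only [Pred.subst, Typ.subst, entails_row_subst_iff, Typ.parts]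
    constructor
    · exact fun h => ⟨fun e he => h _ (.inl ⟨e, he, rfl⟩),
        fun μ hμ => by simpa only [Row.subst_var] using h _ (.inr ⟨μ, hμ, rfl⟩)⟩
    · rintro ⟨hl, ht⟩ b (⟨e, he, rfl⟩ | ⟨μ, hμ, rfl⟩)
      · exact hl e he
      · simpa only [Row.subst_var] using ht μ hμ
  · simp [Typ.parts]

theorem entails_factLin_iff : (∀ κ ∈ factLin τ τ', Entails ∅ (κ.subst t)) ↔
    Entails ∅ ((Pred.lin τ τ').subst t) := by
  constructor
  · intro h
    by_cases htriv : Typ.TrivialLE τ τ'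
    · exact htriv.entails
    refine entails_strip_iff.1 ?_
    by_cases hstrip : Typ.TrivialLE τ.strip τ'
    · exact hstrip.entails
    refine entails_parts_iff.1 fun b hb => ?_
    by_cases hpart : Typ.TrivialLE τ.strip b
    · exact hpart.entails
    · exact h _ (mem_factLin.2 ⟨htriv, hstrip, b, hb, hpart, rfl⟩)
  · intro h κ hκ
    obtain ⟨-, -, b, hb, -, rfl⟩ := mem_factLin.1 hκ
    exact entails_parts_iff.2 (entails_strip_iff.2 h) b hb

theorem Typ.strip_ne_arrow (τ : Typ ℕ) (A : Ty ℕ) (Y : Lin ℕ) (B : Ty ℕ) (R : Row ℕ) :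
    τ.strip ≠ .val (.arrow A Y B R) := by
  rcases τ with (_ | ⟨_, _, _, _⟩) | _ | _ <;> simp [Typ.strip]

theorem Typ.strip_ne_row (h : ∀ R, τ ≠ .row R) (R : Row ℕ) : τ.strip ≠ .row R := by
  rcases τ with (_ | ⟨_, _, _, _⟩) | _ | _ <;> simp_all [Typ.strip]

theorem Typ.ne_val_of_mem_parts (h : ∀ A, τ ≠ .val A) {b : Typ ℕ} (hb : b ∈ τ.parts) (A : Ty ℕ) :
    b ≠ .val A := by
  rintro rfl
  rcases τ with A' | R | Y
  · exact h A' rfl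
  · simp [Typ.parts] at hb
  · simp [Typ.parts] at hb

theorem Typ.labels_eq_zero_of_mem_parts {R : Row ℕ} (h : Typ.row R ∈ τ.parts) :
    R.labels = 0 := by
  rcases τ with A | R' | Y
  · simp [Typ.parts] at h
  · obtain ⟨e, -, h⟩ | ⟨μ, -, h⟩ := h
    · cases h
    · cases h; rfl
  · simp [Typ.parts] at h

/-- The linearity predicates that factorisation leaves alone, unless it discards them. -/
def Pred.Atomic : Pred ℕ → Prop
  | .lin τ τ' => (∀ A Y B R, τ ≠ .val (.arrow A Y B R)) ∧ ∀ R, τ' = .row R → R.labels = 0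
  | _ => True

theorem atomic_of_mem_factLin {κ : Pred ℕ} (hκ : κ ∈ factLin τ τ') : κ.Atomic := by
  obtain ⟨-, -, b, hb, -, rfl⟩ := mem_factLin.1 hκ
  exact ⟨Typ.strip_ne_arrow τ, fun R hR => Typ.labels_eq_zero_of_mem_parts (hR ▸ hb)⟩

theorem directed_of_mem_factLin {κ : Pred ℕ} (hd : (Pred.lin τ τ').Directed)
    (hκ : κ ∈ factLin τ τ') : κ.Directed := by
  obtain ⟨-, -, b, hb, -, rfl⟩ := mem_factLin.1 hκ
  exact ⟨Typ.strip_ne_row hd.1, Typ.ne_val_of_mem_parts hd.2 hb⟩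

theorem directed_of_mem_factorise {π κ : Pred ℕ} (hd : π.Directed) (hκ : κ ∈ factorise π) :
    κ.Directed := by
  cases π with
  | lin τ τ' => exact directed_of_mem_factLin hd hκ
  | sub R₁ R₂ =>
    simp only [factorise] at hκ
    split_ifs at hκ <;> simp_all [Pred.Directed]
  | lack R L =>
    simp only [factorise] at hκ
    split_ifs at hκ <;> simp_all [Pred.Directed]

end Factorisation

/-! ## Directed predicates -/

section DirectedPredicates

theorem Pred.Directed.subst {ν ν' : Type} {π : Pred ν} (h : π.Directed) (θ : Subst ν ν') :
    (π.subst θ).Directed := by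
  cases π with
  | lin τ₁ τ₂ =>
    refine ⟨fun R hR => ?_, fun A hA => ?_⟩
    · cases τ₁ with
      | row R' => exact h.1 R' rfl
      | val A => simp [Typ.subst] at hR
      | lin Y => simp [Typ.subst] at hR
    · cases τ₂ with
      | val A' => exact h.2 A' rfl
      | row R => simp [Typ.subst] at hA
      | lin Y => simp [Typ.subst] at hA
  | sub R₁ R₂ => trivial
  | lack R L => trivial

theorem directed_of_mem_image_subst {ν ν' : Type} [DecidableEq ν'] {P : Finset (Pred ν)}
    (hP : ∀ π ∈ P, π.Directed) (θ : Subst ν ν') : ∀ π ∈ P.image (Pred.subst θ), π.Directed :=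
  Finset.forall_mem_image.2 fun π hπ => (hP π hπ).subst θ

/-- A constraint set of directed predicates. -/
def PSet.Directed (P : PSet) : Prop := ∀ π ∈ P, π.Directed

/-- A type scheme whose qualifiers are directed predicates. -/
def Scheme.Directed (σ : Scheme) : Prop := ∀ π ∈ σ.quals, π.Directed

/-- A context of type schemes with directed qualifiers. -/
def Env.Directed (Γ : Env) : Prop := ∀ p ∈ Γ, p.2.Directed

theorem PSet.Directed.union {P Q : PSet} (hP : P.Directed) (hQ : Q.Directed) :
    PSet.Directed (P ∪ Q) := fun π hπ => (Finset.mem_union.1 hπ).elim (hP π) (hQ π)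

theorem PSet.Directed.subst {P : PSet} (hP : P.Directed) (θ : Subst ℕ ℕ) :
    (PSet.subst θ P).Directed := directed_of_mem_image_subst hP θ

theorem PSet.Directed.factoriseSet {P : PSet} (hP : P.Directed) :
    (factoriseSet P).Directed := by
  intro π hπ
  obtain ⟨κ, hκ, hπ⟩ := Finset.mem_biUnion.1 hπ
  exact directed_of_mem_factorise (hP κ hκ) hπ

theorem PSet.Directed.empty : PSet.Directed ∅ := by simp [PSet.Directed]

theorem factorise_sub_directed (R₁ R₂ : Row ℕ) : PSet.Directed (factorise (.sub R₁ R₂)) :=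
  fun _ => directed_of_mem_factorise trivial

theorem factorise_lack_directed (R : Row ℕ) (L : Finset ℕ) :
    PSet.Directed (factorise (.lack R L)) :=
  fun _ => directed_of_mem_factorise trivial

theorem Scheme.Directed.subst {σ : Scheme} (h : σ.Directed) (θ : Subst ℕ ℕ) :
    (σ.subst θ).Directed := directed_of_mem_image_subst h _

theorem Scheme.Directed.instQuals {σ : Scheme} (h : σ.Directed) (f : Kind → ℕ → ℕ) :
    (σ.instQuals f).Directed := directed_of_mem_image_subst h _

theorem Scheme.mono_directed (A : Ty ℕ) : (Scheme.mono A).Directed := by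
  simp [Scheme.Directed, Scheme.mono]

theorem PSet.Directed.gen {P : PSet} (h : P.Directed) (Γ : Env) (A : Ty ℕ) :
    (gen Γ P A).Directed := directed_of_mem_image_subst h _

theorem Env.Directed.subst {Γ : Env} (h : Γ.Directed) (θ : Subst ℕ ℕ) :
    (Env.subst θ Γ).Directed := List.forall_mem_map.2 fun p hp => (h p hp).subst θ

theorem Env.Directed.filter {Γ : Env} (h : Γ.Directed) (f : ℕ × Scheme → Bool) :
    Env.Directed (List.filter f Γ) := fun p hp => h p (List.mem_filter.1 hp).1

theorem Env.Directed.restrict {Γ : Env} (h : Γ.Directed) (S : Finset ℕ) :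
    (Env.restrict Γ S).Directed := h.filter _

theorem Env.Directed.unused {Γ : Env} (h : Γ.Directed) (S : Finset ℕ) :
    (Env.unused Γ S).Directed := h.filter _

theorem Env.Directed.nil : Env.Directed [] := by simp [Env.Directed]

theorem Env.Directed.cons {Γ : Env} (h : Γ.Directed) {σ : Scheme} (hσ : σ.Directed) (x : ℕ) :
    Env.Directed ((x, σ) :: Γ) := List.forall_mem_cons.2 ⟨hσ, h⟩

theorem Env.Directed.cons_mono {Γ : Env} (h : Γ.Directed) (x : ℕ) (A : Ty ℕ) :
    Env.Directed ((x, Scheme.mono A) :: Γ) := h.cons (Scheme.mono_directed A) x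

theorem Env.Directed.append {Γ Γ' : Env} (h : Γ.Directed) (h' : Γ'.Directed) :
    Env.Directed (Γ ++ Γ') := fun p hp => (List.mem_append.1 hp).elim (h p) (h' p)

theorem OpInfo.env_directed (i : OpInfo) (D : CTy ℕ) : (i.env D).Directed :=
  (Env.Directed.nil.cons_mono _ _).cons_mono _ _

theorem MakeLeq.directed {N N' : Finset (Kind × ℕ)} {Γ : Env} {τ : Typ ℕ} {Q : PSet}
    (h : MakeLeq N Γ τ Q N') (hτ : ∀ A, τ ≠ .val A) (hΓ : Γ.Directed) : Q.Directed := by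
  induction h with
  | nil => exact PSet.Directed.empty
  | cons _ _ ih =>
    obtain ⟨hσ, hΓ⟩ := List.forall_mem_cons.1 hΓ
    exact ((hσ.instQuals _).factoriseSet.union
      fun _ => directed_of_mem_factorise (π := .lin _ _) ⟨by simp, hτ⟩).union (ih hτ hΓ)

theorem MakeUnl.directed {N N' : Finset (Kind × ℕ)} {Γ : Env} {Q : PSet}
    (h : MakeUnl N Γ Q N') (hΓ : Γ.Directed) : Q.Directed :=
  MakeLeq.directed h (by simp) hΓ

theorem Env.mem_of_lookup {Γ : Env} {x : ℕ} {σ : Scheme} (h : Γ.lookup x = some σ) :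
    (x, σ) ∈ Γ := by
  obtain ⟨Γ₁, Γ₂, rfl, -⟩ := List.lookup_eq_some_iff.1 h
  simp

theorem foldr_preds_directed {ops : List OpInfo} (h : ∀ i ∈ ops, i.preds.Directed)
    (θ : Subst ℕ ℕ) :
    PSet.Directed (ops.foldr (fun i T => PSet.subst θ i.preds ∪ T) ∅) := by
  induction ops with
  | nil => exact PSet.Directed.empty
  | cons i ops ih =>
    obtain ⟨hi, hops⟩ := List.forall_mem_cons.1 h
    exact (hi.subst _).union (ih hops)

mutual

theorem InferV.directed {S : Sig} {N N' : Finset (Kind × ℕ)} {Γ : Env} {V : Val} {A : Ty ℕ}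
    {θ : Subst ℕ ℕ} {P : PSet} {used : Finset ℕ} (h : InferV S N Γ V A θ P used N')
    (hΓ : Γ.Directed) : P.Directed := by
  cases h with
  | var hx _ => exact (hΓ _ (Env.mem_of_lookup hx)).instQuals _
  | lam _ _ _ hM hQ₁ hQ₂ =>
    exact (InferC.directed hM (hΓ.cons_mono _ _)).union
      ((hQ₁.directed (by simp) ((hΓ.subst _).restrict _)).union
        (hQ₂.directed (((Env.Directed.nil.cons_mono _ _).subst _).unused _)))

theorem InferC.directed {S : Sig} {N N' : Finset (Kind × ℕ)} {Γ : Env} {M : Comp} {C : CTy ℕ}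
    {θ : Subst ℕ ℕ} {P : PSet} {used : Finset ℕ} (h : InferC S N Γ M C θ P used N')
    (hΓ : Γ.Directed) : P.Directed := by
  cases h with
  | app hV hW _ _ _ _ hQ =>
    exact ((((InferV.directed hV hΓ).subst _).union
      (InferV.directed hW (hΓ.subst _))).subst _).union
        (hQ.directed ((((hΓ.subst _).subst _).subst _).restrict _))
  | ret hV _ => exact InferV.directed hV hΓ
  | perform _ hV _ _ _ =>
    exact ((InferV.directed hV hΓ).subst _).union (factorise_sub_directed _ _)
  | letval _ hV hσ hM hQ₁ hQ₂ =>
    have hσ := hσ ▸ (InferV.directed hV hΓ).gen _ _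
    exact (InferC.directed hM ((hΓ.subst _).cons hσ _)).union
      ((hQ₁.directed (((hΓ.subst _).subst _).restrict _)).union
        (hQ₂.directed (((Env.Directed.nil.cons hσ _).subst _).unused _)))
  | seq _ hL hM _ hQ₁ hQ₂ hQ₃ =>
    exact (((InferC.directed hL hΓ).subst _).union
      (InferC.directed hM ((hΓ.subst _).cons_mono _ _))).union
        (((((hQ₁.directed (((hΓ.subst _).subst _).restrict _)).union
          (hQ₂.directed (((Env.Directed.nil.cons_mono _ _).subst _).unused _))).union
          (hQ₃.directed (by simp) (((hΓ.subst _).subst _).restrict _))).union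
          (factorise_sub_directed _ _)).union (factorise_sub_directed _ _))
  | handle hH hM _ hQ =>
    exact ((((InferH.directed hH hΓ).subst _).union
      (InferC.directed hM (hΓ.subst _))).subst _).union
        ((factorise_sub_directed _ _).union
          (hQ.directed ((((hΓ.subst _).subst _).subst _).restrict _)))

theorem InferH.directed {S : Sig} {N N' : Finset (Kind × ℕ)} {Γ : Env} {H : Handler}
    {C D : CTy ℕ} {θ : Subst ℕ ℕ} {P : PSet} {used : Finset ℕ}
    (h : InferH S N Γ H C D θ P used N') (hΓ : Γ.Directed) : P.Directed := by
  cases h with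
  | mk _ _ _ hM hops _ _ hQ₁ hQ₂ hQ₃ =>
    refine ((((((InferC.directed hM (hΓ.cons_mono _ _)).subst _).union ?_).union
      (hQ₁.directed ((hΓ.subst _).restrict _))).union (factorise_sub_directed _ _)).union
      (factorise_lack_directed _ _)).union
        ((hQ₂.directed (((Env.Directed.nil.cons_mono _ _).subst _).unused _)).union
          (hQ₃.directed ?_))
    · exact foldr_preds_directed (InferOps.directed hops hΓ) _
    · intro p hp
      obtain ⟨i, _, hi⟩ := List.mem_flatMap.1 hp
      exact (((OpInfo.env_directed i _).subst _).unused _) p hi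

theorem InferOps.directed {S : Sig} : ∀ {N N' : Finset (Kind × ℕ)} {Γ : Env} {D : CTy ℕ}
    {θ θ' : Subst ℕ ℕ} {cs : Clauses} {ops : List OpInfo},
    InferOps S N Γ D θ cs θ' ops N' → Γ.Directed → ∀ i ∈ ops, i.preds.Directed
  | _, _, _, _, _, _, _, _, .nil, _ => by simp
  | _, _, _, _, _, _, _, _, .cons _ _ _ _ _ hM _ hops, hΓ => fun j hj =>
    (List.mem_cons.1 hj).elim
      (fun h => h ▸ InferC.directed hM (((OpInfo.env_directed _ _).append hΓ).subst _))
      (fun h => InferOps.directed hops hΓ j h)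

end

theorem Generated.directed {P : PSet} (h : Generated P) : P.Directed := by
  obtain ⟨S, N, N', Γ, θ, used, _, _, hΓ, ⟨V, A, h⟩ | ⟨M, C, h⟩ | ⟨H, C, D, h⟩⟩ := h
  · exact h.directed hΓ
  · exact h.directed hΓ
  · exact h.directed hΓ

end DirectedPredicates

/-! ## Unification of linearity types and shared labels -/

section Unification

/-- A substitution that changes linearity variables only, as the unifiers of labels do. -/
def Subst.LinOnly (θ : Subst ℕ ℕ) : Prop := (∀ α, θ.ty α = .var α) ∧ ∀ μ, θ.row μ = Row.var μ

theorem Subst.LinOnly.id : Subst.LinOnly Subst.id := ⟨fun _ => rfl, fun _ => rfl⟩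

theorem Subst.LinOnly.oneLin (φ : ℕ) (Y : Lin ℕ) : (Subst.oneLin φ Y).LinOnly :=
  ⟨fun _ => rfl, fun _ => rfl⟩

theorem Subst.LinOnly.comp {θ θ' : Subst ℕ ℕ} (h' : θ'.LinOnly) (h : θ.LinOnly) :
    (θ'.comp θ).LinOnly :=
  ⟨fun α => by simp [Subst.comp, h.1, Ty.subst, h'.1],
    fun μ => by simp [Subst.comp, h.2, Row.subst_var, h'.2]⟩

theorem Subst.comp_oneLin {t : Subst ℕ ℕ} {φ : ℕ} {Y : Lin ℕ} (h : t.lin φ = Y.subst t) :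
    t.comp (Subst.oneLin φ Y) = t := by
  refine Subst.ext rfl (funext (Row.subst_var t)) (funext fun ψ => ?_)
  by_cases hψ : ψ = φ
  · simp [Subst.comp, Subst.oneLin, hψ, h]
  · simp [Subst.comp, Subst.oneLin, hψ, Subst.id, Subst.ren, Lin.subst]

theorem Lin.subst_oneLin_self (φ : ℕ) (Y : Lin ℕ) :
    Y.subst (Subst.oneLin φ Y) = Y := by
  cases Y with
  | var ψ =>
    by_cases h : ψ = φ
    · subst h; simp [Lin.subst, Subst.oneLin]
    · simp [Lin.subst, Subst.oneLin, h, Subst.id, Subst.ren]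
  | unl => rfl
  | any => rfl

theorem ulin_cases {Y₁ Y₂ : Lin ℕ} {θ : Subst ℕ ℕ} (h : ulin Y₁ Y₂ = some θ) :
    (Y₁ = Y₂ ∧ θ = Subst.id) ∨ (∃ φ, Y₁ = .var φ ∧ θ = Subst.oneLin φ Y₂) ∨
      ∃ φ, Y₂ = .var φ ∧ θ = Subst.oneLin φ Y₁ := by
  unfold ulin at h
  split at h
  case h_5 φ Y => split_ifs at h with hφ <;> cases h <;> simp [hφ]
  all_goals cases h
  all_goals simp

theorem ulin_unifies {Y₁ Y₂ : Lin ℕ} {θ : Subst ℕ ℕ} (h : ulin Y₁ Y₂ = some θ) :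
    Y₁.subst θ = Y₂.subst θ := by
  rcases ulin_cases h with ⟨rfl, rfl⟩ | ⟨φ, rfl, rfl⟩ | ⟨φ, rfl, rfl⟩
  · rfl
  · rw [Lin.subst_oneLin_self]; simp [Lin.subst, Subst.oneLin]
  · rw [Lin.subst_oneLin_self]; simp [Lin.subst, Subst.oneLin]

theorem ulin_linOnly {Y₁ Y₂ : Lin ℕ} {θ : Subst ℕ ℕ} (h : ulin Y₁ Y₂ = some θ) :
    θ.LinOnly := by
  rcases ulin_cases h with ⟨rfl, rfl⟩ | ⟨φ, rfl, rfl⟩ | ⟨φ, rfl, rfl⟩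
  · exact .id
  · exact .oneLin _ _
  · exact .oneLin _ _

theorem ulin_mapsVars {Y₁ Y₂ : Lin ℕ} {θ : Subst ℕ ℕ} {N : Finset (Kind × ℕ)}
    (h : ulin Y₁ Y₂ = some θ) (h₁ : Y₁.fv ⊆ N) (h₂ : Y₂.fv ⊆ N) : θ.MapsVars N N := by
  rcases ulin_cases h with ⟨rfl, rfl⟩ | ⟨φ, rfl, rfl⟩ | ⟨φ, rfl, rfl⟩
  · exact .id subset_rfl
  · exact .oneLin h₂
  · exact .oneLin h₁

theorem ulin_complete {Y₁ Y₂ : Lin ℕ} {t : Subst ℕ ℕ} (h : Y₁.subst t = Y₂.subst t) :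
    ∃ θ, ulin Y₁ Y₂ = some θ ∧ t.comp θ = t := by
  obtain ⟨θ, hθ⟩ : ∃ θ, ulin Y₁ Y₂ = some θ := by
    unfold ulin
    split
    case h_5 φ Y => split_ifs <;> exact ⟨_, rfl⟩
    all_goals first | exact ⟨_, rfl⟩ | cases h
  refine ⟨θ, hθ, ?_⟩
  rcases ulin_cases hθ with ⟨rfl, rfl⟩ | ⟨φ, rfl, rfl⟩ | ⟨φ, rfl, rfl⟩
  · exact Subst.comp_id t
  · exact Subst.comp_oneLin h
  · exact Subst.comp_oneLin h.symm

theorem ULab.linOnly {K₁ K₂ : CRow ℕ} {r : Option (Subst ℕ ℕ)} (h : ULab K₁ K₂ r) :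
    ∀ θ ∈ r, θ.LinOnly := by
  induction h with
  | nil_left | nil_right => rintro _ ⟨⟩; exact .id
  | shared hu _ ih =>
    intro θ hθ
    obtain ⟨θ', hθ', rfl⟩ := Option.map_eq_some_iff.1 hθ
    exact (ih θ' hθ').comp (ulin_linOnly hu)
  | clash => rintro _ ⟨⟩
  | skip_left _ _ ih => exact ih
  | skip_right _ _ ih => exact ih

theorem ULab.mapsVars {N : Finset (Kind × ℕ)} {K₁ K₂ : CRow ℕ} {r : Option (Subst ℕ ℕ)}
    (h : ULab K₁ K₂ r) :
    (∀ e ∈ K₁, e.2.fv ⊆ N) → (∀ e ∈ K₂, e.2.fv ⊆ N) → ∀ θ ∈ r, θ.MapsVars N N := by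
  induction h with
  | nil_left | nil_right => rintro _ _ _ ⟨⟩; exact .id subset_rfl
  | shared hu _ ih =>
    intro h₁ h₂ θ hθ
    obtain ⟨θ', hθ', rfl⟩ := Option.map_eq_some_iff.1 hθ
    have hm := ulin_mapsVars hu (h₁ _ (Multiset.mem_cons_self _ _))
      (h₂ _ (Multiset.mem_cons_self _ _))
    exact (ih (CRow.fv_subst hm fun e he => h₁ e (Multiset.mem_cons_of_mem he))
      (CRow.fv_subst hm fun e he => h₂ e (Multiset.mem_cons_of_mem he)) θ' hθ').comp hm
  | clash => rintro _ _ _ ⟨⟩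
  | skip_left _ _ ih => exact fun h₁ => ih fun e he => h₁ e (Multiset.mem_cons_of_mem he)
  | skip_right _ _ ih =>
    exact fun h₁ h₂ => ih h₁ fun e he => h₂ e (Multiset.mem_cons_of_mem he)

theorem ULab.complete {K₁ K₂ : CRow ℕ} {r : Option (Subst ℕ ℕ)} (h : ULab K₁ K₂ r)
    {t : Subst ℕ ℕ} :
    (∀ ℓ Y₁ Y₂, (ℓ, Y₁) ∈ K₁ → (ℓ, Y₂) ∈ K₂ → Y₁.subst t = Y₂.subst t) →
    ∃ θ, r = some θ ∧ t.comp θ = t := by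
  induction h with
  | nil_left | nil_right => exact fun _ => ⟨_, rfl, Subst.comp_id t⟩
  | @shared ℓ Y₁ Y₂ K₁ K₂ θ r hu _ ih =>
    intro H
    have hθ : t.comp θ = t := by
      obtain ⟨θ', hu', h'⟩ := ulin_complete
        (H ℓ Y₁ Y₂ (Multiset.mem_cons_self _ _) (Multiset.mem_cons_self _ _))
      rw [hu] at hu'; cases hu'; exact h'
    obtain ⟨θ', rfl, hθ'⟩ := ih (by
      intro ℓ' Z₁ Z₂ hZ₁ hZ₂
      obtain ⟨⟨_, Z₁⟩, h₁, e₁⟩ := CRow.mem_subst.1 hZ₁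
      obtain ⟨⟨_, Z₂⟩, h₂, e₂⟩ := CRow.mem_subst.1 hZ₂
      cases e₁; cases e₂
      rw [Lin.subst_comp, Lin.subst_comp, hθ]
      exact H _ _ _ (Multiset.mem_cons_of_mem h₁) (Multiset.mem_cons_of_mem h₂))
    exact ⟨_, rfl, by rw [← Subst.comp_assoc, hθ', hθ]⟩
  | clash hu =>
    intro H
    obtain ⟨θ', hu', _⟩ := ulin_complete
      (H _ _ _ (Multiset.mem_cons_self _ _) (Multiset.mem_cons_self _ _))
    rw [hu] at hu'; cases hu'
  | skip_left _ _ ih =>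
    exact fun H => ih fun ℓ Y₁ Y₂ h₁ h₂ => H ℓ Y₁ Y₂ (Multiset.mem_cons_of_mem h₁) h₂
  | skip_right _ _ ih =>
    exact fun H => ih fun ℓ Y₁ Y₂ h₁ h₂ => H ℓ Y₁ Y₂ h₁ (Multiset.mem_cons_of_mem h₂)

theorem ULab.unifies {K₁ K₂ : CRow ℕ} {r : Option (Subst ℕ ℕ)} (h : ULab K₁ K₂ r) :
    (K₁.map Prod.fst).Nodup → (K₂.map Prod.fst).Nodup → ∀ θ ∈ r,
    ∀ ℓ Y₁ Y₂, (ℓ, Y₁) ∈ K₁ → (ℓ, Y₂) ∈ K₂ → Y₁.subst θ = Y₂.subst θ := by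
  induction h with
  | nil_left => intro _ _ _ _ _ _ _ h; simp at h
  | nil_right => intro _ _ _ _ _ _ _ _ h; simp at h
  | @shared ℓ Y₁ Y₂ K₁ K₂ θ r hu _ ih =>
    intro hK₁ hK₂ θ' hθ' ℓ' Z₁ Z₂ hZ₁ hZ₂
    obtain ⟨θ', rfl, rfl⟩ := Option.map_eq_some_iff.1 hθ'
    rw [Multiset.map_cons, Multiset.nodup_cons] at hK₁ hK₂
    rw [← Lin.subst_comp, ← Lin.subst_comp]
    rcases Multiset.mem_cons.1 hZ₁ with h₁ | h₁ <;> rcases Multiset.mem_cons.1 hZ₂ with h₂ | h₂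
    · cases h₁; cases h₂; rw [ulin_unifies hu]
    · cases h₁; exact absurd (Multiset.mem_map_of_mem Prod.fst h₂) hK₂.1
    · cases h₂; exact absurd (Multiset.mem_map_of_mem Prod.fst h₁) hK₁.1
    · exact ih (CRow.nodup_map_fst_subst.2 hK₁.2) (CRow.nodup_map_fst_subst.2 hK₂.2) θ' rfl ℓ' _ _
        (CRow.mem_subst.2 ⟨_, h₁, rfl⟩) (CRow.mem_subst.2 ⟨_, h₂, rfl⟩)
  | clash => rintro _ _ _ ⟨⟩
  | skip_left hℓ _ ih =>
    intro hK₁ hK₂ θ hθ ℓ' Z₁ Z₂ hZ₁ hZ₂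
    rw [Multiset.map_cons, Multiset.nodup_cons] at hK₁
    rcases Multiset.mem_cons.1 hZ₁ with h₁ | h₁
    · cases h₁; exact absurd (CRow.mem_dom.2 ⟨_, hZ₂⟩) hℓ
    · exact ih hK₁.2 hK₂ θ hθ ℓ' Z₁ Z₂ h₁ hZ₂
  | skip_right hℓ _ ih =>
    intro hK₁ hK₂ θ hθ ℓ' Z₁ Z₂ hZ₁ hZ₂
    rw [Multiset.map_cons, Multiset.nodup_cons] at hK₂
    rcases Multiset.mem_cons.1 hZ₂ with h₂ | h₂
    · cases h₂; exact absurd (CRow.mem_dom.2 ⟨_, hZ₁⟩) hℓ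
    · exact ih hK₁ hK₂.2 θ hθ ℓ' Z₁ Z₂ hZ₁ h₂

theorem ULab.exists_result (K₁ K₂ : CRow ℕ) : ∃ r, ULab K₁ K₂ r := by
  induction hn : K₁.card + K₂.card using Nat.strong_induction_on generalizing K₁ K₂ with
  | _ n ih =>
    subst hn
    induction K₁ using Multiset.induction_on with
    | empty => exact ⟨_, .nil_left _⟩
    | cons e K₁ _ =>
      obtain ⟨ℓ, Y₁⟩ := e
      by_cases hℓ : ℓ ∈ CRow.dom K₂
      · obtain ⟨Y₂, hY₂⟩ := CRow.mem_dom.1 hℓ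
        obtain ⟨K₂, rfl⟩ := Multiset.exists_cons_of_mem hY₂
        cases hu : ulin Y₁ Y₂ with
        | none => exact ⟨_, .clash hu⟩
        | some θ =>
          obtain ⟨r, hr⟩ := ih ((CRow.subst θ K₁).card + (CRow.subst θ K₂).card)
            (by simp [CRow.subst]; omega) _ _ rfl
          exact ⟨_, .shared hu hr⟩
      · obtain ⟨r, hr⟩ := ih (K₁.card + K₂.card) (by simp) _ _ rfl
        exact ⟨r, .skip_left hℓ hr⟩

end Unification

/-! ## Steps of the row solver -/

section RowSubstitution

variable {θ t : Subst ℕ ℕ} {K K₁ K₂ : CRow ℕ} {t₁ t₂ : Option ℕ}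

theorem Row.subst_of_linOnly (h : θ.LinOnly) (R : Row ℕ) :
    R.subst θ = ⟨CRow.subst θ R.labels, R.tail⟩ := by
  rw [Row.ext_iff, Row.subst_labels, Row.subst_tail]
  cases R.tail <;> simp [h.2, Row.var]

theorem Row.subst_eq_of_linOnly (hθ : θ.LinOnly) (ht : t.comp θ = t) (R : Row ℕ) :
    R.subst t = (⟨CRow.subst θ R.labels, R.tail⟩ : Row ℕ).subst t := by
  rw [← Row.subst_of_linOnly hθ, Row.subst_comp, ht]

theorem CRow.subst_oneRow (μ : ℕ) (R : Row ℕ) (K : CRow ℕ) :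
    CRow.subst (Subst.oneRow μ R) K = K :=
  (CRow.subst_congr_lin (t := Subst.id) rfl K).trans (CRow.subst_id K)

theorem Row.subst_oneRow_of_ne {μ : ℕ} (h : t₁ ≠ some μ) (R : Row ℕ) (K : CRow ℕ) :
    (⟨K, t₁⟩ : Row ℕ).subst (Subst.oneRow μ R) = ⟨K, t₁⟩ := by
  rw [Row.ext_iff, Row.subst_labels, Row.subst_tail, CRow.subst_oneRow]
  cases t₁ with
  | none => simp
  | some ν =>
    have hν : ν ≠ μ := fun e => h (by rw [e])
    simp [Subst.oneRow, hν, Subst.id, Subst.ren, Row.var]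

theorem Row.subst_oneRow_self (μ : ℕ) (R : Row ℕ) (K : CRow ℕ) :
    (⟨K, some μ⟩ : Row ℕ).subst (Subst.oneRow μ R) = ⟨K + R.labels, R.tail⟩ := by
  rw [Row.ext_iff, Row.subst_labels, Row.subst_tail, CRow.subst_oneRow]
  simp [Subst.oneRow]

theorem Subst.oneRow_comp_row (h : θ.LinOnly) (μ : ℕ) (R : Row ℕ) :
    ((Subst.oneRow μ R).comp θ).row = Function.update Subst.id.row μ R := by
  funext ν
  change (θ.row ν).subst _ = _
  rw [h.2, Row.subst_var]
  rfl

theorem Row.Sub.subst_of_tail {D : CRow ℕ} (hK : ∀ e ∈ K₁, e ∈ K₂) (hD : ∀ e ∈ D, e ∈ K₂)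
    (h : ∀ μ₁, t₁ = some μ₁ → t₁ ≠ t₂ → (t.row μ₁).Sub ((⟨D, t₂⟩ : Row ℕ).subst t)) :
    ((⟨K₁, t₁⟩ : Row ℕ).subst t).Sub ((⟨K₂, t₂⟩ : Row ℕ).subst t) := by
  refine ⟨fun e he => ?_, fun μ hμ => ?_⟩
  · rcases Row.mem_subst.1 he with ⟨e', he', rfl⟩ | ⟨μ₁, hμ₁, he⟩
    · exact Row.mem_subst.2 (.inl ⟨e', hK e' he', rfl⟩)
    · by_cases ht : t₁ = t₂
      · exact Row.mem_subst.2 (.inr ⟨μ₁, ht ▸ hμ₁, he⟩)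
      · rcases Row.mem_subst.1 ((h μ₁ hμ₁ ht).1 e he) with ⟨e', he', rfl⟩ | h'
        · exact Row.mem_subst.2 (.inl ⟨e', hD e' he', rfl⟩)
        · exact Row.mem_subst.2 (.inr h')
  · by_cases ht : t₁ = t₂
    · subst ht; rw [Row.subst_tail] at hμ ⊢; exact hμ
    · rw [Row.subst_tail, Option.bind_eq_some_iff] at hμ
      obtain ⟨μ₁, hμ₁, hμ⟩ := hμ
      have := (h μ₁ hμ₁ ht).2 μ hμ
      rwa [Row.subst_tail] at this ⊢

end RowSubstitution

section Reduction

theorem entails_empty_sub {R₁ R₂ : Row ℕ} : Entails ∅ (.sub R₁ R₂) ↔ R₁.Sub R₂ := by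
  refine ⟨fun h => ?_, .sub⟩
  cases h with
  | subsume h => simp at h
  | sub h => exact h

theorem entails_empty_lack {R : Row ℕ} {L : Finset ℕ} :
    Entails ∅ (.lack R L) ↔ Disjoint (CRow.dom R.labels) L := by
  refine ⟨fun h => ?_, .lack⟩
  cases h with
  | subsume h => simp at h
  | lack h => exact h

/-- The predicate that remains of `K₁;t₁ ⩽ R₂` when the labels in `K₁` have been removed, and the
rest of `R₂` is `R`. -/
def leftover (t₁ : Option ℕ) (R : Row ℕ) : PSet :=
  t₁.elim ∅ (fun μ₁ => {.sub (Row.var μ₁) R})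

theorem mem_leftover {t₁ : Option ℕ} {R : Row ℕ} {κ : Pred ℕ} :
    κ ∈ leftover t₁ R ↔ ∃ μ₁, t₁ = some μ₁ ∧ κ = .sub (Row.var μ₁) R := by
  cases t₁ <;> simp [leftover]

/-- `Reduce μ π δ X`: the row solver simplifies `π` under the substitution `δ`, which may use the
fresh variable `μ`, to the predicates in `X`. -/
inductive Reduce (μ : ℕ) : Pred ℕ → Subst ℕ ℕ → PSet → Prop
  | lin (τ₁ τ₂ : Typ ℕ) : Reduce μ (.lin τ₁ τ₂) Subst.id {.lin τ₁ τ₂}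
  | lack_closed {K : CRow ℕ} {L : Finset ℕ} :
      Disjoint (CRow.dom K) L → Reduce μ (.lack ⟨K, none⟩ L) Subst.id ∅
  | lack_open {K : CRow ℕ} {μ₁ : ℕ} {L : Finset ℕ} :
      Disjoint (CRow.dom K) L → Reduce μ (.lack ⟨K, some μ₁⟩ L) Subst.id {.lack (Row.var μ₁) L}
  | sub {K₁ K₂ : CRow ℕ} {t₁ t₂ : Option ℕ} {θ : Subst ℕ ℕ} :
      ULab K₁ K₂ (some θ) →
      (∀ e ∈ CRow.subst θ K₁, e ∈ CRow.subst θ K₂) →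
      Reduce μ (.sub ⟨K₁, t₁⟩ ⟨K₂, t₂⟩) θ
        (if t₁ = t₂ then ∅
          else leftover t₁ ⟨CRow.diff (CRow.subst θ K₂) (CRow.subst θ K₁), t₂⟩)
  | extend {K₁ K₂ : CRow ℕ} {t₁ : Option ℕ} {μ₂ : ℕ} {θ : Subst ℕ ℕ} :
      ULab K₁ K₂ (some θ) →
      t₁ ≠ some μ₂ →
      ¬ (∀ e ∈ CRow.subst θ K₁, e ∈ CRow.subst θ K₂) →
      Reduce μ (.sub ⟨K₁, t₁⟩ ⟨K₂, some μ₂⟩)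
        ((Subst.oneRow μ₂ ⟨CRow.diff (CRow.subst θ K₁) (CRow.subst θ K₂), some μ⟩).comp θ)
        (leftover t₁ ⟨CRow.diff (CRow.subst θ K₂) (CRow.subst θ K₁), some μ⟩)

/-- The substitution `δ` adds labels to the row variable on the right of the inclusion `π`. -/
def Subst.Extends (δ : Subst ℕ ℕ) (π : Pred ℕ) : Prop :=
  ∃ R₁ R₂ μ₂, π = .sub R₁ R₂ ∧ R₂.tail = some μ₂ ∧ 0 < (δ.row μ₂).labels.card

/-- The effect on the sets `P` and `Q` of solved and unsolved predicates when `π` is simplified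
under `δ` to `X`: solved predicates stay solved as long as `δ` leaves row variables alone. -/
inductive Update (π : Pred ℕ) (δ : Subst ℕ ℕ) (X P Q : PSet) : PSet → PSet → Prop
  | keep : δ.LinOnly → Update π δ X P Q (X ∪ PSet.subst δ P) (PSet.subst δ Q)
  | reset : δ.Extends π → Update π δ X P Q X (PSet.subst δ (Q ∪ P))

theorem PSet.subst_union (θ : Subst ℕ ℕ) (P Q : PSet) :
    PSet.subst θ (P ∪ Q) = PSet.subst θ P ∪ PSet.subst θ Q := Finset.image_union _ _

theorem Update.union_eq {π : Pred ℕ} {δ : Subst ℕ ℕ} {X P Q P₁ Q₁ : PSet}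
    (h : Update π δ X P Q P₁ Q₁) : P₁ ∪ Q₁ = X ∪ PSet.subst δ (P ∪ Q) := by
  cases h with
  | keep => rw [PSet.subst_union, Finset.union_assoc]
  | reset => rw [Finset.union_comm Q P]

theorem subCase_eq (θ : Subst ℕ ℕ) (P Q : PSet) (μ : ℕ) (K₁ : CRow ℕ) (t₁ : Option ℕ)
    (K₂ : CRow ℕ) (t₂ : Option ℕ) (θ' : Subst ℕ ℕ) :
    subCase θ P Q μ K₁ t₁ K₂ t₂ θ' =
      if ∀ e ∈ CRow.subst θ' K₁, e ∈ CRow.subst θ' K₂ then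
        some (θ'.comp θ,
          (if t₁ = t₂ then ∅
            else leftover t₁ ⟨CRow.diff (CRow.subst θ' K₂) (CRow.subst θ' K₁), t₂⟩) ∪
              PSet.subst θ' P,
          PSet.subst θ' Q)
      else if t₁ = t₂ then none
      else t₂.bind fun μ₂ =>
        let δ := (Subst.oneRow μ₂
          ⟨CRow.diff (CRow.subst θ' K₁) (CRow.subst θ' K₂), some μ⟩).comp θ'
        some (δ.comp θ,
          leftover t₁ ⟨CRow.diff (CRow.subst θ' K₂) (CRow.subst θ' K₁), some μ⟩,
          PSet.subst δ (Q ∪ P)) := by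
  unfold subCase leftover
  rcases t₁ with _ | μ₁ <;> rcases t₂ with _ | μ₂
  · simp
  · simp
  · simp
  · by_cases h : μ₁ = μ₂ <;> simp [h]

variable {θ θ₁ : Subst ℕ ℕ} {P Q P₁ Q₁ : PSet} {μ : ℕ}

theorem exists_reduce_of_subCase_eq_some {K₁ K₂ : CRow ℕ} {t₁ t₂ : Option ℕ} {θ' : Subst ℕ ℕ}
    (hu : ULab K₁ K₂ (some θ')) (h : subCase θ P Q μ K₁ t₁ K₂ t₂ θ' = some (θ₁, P₁, Q₁)) :
    ∃ δ X, Reduce μ (.sub ⟨K₁, t₁⟩ ⟨K₂, t₂⟩) δ X ∧ θ₁ = δ.comp θ ∧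
      Update (.sub ⟨K₁, t₁⟩ ⟨K₂, t₂⟩) δ X P Q P₁ Q₁ := by
  rw [subCase_eq] at h
  have hθ' := hu.linOnly _ rfl
  split_ifs at h with hK ht ht
  · cases h
    exact ⟨_, _, .sub hu hK, rfl, by rw [if_pos ht]; exact .keep hθ'⟩
  · cases h
    exact ⟨_, _, .sub hu hK, rfl, by rw [if_neg ht]; exact .keep hθ'⟩
  · obtain ⟨μ₂, rfl, h⟩ := Option.bind_eq_some_iff.1 h
    cases h
    refine ⟨_, _, .extend hu ht hK, rfl, .reset ⟨_, _, μ₂, rfl, rfl, ?_⟩⟩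
    rw [Subst.oneRow_comp_row hθ', Function.update_self]
    push Not at hK
    obtain ⟨e, he, he'⟩ := hK
    exact Multiset.card_pos_iff_exists_mem.2 ⟨e, CRow.mem_diff.2 ⟨he, he'⟩⟩

theorem RowStep.reduce {π : Pred ℕ} (h : RowStep θ P Q μ π (some (θ₁, P₁, Q₁))) :
    ∃ δ X, Reduce μ π δ X ∧ θ₁ = δ.comp θ ∧ Update π δ X P Q P₁ Q₁ := by
  have keep (X : PSet) : Update π Subst.id X P Q (X ∪ P) Q := by
    simpa only [PSet.subst_id] using Update.keep (π := π) (X := X) (P := P) (Q := Q) .id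
  generalize hr : some (θ₁, P₁, Q₁) = r at h
  cases h with
  | lin τ₁ τ₂ =>
    cases hr
    exact ⟨_, _, .lin τ₁ τ₂, (Subst.id_comp _).symm, keep _⟩
  | lack_closed K L =>
    split_ifs at hr with hK
    cases hr
    exact ⟨_, _, .lack_closed hK, (Subst.id_comp _).symm, by simpa using keep ∅⟩
  | lack_open K μ₁ L =>
    split_ifs at hr with hK
    cases hr
    exact ⟨_, _, .lack_open hK, (Subst.id_comp _).symm, keep _⟩
  | sub hu =>
    obtain ⟨θ', rfl, h⟩ := Option.bind_eq_some_iff.1 hr.symm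
    exact exists_reduce_of_subCase_eq_some hu h

theorem RowStep.exists_result (θ : Subst ℕ ℕ) (P Q : PSet) (μ : ℕ) (π : Pred ℕ) :
    ∃ r, RowStep θ P Q μ π r := by
  rcases π with ⟨τ₁, τ₂⟩ | ⟨⟨K₁, t₁⟩, ⟨K₂, t₂⟩⟩ | ⟨⟨K, _ | μ₁⟩, L⟩
  · exact ⟨_, .lin τ₁ τ₂⟩
  · obtain ⟨r, hr⟩ := ULab.exists_result K₁ K₂
    exact ⟨_, .sub hr⟩
  · exact ⟨_, .lack_closed K L⟩
  · exact ⟨_, .lack_open K μ₁ L⟩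

/-- The possible shapes of the predicates `κ` to which the row solver simplifies `π`, where `π` is
already instantiated by the substitution of the step. -/
inductive Residual : Pred ℕ → Pred ℕ → Prop
  | lin (τ₁ τ₂ : Typ ℕ) : Residual (.lin τ₁ τ₂) (.lin τ₁ τ₂)
  | lack {R : Row ℕ} {μ₁ : ℕ} (L : Finset ℕ) :
      R.tail = some μ₁ → Residual (.lack R L) (.lack (Row.var μ₁) L)
  | sub {R₁ R₂ R : Row ℕ} {μ₁ : ℕ} :
      R₁.tail = some μ₁ → (∀ e ∈ R.labels, e ∈ R₂.labels) → R.tail = R₂.tail →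
      Residual (.sub R₁ R₂) (.sub (Row.var μ₁) R)

theorem Reduce.residual {π κ : Pred ℕ} {δ : Subst ℕ ℕ} {X : PSet} (h : Reduce μ π δ X)
    (hκ : κ ∈ X) : Residual (π.subst δ) κ := by
  cases h with
  | lin τ₁ τ₂ => rw [Finset.mem_singleton.1 hκ, Pred.subst_id]; exact .lin τ₁ τ₂
  | lack_closed => simp at hκ
  | lack_open => rw [Finset.mem_singleton.1 hκ, Pred.subst_id]; exact .lack _ rfl
  | sub hu _ =>
    split_ifs at hκ with ht
    · simp at hκ
    · obtain ⟨μ₁, rfl, rfl⟩ := mem_leftover.1 hκ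
      rw [Pred.subst, Row.subst_of_linOnly (hu.linOnly _ rfl),
        Row.subst_of_linOnly (hu.linOnly _ rfl)]
      exact .sub rfl (fun e he => (CRow.mem_diff.1 he).1) rfl
  | extend hu ht _ =>
    obtain ⟨μ₁, rfl, rfl⟩ := mem_leftover.1 hκ
    rw [Pred.subst, ← Row.subst_comp, ← Row.subst_comp, Row.subst_of_linOnly (hu.linOnly _ rfl),
      Row.subst_of_linOnly (hu.linOnly _ rfl), Row.subst_oneRow_of_ne ht, Row.subst_oneRow_self]
    exact .sub rfl (fun e he => Multiset.mem_add.2 (.inl (CRow.mem_diff.1 he).1)) rfl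

end Reduction

section Soundness

theorem leftover_entails {t : Subst ℕ ℕ} {t₁ : Option ℕ} {R : Row ℕ}
    (h : ∀ κ ∈ leftover t₁ R, Entails ∅ (κ.subst t)) {μ₁ : ℕ} (hμ₁ : t₁ = some μ₁) :
    (t.row μ₁).Sub (R.subst t) := by
  have := h _ (mem_leftover.2 ⟨μ₁, hμ₁, rfl⟩)
  rwa [Pred.subst, entails_empty_sub, Row.subst_var] at this

theorem entails_lack_subst_iff {t : Subst ℕ ℕ} {R : Row ℕ} {L : Finset ℕ} :
    Entails ∅ ((Pred.lack R L).subst t) ↔ Disjoint (CRow.dom R.labels) L ∧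
      ∀ μ, R.tail = some μ → Entails ∅ ((Pred.lack (Row.var μ) L).subst t) := by
  simp only [Pred.subst, entails_empty_lack, Row.subst_var, CRow.disjoint_dom, Row.mem_subst]
  constructor
  · exact fun h => ⟨fun e he => h (e.1, e.2.subst t) (.inl ⟨e, he, rfl⟩),
      fun μ hμ e he => h e (.inr ⟨μ, hμ, he⟩)⟩
  · rintro ⟨hR, hμ⟩ _ (⟨e, he, rfl⟩ | ⟨μ, hRμ, he⟩)
    · exact hR e he
    · exact hμ μ hRμ _ he

theorem Reduce.sound {μ : ℕ} {π : Pred ℕ} {δ : Subst ℕ ℕ} {X : PSet} (h : Reduce μ π δ X)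
    {t : Subst ℕ ℕ} (hX : ∀ κ ∈ X, Entails ∅ (κ.subst t)) :
    Entails ∅ ((π.subst δ).subst t) := by
  cases h with
  | lin τ₁ τ₂ => rw [Pred.subst_id]; exact hX _ (Finset.mem_singleton_self _)
  | lack_closed hK =>
    rw [Pred.subst_id, entails_lack_subst_iff]
    exact ⟨hK, by simp⟩
  | lack_open hK =>
    rw [Pred.subst_id, entails_lack_subst_iff]
    refine ⟨hK, ?_⟩
    rintro _ ⟨⟩
    exact hX _ (Finset.mem_singleton_self _)
  | @sub K₁ K₂ _ _ _ hu hK =>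
    rw [Pred.subst, Pred.subst, entails_empty_sub, Row.subst_of_linOnly (hu.linOnly _ rfl),
      Row.subst_of_linOnly (hu.linOnly _ rfl)]
    refine Row.Sub.subst_of_tail (D := CRow.diff (CRow.subst δ K₂) (CRow.subst δ K₁)) hK
      (fun e he => (CRow.mem_diff.1 he).1) fun μ₁ hμ₁ ht => ?_
    rw [if_neg ht] at hX
    exact leftover_entails hX hμ₁
  | @extend K₁ K₂ t₁ μ₂ θ hu ht hK =>
    rw [Pred.subst, Pred.subst, entails_empty_sub, ← Row.subst_comp, ← Row.subst_comp,
      Row.subst_of_linOnly (hu.linOnly _ rfl), Row.subst_of_linOnly (hu.linOnly _ rfl),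
      Row.subst_oneRow_of_ne ht, Row.subst_oneRow_self]
    refine Row.Sub.subst_of_tail (D := CRow.diff (CRow.subst θ K₂) (CRow.subst θ K₁))
      (fun e he => Multiset.mem_add.2 ?_)
      (fun e he => Multiset.mem_add.2 (.inl (CRow.mem_diff.1 he).1))
      fun μ₁ hμ₁ _ => leftover_entails hX hμ₁
    by_cases he' : e ∈ CRow.subst θ K₂
    · exact .inl he'
    · exact .inr (CRow.mem_diff.2 ⟨he, he'⟩)

end Soundness

section Completeness

variable {t : Subst ℕ ℕ} {K₁ K₂ : CRow ℕ} {t₁ t₂ : Option ℕ}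

theorem Row.Sub.shared_eq (hs : ((⟨K₁, t₁⟩ : Row ℕ).subst t).Sub ((⟨K₂, t₂⟩ : Row ℕ).subst t))
    (h₂ : ((⟨K₂, t₂⟩ : Row ℕ).subst t).WF) :
    ∀ ℓ Y₁ Y₂, (ℓ, Y₁) ∈ K₁ → (ℓ, Y₂) ∈ K₂ → Y₁.subst t = Y₂.subst t :=
  fun _ _ _ hY₁ hY₂ => CRow.eq_of_fst_eq h₂ (hs.1 _ (Row.mem_subst.2 (.inl ⟨_, hY₁, rfl⟩)))
    (Row.mem_subst.2 (.inl ⟨_, hY₂, rfl⟩))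

theorem ULab.exists_sub_subst {r : Option (Subst ℕ ℕ)} (hu : ULab K₁ K₂ r)
    (h₁ : ((⟨K₁, t₁⟩ : Row ℕ).subst t).WF) (h₂ : ((⟨K₂, t₂⟩ : Row ℕ).subst t).WF)
    (hs : ((⟨K₁, t₁⟩ : Row ℕ).subst t).Sub ((⟨K₂, t₂⟩ : Row ℕ).subst t)) :
    ∃ θ, r = some θ ∧ t.comp θ = t ∧ ((⟨CRow.subst θ K₁, t₁⟩ : Row ℕ).subst t).WF ∧
      ((⟨CRow.subst θ K₂, t₂⟩ : Row ℕ).subst t).WF ∧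
      ((⟨CRow.subst θ K₁, t₁⟩ : Row ℕ).subst t).Sub ((⟨CRow.subst θ K₂, t₂⟩ : Row ℕ).subst t) := by
  obtain ⟨θ, rfl, hθ⟩ := hu.complete (hs.shared_eq h₂)
  have heq := Row.subst_eq_of_linOnly (hu.linOnly θ rfl) hθ
  exact ⟨θ, rfl, hθ, heq ⟨K₁, t₁⟩ ▸ h₁, heq ⟨K₂, t₂⟩ ▸ h₂,
    heq ⟨K₂, t₂⟩ ▸ heq ⟨K₁, t₁⟩ ▸ hs⟩

theorem ULab.unifies_subst {θ : Subst ℕ ℕ} (h : ULab K₁ K₂ (some θ))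
    (hK₁ : (K₁.map Prod.fst).Nodup) (hK₂ : (K₂.map Prod.fst).Nodup) :
    ∀ ℓ Y₁ Y₂, (ℓ, Y₁) ∈ CRow.subst θ K₁ → (ℓ, Y₂) ∈ CRow.subst θ K₂ → Y₁ = Y₂ := by
  intro ℓ Y₁ Y₂ hY₁ hY₂
  obtain ⟨⟨_, Z₁⟩, z₁, e₁⟩ := CRow.mem_subst.1 hY₁
  obtain ⟨⟨_, Z₂⟩, z₂, e₂⟩ := CRow.mem_subst.1 hY₂
  cases e₁; cases e₂
  exact h.unifies hK₁ hK₂ _ rfl _ _ _ z₁ z₂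

theorem Row.WF.fst_ne_of_mem_tail (h₁ : ((⟨K₁, t₁⟩ : Row ℕ).subst t).WF) {μ₁ : ℕ}
    (ht : t₁ = some μ₁) {e e' : ℕ × Lin ℕ} (he : e ∈ K₁) (he' : e' ∈ (t.row μ₁).labels) :
    e.1 ≠ e'.1 := by
  subst ht
  rw [Row.WF, Row.subst_labels] at h₁
  intro h
  obtain ⟨ℓ', Y'⟩ := e'
  cases h
  exact CRow.notMem_of_nodup_add h₁ (CRow.mem_subst.2 ⟨e, he, rfl⟩) he'

theorem Row.WF.diff (h₂ : ((⟨K₂, t₂⟩ : Row ℕ).subst t).WF) :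
    ((⟨CRow.diff K₂ K₁, t₂⟩ : Row ℕ).subst t).WF := by
  rw [Row.WF, Row.subst_labels] at *
  exact CRow.nodup_map_fst_of_le
    (add_le_add_left (CRow.subst_mono (CRow.diff_le K₂ K₁)) _) h₂

theorem Row.Sub.tail_sub (hs : ((⟨K₁, t₁⟩ : Row ℕ).subst t).Sub ((⟨K₂, t₂⟩ : Row ℕ).subst t))
    (h₁ : ((⟨K₁, t₁⟩ : Row ℕ).subst t).WF) {μ₁ : ℕ} (ht : t₁ = some μ₁) :
    (t.row μ₁).Sub ((⟨CRow.diff K₂ K₁, t₂⟩ : Row ℕ).subst t) := by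
  refine ⟨fun e he => ?_, fun μ hμ => ?_⟩
  · rcases Row.mem_subst.1 (hs.1 e (Row.mem_subst.2 (.inr ⟨μ₁, ht, he⟩))) with
      ⟨e', he', rfl⟩ | h'
    · refine Row.mem_subst.2 (.inl ⟨e', CRow.mem_diff.2 ⟨he', fun h => ?_⟩, rfl⟩)
      exact h₁.fst_ne_of_mem_tail ht h he rfl
    · exact Row.mem_subst.2 (.inr h')
  · have := hs.2 μ (by rw [Row.subst_tail, ht]; exact hμ)
    rwa [Row.subst_tail] at this ⊢

theorem Row.Sub.mem_tail (hs : ((⟨K₁, t₁⟩ : Row ℕ).subst t).Sub ((⟨K₂, t₂⟩ : Row ℕ).subst t))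
    (hU : ∀ ℓ Y₁ Y₂, (ℓ, Y₁) ∈ K₁ → (ℓ, Y₂) ∈ K₂ → Y₁ = Y₂) {e : ℕ × Lin ℕ} (he : e ∈ K₁)
    (he' : e ∉ K₂) : ∃ μ₂, t₂ = some μ₂ ∧ (e.1, e.2.subst t) ∈ (t.row μ₂).labels := by
  rcases Row.mem_subst.1 (hs.1 _ (Row.mem_subst.2 (.inl ⟨e, he, rfl⟩))) with ⟨⟨ℓ, Y⟩, h, h'⟩ | h
  · obtain ⟨ℓ', Y'⟩ := e
    cases congrArg Prod.fst h'
    cases hU _ _ _ he h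
    exact absurd h he'
  · exact h

theorem Row.Sub.tail_ne (hs : ((⟨K₁, t₁⟩ : Row ℕ).subst t).Sub ((⟨K₂, t₂⟩ : Row ℕ).subst t))
    (h₁ : ((⟨K₁, t₁⟩ : Row ℕ).subst t).WF)
    (hU : ∀ ℓ Y₁ Y₂, (ℓ, Y₁) ∈ K₁ → (ℓ, Y₂) ∈ K₂ → Y₁ = Y₂)
    (hK : ¬ ∀ e ∈ K₁, e ∈ K₂) : ∃ μ₂, t₂ = some μ₂ ∧ t₁ ≠ t₂ := by
  push Not at hK
  obtain ⟨e, he, he'⟩ := hK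
  obtain ⟨μ₂, hμ₂, h⟩ := hs.mem_tail hU he he'
  exact ⟨μ₂, hμ₂, fun ht => h₁.fst_ne_of_mem_tail (ht.trans hμ₂) he h rfl⟩

section Split

/-- `t` with the value of `μ₂` split into the labels in `D` and the rest, which becomes the value
of `μ`. -/
def Subst.split (t : Subst ℕ ℕ) (μ₂ : ℕ) (D : CRow ℕ) (μ : ℕ) : Subst ℕ ℕ :=
  { t with
    row := Function.update t.row μ ⟨(t.row μ₂).labels - CRow.subst t D, (t.row μ₂).tail⟩ }

theorem Subst.split_row_self (t : Subst ℕ ℕ) (μ₂ : ℕ) (D : CRow ℕ) (μ : ℕ) :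
    (t.split μ₂ D μ).row μ = ⟨(t.row μ₂).labels - CRow.subst t D, (t.row μ₂).tail⟩ :=
  Function.update_self ..

theorem Subst.split_row_of_ne (t : Subst ℕ ℕ) (μ₂ : ℕ) (D : CRow ℕ) {μ ν : ℕ} (h : ν ≠ μ) :
    (t.split μ₂ D μ).row ν = t.row ν :=
  Function.update_of_ne h ..

theorem Row.subst_split (t : Subst ℕ ℕ) (μ₂ : ℕ) (D : CRow ℕ) (μ : ℕ) (K : CRow ℕ) :
    (⟨K, some μ⟩ : Row ℕ).subst (t.split μ₂ D μ) =
      ⟨CRow.subst t K + ((t.row μ₂).labels - CRow.subst t D), (t.row μ₂).tail⟩ := by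
  rw [Row.ext_iff, Row.subst_labels, Row.subst_tail,
    CRow.subst_congr_lin (s := t.split μ₂ D μ) (t := t) rfl]
  simp [Subst.split_row_self]

theorem Subst.WF.split (ht : t.WF) (μ₂ : ℕ) (D : CRow ℕ) (μ : ℕ) : (t.split μ₂ D μ).WF := by
  refine ⟨ht.1, fun ν => ?_⟩
  by_cases h : ν = μ
  · rw [h, Subst.split_row_self]
    exact CRow.nodup_map_fst_of_le tsub_le_self (ht.2 μ₂)
  · rw [Subst.split_row_of_ne _ _ _ h]
    exact ht.2 ν

theorem Subst.split_comp_agreeOn {N : Finset (Kind × ℕ)} {μ μ₂ : ℕ} {D : CRow ℕ}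
    (hμ : (Kind.row, μ) ∉ N) (hD : CRow.subst t D ≤ (t.row μ₂).labels) :
    ((t.split μ₂ D μ).comp (Subst.oneRow μ₂ ⟨D, some μ⟩)).AgreeOn N t := by
  refine ⟨fun _ _ => rfl, fun ν hν => ?_, fun _ _ => rfl⟩
  have hne : ν ≠ μ := by rintro rfl; exact hμ hν
  change Row.subst _ (Function.update Subst.id.row μ₂ _ _) = _
  by_cases h : ν = μ₂
  · rw [h, Function.update_self, Row.subst_split, add_tsub_cancel_of_le hD]
  · rw [Function.update_of_ne h]
    exact (Row.subst_var _ _).trans (Subst.split_row_of_ne _ _ _ hne)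

variable {μ₂ : ℕ}

theorem Row.Sub.subst_diff_le
    (hs : ((⟨K₁, t₁⟩ : Row ℕ).subst t).Sub ((⟨K₂, some μ₂⟩ : Row ℕ).subst t))
    (hK₁ : (K₁.map Prod.fst).Nodup) (hU : ∀ ℓ Y₁ Y₂, (ℓ, Y₁) ∈ K₁ → (ℓ, Y₂) ∈ K₂ → Y₁ = Y₂) :
    CRow.subst t (CRow.diff K₁ K₂) ≤ (t.row μ₂).labels := by
  have hnodup : ((CRow.subst t (CRow.diff K₁ K₂)).map Prod.fst).Nodup :=
    CRow.nodup_map_fst_subst.2 (CRow.nodup_map_fst_of_le (CRow.diff_le _ _) hK₁)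
  refine (Multiset.le_iff_subset (Multiset.Nodup.of_map _ hnodup)).2 fun _ hmem => ?_
  obtain ⟨e, he, rfl⟩ := CRow.mem_subst.1 hmem
  obtain ⟨_, ⟨⟩, h⟩ := hs.mem_tail hU (CRow.mem_diff.1 he).1 (CRow.mem_diff.1 he).2
  exact h

theorem Row.WF.split (h₂ : ((⟨K₂, some μ₂⟩ : Row ℕ).subst t).WF) (D : CRow ℕ) (μ : ℕ) :
    ((⟨CRow.diff K₂ K₁, some μ⟩ : Row ℕ).subst (t.split μ₂ D μ)).WF := by
  rw [Row.WF, Row.subst_labels] at h₂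
  rw [Row.subst_split]
  exact CRow.nodup_map_fst_of_le
    (add_le_add (CRow.subst_mono (CRow.diff_le _ _)) tsub_le_self) h₂

theorem Row.Sub.tail_sub_split
    (hs : ((⟨K₁, t₁⟩ : Row ℕ).subst t).Sub ((⟨K₂, some μ₂⟩ : Row ℕ).subst t))
    (h₁ : ((⟨K₁, t₁⟩ : Row ℕ).subst t).WF)
    (hD : CRow.subst t (CRow.diff K₁ K₂) ≤ (t.row μ₂).labels) {μ₁ : ℕ} (hμ₁ : t₁ = some μ₁)
    (μ : ℕ) :
    (t.row μ₁).Sub ((⟨CRow.diff K₂ K₁, some μ⟩ : Row ℕ).subst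
      (t.split μ₂ (CRow.diff K₁ K₂) μ)) := by
  have htail := hs.tail_sub h₁ hμ₁
  rw [Row.subst_split]
  refine ⟨fun e hmem => ?_, fun ν hν => by simpa [Row.subst_tail] using htail.2 ν hν⟩
  rcases Row.mem_subst.1 (htail.1 e hmem) with ⟨e', he', rfl⟩ | ⟨_, ⟨⟩, h⟩
  · exact Multiset.mem_add.2 (.inl (CRow.mem_subst.2 ⟨e', he', rfl⟩))
  · refine Multiset.mem_add.2 (.inr ?_)
    rw [← add_tsub_cancel_of_le hD] at h
    rcases Multiset.mem_add.1 h with h | h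
    · obtain ⟨e', he', rfl⟩ := CRow.mem_subst.1 h
      exact (h₁.fst_ne_of_mem_tail hμ₁ (CRow.mem_diff.1 he').1 hmem rfl).elim
    · exact h

end Split

variable {N : Finset (Kind × ℕ)} {μ : ℕ}

theorem exists_agreeOn_of_extend {θ : Subst ℕ ℕ} {μ₂ : ℕ} (hu : ULab K₁ K₂ (some θ)) (ht : t.WF)
    (hπ : ((Pred.sub ⟨K₁, t₁⟩ ⟨K₂, some μ₂⟩).subst t).WF)
    (he : Entails ∅ ((Pred.sub ⟨K₁, t₁⟩ ⟨K₂, some μ₂⟩).subst t))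
    (hN : (Pred.sub ⟨K₁, t₁⟩ ⟨K₂, some μ₂⟩).fv ⊆ N) (hμ : (Kind.row, μ) ∉ N) :
    ∃ t' : Subst ℕ ℕ, t'.WF ∧
      (t'.comp ((Subst.oneRow μ₂
        ⟨CRow.diff (CRow.subst θ K₁) (CRow.subst θ K₂), some μ⟩).comp θ)).AgreeOn N t ∧
      ∀ κ ∈ leftover t₁ ⟨CRow.diff (CRow.subst θ K₂) (CRow.subst θ K₁), some μ⟩,
        (κ.subst t').WF ∧ Entails ∅ (κ.subst t') := by
  rw [Pred.subst, entails_empty_sub] at he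
  have hU := hu.unifies_subst (Row.WF.of_subst hπ.1) (Row.WF.of_subst hπ.2)
  obtain ⟨_, ⟨⟩, hθ, h₁, h₂, hs⟩ := hu.exists_sub_subst hπ.1 hπ.2 he
  obtain ⟨hN₁, hN₂⟩ := Finset.union_subset_iff.1 hN
  rw [Row.fv_subset_iff] at hN₁ hN₂
  have hmaps : θ.MapsVars N N := hu.mapsVars hN₁.1 hN₂.1 _ rfl
  have hD := hs.subst_diff_le (Row.WF.of_subst h₁) hU
  refine ⟨t.split μ₂ (CRow.diff (CRow.subst θ K₁) (CRow.subst θ K₂)) μ, ht.split _ _ _, ?_,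
    fun κ hκ => ?_⟩
  · rw [← Subst.comp_assoc]
    have := (Subst.split_comp_agreeOn hμ hD).comp_right hmaps
    rwa [hθ] at this
  · obtain ⟨μ₁, hμ₁, rfl⟩ := mem_leftover.1 hκ
    have hne : μ₁ ≠ μ := by
      rintro rfl
      exact hμ (hN₁.2 _ hμ₁)
    rw [Pred.subst, entails_empty_sub, Row.subst_var, Subst.split_row_of_ne _ _ _ hne]
    exact ⟨⟨ht.2 μ₁, h₂.split _ _⟩, hs.tail_sub_split h₁ hD hμ₁ μ⟩

theorem Reduce.complete {π : Pred ℕ} {δ : Subst ℕ ℕ} {X : PSet} (h : Reduce μ π δ X)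
    (ht : t.WF) (hπ : (π.subst t).WF) (he : Entails ∅ (π.subst t)) (hN : π.fv ⊆ N)
    (hμ : (Kind.row, μ) ∉ N) :
    ∃ t' : Subst ℕ ℕ, t'.WF ∧ (t'.comp δ).AgreeOn N t ∧
      ∀ κ ∈ X, (κ.subst t').WF ∧ Entails ∅ (κ.subst t') := by
  cases h with
  | lin τ₁ τ₂ =>
    refine ⟨t, ht, by rw [Subst.comp_id]; exact .refl _, fun κ hκ => ?_⟩
    rw [Finset.mem_singleton.1 hκ]
    exact ⟨hπ, he⟩
  | lack_closed hK =>
    exact ⟨t, ht, by rw [Subst.comp_id]; exact .refl _, by simp⟩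
  | @lack_open K μ₁ L hK =>
    refine ⟨t, ht, by rw [Subst.comp_id]; exact .refl _, fun κ hκ => ?_⟩
    rw [Finset.mem_singleton.1 hκ]
    refine ⟨?_, (entails_lack_subst_iff.1 he).2 μ₁ rfl⟩
    rw [Pred.subst, Pred.WF, Row.subst_var]
    exact ht.2 μ₁
  | sub hu hK =>
    rw [Pred.subst, entails_empty_sub] at he
    obtain ⟨_, ⟨⟩, hδ, h₁, h₂, hs⟩ := hu.exists_sub_subst hπ.1 hπ.2 he
    refine ⟨t, ht, by rw [hδ]; exact .refl _, fun κ hκ => ?_⟩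
    split_ifs at hκ with htt
    · simp at hκ
    · obtain ⟨μ₁, hμ₁, rfl⟩ := mem_leftover.1 hκ
      rw [Pred.subst, entails_empty_sub, Row.subst_var]
      exact ⟨⟨ht.2 μ₁, h₂.diff⟩, hs.tail_sub h₁ hμ₁⟩
  | extend hu _ _ => exact exists_agreeOn_of_extend hu ht hπ he hN hμ

theorem RowStep.not_entails {θ : Subst ℕ ℕ} {P Q : PSet} {π : Pred ℕ}
    (h : RowStep θ P Q μ π none) (hπ : (π.subst t).WF) : ¬ Entails ∅ (π.subst t) := by
  intro he
  generalize hr : none = r at h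
  cases h with
  | lin τ₁ τ₂ => cases hr
  | lack_closed K L =>
    split_ifs at hr with hK
    exact hK (entails_lack_subst_iff.1 he).1
  | lack_open K μ₁ L =>
    split_ifs at hr with hK
    exact hK (entails_lack_subst_iff.1 he).1
  | sub hu =>
    rw [Pred.subst, entails_empty_sub] at he
    obtain ⟨δ, rfl, _, h₁, _, hs⟩ := hu.exists_sub_subst hπ.1 hπ.2 he
    have hU := hu.unifies_subst (Row.WF.of_subst hπ.1) (Row.WF.of_subst hπ.2)
    rw [Option.bind_some, subCase_eq] at hr
    split_ifs at hr with hK ht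
    · obtain ⟨_, _, h⟩ := hs.tail_ne h₁ hU hK
      exact h ht
    · obtain ⟨_, rfl, _⟩ := hs.tail_ne h₁ hU hK
      simp at hr

end Completeness

/-! ## Linearity predicates and their transitive closure -/

section LinearityPredicates

variable {t : Subst ℕ ℕ} {τ τ' : Typ ℕ}

/-- The predicates that hold when `∘` is below no linearity type but itself; an invariant of
entailment, used to show that `∘ ≼ •` is not entailed. -/
def Pred.AnyIsTop : Pred ℕ → Prop
  | .lin τ τ' => τ.strip = .lin .any →
    match τ' with
    | .lin Y => Y = .any
    | .val B => (Typ.val B).strip = .lin .any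
    | .row R => (∀ e ∈ R.labels, e.2 = .any) ∧ R.tail = none
  | _ => True

theorem Entails.anyIsTop {π : Pred ℕ} (h : Entails ∅ π) : π.AnyIsTop := by
  induction h with
  | subsume h => exact absurd h (Finset.notMem_empty _)
  | refl τ =>
    rcases τ with A | R | Y
    · exact id
    · exact nofun
    · exact Typ.lin.inj
  | lin τ => exact fun _ => rfl
  | unl τ => exact nofun
  | func _ ih => exact ih
  | func_inv _ ih => exact ih
  | @row τ R _ _ ih₁ ih₂ =>
    refine fun h => ⟨fun e he => ih₁ e he h, Option.eq_none_iff_forall_ne_some.2 fun μ hμ => ?_⟩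
    exact Option.some_ne_none μ (ih₂ μ hμ h).2
  | row_inv_label he _ ih => exact fun h => (ih h).1 _ he
  | row_inv_tail ht _ ih => exact fun h => absurd (ih h).2 (by simp [ht])
  | sub | lack => trivial

/-- The image of `τ` under `t` is above `∘`. -/
def Typ.AboveAny (t : Subst ℕ ℕ) (τ : Typ ℕ) : Prop :=
  Entails ∅ (.lin (.lin .any) (τ.subst t))

theorem Typ.AboveAny.any (t : Subst ℕ ℕ) : Typ.AboveAny t (.lin .any) := .lin _

theorem Typ.AboveAny.not_unl (t : Subst ℕ ℕ) : ¬ Typ.AboveAny t (.lin .unl) :=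
  fun h => nomatch h.anyIsTop rfl

theorem Typ.AboveAny.mono (h : Typ.AboveAny t τ) (hd : (Pred.lin τ τ').Directed)
    (he : Entails ∅ ((Pred.lin τ τ').subst t)) : Typ.AboveAny t τ' := by
  rw [← entails_strip_iff] at he
  have hany := h.anyIsTop rfl
  suffices hτ : τ.strip.subst t = .lin .any ∨
      ∃ A B R, τ.strip.subst t = .val (.arrow A .any B R) by
    rcases hτ with hτ | ⟨A, B, R, hτ⟩ <;> rw [Pred.subst, hτ] at he
    · exact he
    · exact he.func_inv
  rcases τ with (α | ⟨A, Y, B, R⟩) | R | Y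
  · simp only [Typ.subst, Ty.subst, Typ.strip] at hany ⊢
    rcases hα : t.ty α with _ | ⟨A, Y, B, R⟩ <;> rw [hα] at hany
    · exact nomatch hany
    · cases hany
      exact .inr ⟨A, B, R, rfl⟩
  · exact .inl hany
  · exact absurd rfl (hd.1 R)
  · exact .inl (congrArg Typ.lin hany)

theorem mem_factoriseSet_lin {P : PSet} (h : Pred.lin τ τ' ∈ factoriseSet P) :
    ∃ τ₁ τ₂, Pred.lin τ₁ τ₂ ∈ P ∧ Pred.lin τ τ' ∈ factLin τ₁ τ₂ := by
  obtain ⟨π, hπ, h⟩ := Finset.mem_biUnion.1 h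
  cases π with
  | lin τ₁ τ₂ => exact ⟨τ₁, τ₂, hπ, h⟩
  | sub R₁ R₂ => simp only [factorise] at h; split_ifs at h <;> simp at h
  | lack R L => simp only [factorise] at h; split_ifs at h <;> simp at h

end LinearityPredicates

section TransitiveClosure

variable {T : Finset (Typ ℕ × Typ ℕ)} {τ τ' : Typ ℕ}

theorem mem_closeStep {τ₁ τ₂ a b : Typ ℕ} : (a, b) ∈ closeStep T τ₁ τ₂ ↔
    (a, b) ∈ T ∨ (a = τ₁ ∨ (a, τ₁) ∈ T) ∧ (b = τ₂ ∨ (τ₂, b) ∈ T) := by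
  simp only [closeStep, Finset.mem_union, Finset.mem_product, Finset.mem_image,
    Finset.mem_filter, Finset.mem_insert, Finset.mem_singleton, Prod.exists, Prod.mk.injEq]
  grind

/-- The finite relation is transitive. -/
def TransRel (T : Finset (Typ ℕ × Typ ℕ)) : Prop :=
  ∀ a b c, (a, b) ∈ T → (b, c) ∈ T → (a, c) ∈ T

theorem TransRel.closeStep (h : TransRel T) (τ₁ τ₂ : Typ ℕ) :
    TransRel (closeStep T τ₁ τ₂) := by
  intro a b c hab hbc
  rw [mem_closeStep] at *
  rcases hab with hab | ⟨ha, hb⟩ <;> rcases hbc with hbc | ⟨hb', hc⟩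
  · exact .inl (h a b c hab hbc)
  · refine .inr ⟨.inr ?_, hc⟩
    rcases hb' with rfl | hb'
    · exact hab
    · exact h _ _ _ hab hb'
  · refine .inr ⟨ha, .inr ?_⟩
    rcases hb with rfl | hb
    · exact hbc
    · exact h _ _ _ hb hbc
  · exact .inr ⟨ha, hc⟩

/-- The canonical solution read off the closure `T`: linearity variables above `∘` become `∘`, the
other ones `•`, value types become unlimited functions, and rows become empty. -/
def canonicalSubst (T : Finset (Typ ℕ × Typ ℕ)) : Subst ℕ ℕ where
  ty _ := .arrow (.var 0) .unl (.var 0) ⟨0, none⟩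
  row _ := ⟨0, none⟩
  lin φ := if (Typ.lin .any, Typ.lin (.var φ)) ∈ T then .any else .unl

theorem entails_or_any_mem_of_mem (hT : TransRel T) (h : (τ, τ') ∈ T)
    (hd : (Pred.lin τ τ').Directed) (ha : (Pred.lin τ τ').Atomic) :
    (∀ b, Entails ∅ (.lin (τ.subst (canonicalSubst T)) b)) ∨
      τ.subst (canonicalSubst T) = .lin .any ∧ (Typ.lin Lin.any, τ') ∈ T := by
  rcases τ with (α | ⟨A, Y, B, R⟩) | R | (φ | _ | _)
  · exact .inl fun _ => .func (.unl _)
  · exact absurd rfl (ha.1 A Y B R)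
  · exact absurd rfl (hd.1 R)
  · by_cases hφ : (Typ.lin Lin.any, Typ.lin (Lin.var φ)) ∈ T
    · exact .inr ⟨congrArg Typ.lin (if_pos hφ), hT _ _ _ hφ h⟩
    · have hunl : Typ.subst (canonicalSubst T) (.lin (.var φ)) = .lin .unl :=
        congrArg Typ.lin (if_neg hφ)
      exact .inl fun b => hunl ▸ .unl b
  · exact .inl fun _ => .unl _
  · exact .inr ⟨rfl, h⟩

theorem entails_any_canonicalSubst (hT' : (Typ.lin Lin.any, Typ.lin Lin.unl) ∉ T)
    (h : (Typ.lin Lin.any, τ') ∈ T) (hd : (Pred.lin τ τ').Directed)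
    (ha : (Pred.lin τ τ').Atomic) :
    Entails ∅ (.lin (.lin .any) (τ'.subst (canonicalSubst T))) := by
  rcases τ' with A | R | (φ | _ | _)
  · exact absurd rfl (hd.2 A)
  · refine entails_row_subst_iff.2 ⟨fun e he => ?_, fun μ _ => .row nofun nofun⟩
    rw [ha.2 R rfl] at he
    exact absurd he (Multiset.notMem_zero e)
  · rw [show Typ.subst (canonicalSubst T) (.lin (.var φ)) = .lin .any from
      congrArg Typ.lin (if_pos h)]
    exact .refl _
  · exact absurd h hT'
  · exact .refl _

theorem entails_canonicalSubst (hT : TransRel T)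
    (hT' : (Typ.lin Lin.any, Typ.lin Lin.unl) ∉ T) (h : (τ, τ') ∈ T)
    (hd : (Pred.lin τ τ').Directed) (ha : (Pred.lin τ τ').Atomic) :
    Entails ∅ ((Pred.lin τ τ').subst (canonicalSubst T)) := by
  rw [Pred.subst]
  rcases entails_or_any_mem_of_mem hT h hd ha with hunl | ⟨hany, hmem⟩
  · exact hunl _
  · rw [hany]
    exact entails_any_canonicalSubst hT' hmem hd ha

end TransitiveClosure

/-! ## The invariant of the row solver -/

section Residual

variable {π κ : Pred ℕ}

/-- Predicates that the row solver counts as solved. -/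
def Pred.Solved : Pred ℕ → Prop
  | .lin _ _ => True
  | .sub R₁ _ => ∃ μ, R₁ = Row.var μ
  | .lack R _ => ∃ μ, R = Row.var μ

theorem Pred.Solved.subst {δ : Subst ℕ ℕ} (h : π.Solved) (hδ : δ.LinOnly) :
    (π.subst δ).Solved := by
  cases π with
  | lin τ₁ τ₂ => trivial
  | sub R₁ R₂ | lack R₁ L =>
    obtain ⟨ν, rfl⟩ := h
    exact ⟨ν, by rw [Row.subst_var, hδ.2]⟩

theorem Residual.solved (h : Residual π κ) : κ.Solved := by
  cases h with
  | lin => trivial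
  | lack | sub => exact ⟨_, rfl⟩

theorem Residual.directed (h : Residual π κ) (hπ : π.Directed) : κ.Directed := by
  cases h with
  | lin => exact hπ
  | lack | sub => trivial

theorem Row.fv_var_subset {R : Row ℕ} {μ : ℕ} (h : R.tail = some μ) : (Row.var μ).fv ⊆ R.fv :=
  Row.fv_subset_iff.2 ⟨by simp [Row.var], fun _ hν => (Row.fv_subset_iff.1 subset_rfl).2 _ <| by
    rw [h, ← hν]; rfl⟩

theorem Residual.fv_subset (h : Residual π κ) : κ.fv ⊆ π.fv := by
  cases h with
  | lin => exact subset_rfl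
  | lack L hR => exact Row.fv_var_subset hR
  | @sub R₁ R₂ R μ₁ hR₁ hR ht =>
    have hR₂ := Row.fv_subset_iff.1 (subset_refl R₂.fv)
    exact Finset.union_subset_union (Row.fv_var_subset hR₁)
      (Row.fv_subset_iff.2 ⟨fun e he => hR₂.1 e (hR e he), fun ν hν => hR₂.2 ν (ht ▸ hν)⟩)

end Residual

section Traced

/-- The labels on both sides of a row inclusion. -/
def Pred.subLabels : Pred ℕ → Finset ℕ
  | .sub R₁ R₂ => CRow.dom R₁.labels ∪ CRow.dom R₂.labels
  | _ => ∅

/-- The labels of the row inclusions in the set, which bound the labels that the row solver can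
add to row variables. -/
def PSet.subLabels (P : PSet) : Finset ℕ := P.biUnion Pred.subLabels

/-- The row variables of the set. -/
def PSet.rowVars (P : PSet) : Finset ℕ := (P.fv.filter (fun x => x.1 = Kind.row)).image Prod.snd

theorem PSet.mem_rowVars {P : PSet} {μ : ℕ} : μ ∈ P.rowVars ↔ (Kind.row, μ) ∈ P.fv := by
  simp [PSet.rowVars]

/-- The substitution puts only labels from `L` into rows. -/
def Subst.LabelsIn (δ : Subst ℕ ℕ) (L : Finset ℕ) : Prop :=
  ∀ μ, ∀ e ∈ (δ.row μ).labels, e.1 ∈ L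

/-- The labels of the row are labels of inclusions in `P₀`, and its row variable occurs in the
image of a row variable of `P₀` under `θ`. -/
def Row.Traced (P₀ : PSet) (θ : Subst ℕ ℕ) (R : Row ℕ) : Prop :=
  (∀ e ∈ R.labels, e.1 ∈ P₀.subLabels) ∧
    ∀ μ, R.tail = some μ → ∃ μ₀ ∈ P₀.rowVars, (θ.row μ₀).tail = some μ

/-- Both rows of the predicate are traced, if it is a row inclusion. -/
def Pred.Traced (P₀ : PSet) (θ : Subst ℕ ℕ) : Pred ℕ → Prop
  | .sub R₁ R₂ => R₁.Traced P₀ θ ∧ R₂.Traced P₀ θ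
  | _ => True

variable {P₀ : PSet} {θ δ : Subst ℕ ℕ} {L : Finset ℕ}

theorem Subst.LinOnly.labelsIn (h : δ.LinOnly) : δ.LabelsIn L := by
  intro μ e he
  simp [h.2, Row.var] at he

theorem Subst.LabelsIn.comp (hδ : δ.LabelsIn L) (hθ : θ.LabelsIn L) : (δ.comp θ).LabelsIn L := by
  intro μ e he
  rcases Row.mem_subst.1 he with ⟨e', he', rfl⟩ | ⟨ν, _, he⟩
  · exact hθ μ e' he'
  · exact hδ ν e he

theorem Row.Traced.subst {R : Row ℕ} (h : R.Traced P₀ θ) (hδ : δ.LabelsIn P₀.subLabels) :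
    (R.subst δ).Traced P₀ (δ.comp θ) := by
  refine ⟨fun e he => ?_, fun μ hμ => ?_⟩
  · rcases Row.mem_subst.1 he with ⟨e', he', rfl⟩ | ⟨μ, _, he⟩
    · exact h.1 e' he'
    · exact hδ μ e he
  · rw [Row.subst_tail, Option.bind_eq_some_iff] at hμ
    obtain ⟨ν, hν, hμ⟩ := hμ
    obtain ⟨μ₀, h₀, h₁⟩ := h.2 ν hν
    exact ⟨μ₀, h₀, by simp [Subst.comp, Row.subst_tail, h₁, hμ]⟩

theorem Pred.Traced.subst {π : Pred ℕ} (h : π.Traced P₀ θ) (hδ : δ.LabelsIn P₀.subLabels) :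
    (π.subst δ).Traced P₀ (δ.comp θ) := by
  cases π with
  | lin | lack => trivial
  | sub => exact ⟨h.1.subst hδ, h.2.subst hδ⟩

theorem Residual.traced {π κ : Pred ℕ} (h : Residual π κ) (hπ : π.Traced P₀ θ) :
    κ.Traced P₀ θ := by
  cases h with
  | lin | lack => trivial
  | sub hR₁ hR ht =>
    refine ⟨⟨by simp [Row.var], ?_⟩, fun e he => hπ.2.1 e (hR e he), ht ▸ hπ.2.2⟩
    rintro _ ⟨⟩
    exact hπ.1.2 _ hR₁

theorem Reduce.labelsIn {μ : ℕ} {π : Pred ℕ} {X : PSet} (h : Reduce μ π δ X)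
    (hπ : π.Traced P₀ θ) : δ.LabelsIn P₀.subLabels := by
  cases h with
  | lin | lack_closed | lack_open => exact Subst.LinOnly.id.labelsIn
  | sub hu _ => exact (hu.linOnly _ rfl).labelsIn
  | @extend K₁ K₂ t₁ μ₂ θ' hu _ _ =>
    intro ν e he
    rw [Subst.oneRow_comp_row (hu.linOnly _ rfl)] at he
    by_cases h : ν = μ₂
    · subst h
      rw [Function.update_self] at he
      obtain ⟨e', he', rfl⟩ := CRow.mem_subst.1 (CRow.mem_diff.1 he).1
      exact hπ.1.1 e' he'
    · rw [Function.update_of_ne h] at he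
      exact Subst.LinOnly.id.labelsIn ν e he

theorem Pred.traced_id_of_mem {π : Pred ℕ} (hπ : π ∈ P₀) : π.Traced P₀ Subst.id := by
  cases π with
  | lin | lack => trivial
  | sub R₁ R₂ =>
    have hl : CRow.dom R₁.labels ∪ CRow.dom R₂.labels ⊆ P₀.subLabels :=
      Finset.subset_biUnion_of_mem Pred.subLabels hπ
    have hv : R₁.fv ∪ R₂.fv ⊆ P₀.fv := Finset.subset_biUnion_of_mem Pred.fv hπ
    have traced {R : Row ℕ} (hl : CRow.dom R.labels ⊆ P₀.subLabels) (hv : R.fv ⊆ P₀.fv) :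
        R.Traced P₀ Subst.id :=
      ⟨fun e he => hl (CRow.mem_dom.2 ⟨e.2, he⟩), fun μ hμ =>
        ⟨μ, PSet.mem_rowVars.2 ((Row.fv_subset_iff.1 hv).2 μ hμ), rfl⟩⟩
    exact ⟨traced (Finset.union_subset_left hl) (Finset.union_subset_left hv),
      traced (Finset.union_subset_right hl) (Finset.union_subset_right hv)⟩

end Traced

section Invariant

theorem Reduce.mapsVars {μ : ℕ} {π : Pred ℕ} {δ : Subst ℕ ℕ} {X : PSet}
    {N : Finset (Kind × ℕ)} (h : Reduce μ π δ X) (hN : π.fv ⊆ N) :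
    δ.MapsVars N (insert (Kind.row, μ) N) := by
  have hsub := Finset.subset_insert (Kind.row, μ) N
  cases h with
  | lin | lack_closed | lack_open => exact .id hsub
  | sub hu _ =>
    have hfv := Finset.union_subset_iff.1 hN
    have := (Subst.MapsVars.id hsub).comp
      (hu.mapsVars (Row.fv_subset_iff.1 hfv.1).1 (Row.fv_subset_iff.1 hfv.2).1 _ rfl)
    rwa [Subst.id_comp] at this
  | extend hu _ _ =>
    have hfv := Finset.union_subset_iff.1 hN
    have hK₁ := (Row.fv_subset_iff.1 hfv.1).1
    have hm := hu.mapsVars hK₁ (Row.fv_subset_iff.1 hfv.2).1 _ rfl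
    refine (Subst.MapsVars.oneRow hsub (Row.fv_subset_iff.2 ⟨fun e he => ?_, by simp⟩)).comp hm
    exact (CRow.fv_subst hm hK₁ e (CRow.mem_diff.1 he).1).trans hsub

/-- The substitution `t` solves all predicates of the set. -/
def Solves (t : Subst ℕ ℕ) (P : PSet) : Prop := ∀ π ∈ P, Entails ∅ (π.subst t)

theorem mem_Sat {s : Subst ℕ ℕ} {P : PSet} :
    s ∈ Sat P ↔ s.WF ∧ ∀ π ∈ P, (π.subst s).WF ∧ Entails ∅ (π.subst s) := by
  simp only [Sat, Subst.WFFor, PSet.WF, EntailsSet, Set.mem_ofPred_eq, and_assoc,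
    PSet.mem_subst, forall_exists_index, and_imp, forall_apply_eq_imp_iff₂, forall_and]

theorem solves_subst {t θ : Subst ℕ ℕ} {P : PSet} :
    Solves t (PSet.subst θ P) ↔ Solves (t.comp θ) P := by
  simp only [Solves, PSet.mem_subst, forall_exists_index, and_imp, forall_apply_eq_imp_iff₂,
    Pred.subst_comp]

/-- The invariant of the row solver on `P₀`, where the variables in `N₀` are in use initially and
those in `N` are in use now. -/
structure RunInv (P₀ : PSet) (N₀ N : Finset (Kind × ℕ)) (θ : Subst ℕ ℕ) (P Q : PSet) : Prop where
  fv_subset : ∀ π ∈ P ∪ Q, π.fv ⊆ N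
  mapsVars : θ.MapsVars N₀ N
  directed : PSet.Directed (P ∪ Q)
  solved : ∀ π ∈ P, π.Solved
  traced : ∀ π ∈ P ∪ Q, π.Traced P₀ θ
  labelsIn : θ.LabelsIn P₀.subLabels
  wf : (PSet.subst θ P₀).WF
  sound : ∀ t, Solves t (P ∪ Q) → Solves t (PSet.subst θ P₀)
  complete : ∀ s ∈ Sat P₀, ∃ t, (t.comp θ).AgreeOn N₀ s ∧ t ∈ Sat (P ∪ Q)

variable {P₀ P P₁ Q Q₁ X : PSet} {N₀ N : Finset (Kind × ℕ)} {θ θ₁ δ : Subst ℕ ℕ} {μ : ℕ}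
  {π : Pred ℕ}

theorem RunInv.init (hd : P₀.Directed) (hwf : P₀.WF) (hN : P₀.fv ⊆ N₀) :
    RunInv P₀ N₀ N₀ Subst.id ∅ P₀ where
  fv_subset π hπ := (Finset.subset_biUnion_of_mem Pred.fv (by simpa using hπ)).trans hN
  mapsVars := .id subset_rfl
  directed := by simpa using hd
  solved := by simp
  traced π hπ := Pred.traced_id_of_mem (by simpa using hπ)
  labelsIn := Subst.LinOnly.id.labelsIn
  wf := by rwa [PSet.subst_id]
  sound t ht := by rw [PSet.subst_id]; simpa using ht
  complete s hs := ⟨s, by rw [Subst.comp_id]; exact .refl _, by simpa using hs⟩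

theorem Update.forall {p : Pred ℕ → Prop} (h : Update π δ X P (Q.erase π) P₁ Q₁)
    (hX : ∀ κ ∈ X, p κ) (hPQ : ∀ κ ∈ P ∪ Q, p (κ.subst δ)) : ∀ κ ∈ P₁ ∪ Q₁, p κ := by
  intro κ hκ
  rw [h.union_eq] at hκ
  rcases Finset.mem_union.1 hκ with hκ | hκ
  · exact hX κ hκ
  · obtain ⟨κ, hmem, rfl⟩ := PSet.mem_subst.1 hκ
    exact hPQ κ (Finset.union_subset_union_right (Finset.erase_subset π Q) hmem)

theorem Update.solved (h : Update π δ X P Q P₁ Q₁) (hX : ∀ κ ∈ X, κ.Solved)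
    (hP : ∀ κ ∈ P, κ.Solved) : ∀ κ ∈ P₁, κ.Solved := by
  intro κ hκ
  cases h with
  | keep hδ =>
    rcases Finset.mem_union.1 hκ with hκ | hκ
    · exact hX κ hκ
    · obtain ⟨κ, hmem, rfl⟩ := PSet.mem_subst.1 hκ
      exact (hP κ hmem).subst hδ
  | reset => exact hX κ hκ

theorem Update.solves {t : Subst ℕ ℕ} (h : Update π δ X P (Q.erase π) P₁ Q₁)
    (hred : Reduce μ π δ X) (ht : Solves t (P₁ ∪ Q₁)) : Solves (t.comp δ) (P ∪ Q) := by
  rw [h.union_eq] at ht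
  intro κ hκ
  rw [← Pred.subst_comp]
  by_cases hκπ : κ = π
  · subst hκπ
    exact hred.sound fun κ' hκ' => ht κ' (Finset.mem_union_left _ hκ')
  · refine ht _ (Finset.mem_union_right _ (PSet.mem_subst.2 ⟨κ, ?_, rfl⟩))
    exact (Finset.mem_union.1 hκ).elim (Finset.mem_union_left _)
      fun hκ => Finset.mem_union_right _ (Finset.mem_erase.2 ⟨hκπ, hκ⟩)

theorem RunInv.complete_step (h : RunInv P₀ N₀ N θ P Q) (hπ : π ∈ Q) (hμ : (Kind.row, μ) ∉ N)
    (hr : RowStep θ P (Q.erase π) μ π (some (θ₁, P₁, Q₁))) {s : Subst ℕ ℕ} (hs : s ∈ Sat P₀) :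
    ∃ t, (t.comp θ₁).AgreeOn N₀ s ∧ t ∈ Sat (P₁ ∪ Q₁) := by
  obtain ⟨δ, X, hred, rfl, hupd⟩ := hr.reduce
  obtain ⟨t, hts, ht⟩ := h.complete s hs
  rw [mem_Sat] at ht
  have hπ' : π ∈ P ∪ Q := Finset.mem_union_right _ hπ
  obtain ⟨t', ht', ha, hX⟩ := hred.complete ht.1 (ht.2 π hπ').1 (ht.2 π hπ').2
    (h.fv_subset π hπ') hμ
  refine ⟨t', ?_, mem_Sat.2 ⟨ht', hupd.forall hX fun κ hκ => ?_⟩⟩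
  · rw [← Subst.comp_assoc]
    exact (ha.comp_right h.mapsVars).trans hts
  · rw [Pred.subst_comp, Pred.subst_congr ha (h.fv_subset κ hκ)]
    exact ht.2 κ hκ

theorem RunInv.step (h : RunInv P₀ N₀ N θ P Q) (hπ : π ∈ Q) (hμ : (Kind.row, μ) ∉ N)
    (hr : RowStep θ P (Q.erase π) μ π (some (θ₁, P₁, Q₁))) (hwf : (PSet.subst θ₁ P₀).WF) :
    RunInv P₀ N₀ (insert (Kind.row, μ) N) θ₁ P₁ Q₁ := by
  have hcomplete := fun s => h.complete_step hπ hμ hr (s := s)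
  obtain ⟨δ, X, hred, rfl, hupd⟩ := hr.reduce
  have hπ' : π ∈ P ∪ Q := Finset.mem_union_right _ hπ
  have hmaps := hred.mapsVars (h.fv_subset π hπ')
  have hlabels := hred.labelsIn (h.traced π hπ')
  exact {
    fv_subset := hupd.forall
      (fun κ hκ => (hred.residual hκ).fv_subset.trans (Pred.fv_subst hmaps (h.fv_subset π hπ')))
      fun κ hκ => Pred.fv_subst hmaps (h.fv_subset κ hκ)
    mapsVars := hmaps.comp h.mapsVars
    directed := hupd.forall
      (fun κ hκ => (hred.residual hκ).directed ((h.directed π hπ').subst δ))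
      fun κ hκ => (h.directed κ hκ).subst δ
    solved := hupd.solved (fun κ hκ => (hred.residual hκ).solved) h.solved
    traced := hupd.forall
      (fun κ hκ => (hred.residual hκ).traced ((h.traced π hπ').subst hlabels))
      fun κ hκ => (h.traced κ hκ).subst hlabels
    labelsIn := hlabels.comp h.labelsIn
    wf := hwf
    sound := fun t ht => by
      rw [solves_subst, ← Subst.comp_assoc, ← solves_subst]
      exact h.sound _ (hupd.solves hred ht)
    complete := hcomplete }

theorem RunInv.not_satisfiable_of_none (h : RunInv P₀ N₀ N θ P Q) (hπ : π ∈ Q)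
    (hr : RowStep θ P (Q.erase π) μ π none) : ¬ Satisfiable P₀ := by
  rintro ⟨s, hs⟩
  obtain ⟨t, _, ht⟩ := h.complete s hs
  have ⟨hwf, he⟩ := (mem_Sat.1 ht).2 π (Finset.mem_union_right _ hπ)
  exact hr.not_entails hwf he

theorem RunInv.wf_of_satisfiable (h : RunInv P₀ N₀ N θ P Q) (hN₀ : P₀.fv ⊆ N₀) (hπ : π ∈ Q)
    (hμ : (Kind.row, μ) ∉ N) (hr : RowStep θ P (Q.erase π) μ π (some (θ₁, P₁, Q₁)))
    (hsat : Satisfiable P₀) : (PSet.subst θ₁ P₀).WF := by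
  obtain ⟨s, hs⟩ := hsat
  obtain ⟨t, ht, _⟩ := h.complete_step hπ hμ hr hs
  refine PSet.WF.of_subst_comp (t := t) ?_
  rw [PSet.subst_congr ht hN₀]
  exact hs.1.2

end Invariant

/-! ## Correctness -/

section Closure

variable {Q W : PSet} {T : Finset (Typ ℕ × Typ ℕ)}

/-- The invariant of the closure phase for the solved set `Q`, where `T` is the relation closed so
far and `W` is the set of predicates still to be added. -/
structure CloseInv (Q : PSet) (T : Finset (Typ ℕ × Typ ℕ)) (W : PSet) : Prop where
  cover : ∀ τ τ', Pred.lin τ τ' ∈ factoriseSet Q → Pred.lin τ τ' ∈ W ∨ (τ, τ') ∈ T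
  subset : W ⊆ factoriseSet Q
  trans : TransRel T
  aboveAny : ∀ t, Solves t Q → ∀ τ τ', (τ, τ') ∈ T → τ.AboveAny t → τ'.AboveAny t

theorem CloseInv.init (Q : PSet) : CloseInv Q ∅ (factoriseSet Q) where
  cover _ _ := .inl
  subset := subset_rfl
  trans _ _ _ h := by simp at h
  aboveAny _ _ _ _ h := by simp at h

theorem CloseInv.erase (h : CloseInv Q T W) {π : Pred ℕ} (hπ : ∀ τ τ', π ≠ .lin τ τ') :
    CloseInv Q T (W.erase π) where
  cover τ τ' hτ := (h.cover τ τ' hτ).imp_left fun h' => Finset.mem_erase.2 ⟨(hπ τ τ').symm, h'⟩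
  subset := (Finset.erase_subset _ _).trans h.subset
  trans := h.trans
  aboveAny := h.aboveAny

theorem Solves.entails_of_mem_factoriseSet {t : Subst ℕ ℕ} (ht : Solves t Q) {τ τ' : Typ ℕ}
    (h : Pred.lin τ τ' ∈ factoriseSet Q) : Entails ∅ ((Pred.lin τ τ').subst t) := by
  obtain ⟨τ₁, τ₂, h₁, h₂⟩ := mem_factoriseSet_lin h
  exact entails_factLin_iff.2 (ht _ h₁) _ h₂

theorem CloseInv.step (h : CloseInv Q T W) (hQ : Q.Directed) {τ₁ τ₂ : Typ ℕ}
    (hτ : Pred.lin τ₁ τ₂ ∈ W) : CloseInv Q (closeStep T τ₁ τ₂) (W.erase (.lin τ₁ τ₂)) where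
  cover τ τ' hmem := by
    by_cases heq : Pred.lin τ τ' = .lin τ₁ τ₂
    · cases heq
      exact .inr (mem_closeStep.2 (.inr ⟨.inl rfl, .inl rfl⟩))
    · exact (h.cover τ τ' hmem).imp (fun h' => Finset.mem_erase.2 ⟨heq, h'⟩)
        fun h' => mem_closeStep.2 (.inl h')
  subset := (Finset.erase_subset _ _).trans h.subset
  trans := h.trans.closeStep _ _
  aboveAny t ht τ τ' hmem hτany := by
    rcases mem_closeStep.1 hmem with hmem | ⟨h₁, h₂⟩
    · exact h.aboveAny t ht τ τ' hmem hτany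
    · have hany₁ : τ₁.AboveAny t := by
        rcases h₁ with rfl | h₁
        · exact hτany
        · exact h.aboveAny t ht _ _ h₁ hτany
      have hany₂ : τ₂.AboveAny t := hany₁.mono (hQ.factoriseSet _ (h.subset hτ))
        (ht.entails_of_mem_factoriseSet (h.subset hτ))
      rcases h₂ with rfl | h₂
      · exact hany₂
      · exact h.aboveAny t ht _ _ h₂ hany₂

theorem canonicalSubst_wf (T : Finset (Typ ℕ × Typ ℕ)) : (canonicalSubst T).WF :=
  ⟨fun _ => ⟨trivial, trivial, by simp [Row.WF]⟩, fun _ => by simp [canonicalSubst, Row.WF]⟩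

theorem CloseInv.solves_canonicalSubst (h : CloseInv Q T ∅) (hQ : Q.Directed)
    (hs : ∀ π ∈ Q, π.Solved) (hT : (Typ.lin Lin.any, Typ.lin Lin.unl) ∉ T) :
    Solves (canonicalSubst T) Q := by
  intro π hπ
  cases π with
  | lin τ τ' =>
    refine entails_factLin_iff.1 fun κ hκ => ?_
    have hmem : κ ∈ factoriseSet Q := Finset.mem_biUnion.2 ⟨_, hπ, hκ⟩
    have hd := directed_of_mem_factLin (hQ _ hπ) hκ
    have ha := atomic_of_mem_factLin hκ
    obtain ⟨-, -, b, -, -, rfl⟩ := mem_factLin.1 hκ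
    exact entails_canonicalSubst h.trans hT ((h.cover _ _ hmem).resolve_left (by simp)) hd ha
  | sub R₁ R₂ =>
    obtain ⟨μ, rfl⟩ := hs _ hπ
    rw [Pred.subst, entails_empty_sub, Row.subst_var]
    exact ⟨by simp [canonicalSubst], by simp [canonicalSubst]⟩
  | lack R L =>
    obtain ⟨μ, rfl⟩ := hs _ hπ
    rw [Pred.subst, entails_empty_lack, Row.subst_var]
    simp [canonicalSubst, CRow.dom]

end Closure

section Correctness

variable {P₀ Q : PSet} {N₀ N : Finset (Kind × ℕ)} {θ t : Subst ℕ ℕ}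

theorem Subst.WFOn.exists_wf (h : t.WFOn N) : ∃ s : Subst ℕ ℕ, s.WF ∧ s.AgreeOn N t := by
  refine ⟨{
    ty := fun α => if (Kind.ty, α) ∈ N then t.ty α else .var α
    row := fun μ => if (Kind.row, μ) ∈ N then t.row μ else Row.var μ
    lin := t.lin }, ⟨fun α => ?_, fun μ => ?_⟩, ?_⟩
  · by_cases hα : (Kind.ty, α) ∈ N
    · simpa [hα] using h.1 α hα
    · simp [hα, Ty.WF]
  · by_cases hμ : (Kind.row, μ) ∈ N
    · simpa [hμ] using h.2 μ hμ
    · simp [hμ, Row.WF, Row.var]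
  · exact ⟨fun α hα => by simp [hα], fun μ hμ => by simp [hμ], fun _ _ => rfl⟩

theorem RunInv.satisfiable (h : RunInv P₀ N₀ N θ Q ∅) (ht : t.WF) (htQ : Solves t Q)
    (hrow : ∀ μ, (t.row μ).labels = 0) : Satisfiable P₀ := by
  have hwf : ∀ π ∈ P₀, (π.subst (t.comp θ)).WF := fun π hπ => by
    rw [← Pred.subst_comp]
    exact (PSet.wf_subst.1 h.wf π hπ).subst_of_labels_eq_zero hrow ht.1
  have hsol : Solves (t.comp θ) P₀ := solves_subst.1 (h.sound t (by simpa using htQ))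
  -- `θ` need not be well-formed on variables that do not occur in `P₀`.
  obtain ⟨s, hs, hst⟩ := (PSet.WF.wfOn (PSet.wf_subst.2 hwf)).exists_wf
  refine ⟨s, mem_Sat.2 ⟨hs, fun π hπ => ?_⟩⟩
  rw [Pred.subst_congr hst (Finset.subset_biUnion_of_mem Pred.fv hπ)]
  exact ⟨hwf π hπ, hsol π hπ⟩

theorem RunInv.sat_eq (h : RunInv P₀ N₀ N θ Q ∅) (hN₀ : P₀.fv ⊆ N₀) :
    Sat P₀ = composeSet N₀ P₀ (Sat Q) θ := by
  ext s
  constructor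
  · intro hs
    obtain ⟨t, hts, ht⟩ := h.complete s hs
    rw [Finset.union_empty] at ht
    exact ⟨hs.1, t, ht, hts.symm⟩
  · rintro ⟨hs, t, ht, hst⟩
    have hsol := solves_subst.1 <| h.sound t <| by
      rw [Finset.union_empty]
      exact fun κ hκ => ((mem_Sat.1 ht).2 κ hκ).2
    refine ⟨hs, fun π hπ => ?_⟩
    obtain ⟨κ, hκ, rfl⟩ := PSet.mem_subst.1 hπ
    rw [Pred.subst_congr hst ((Finset.subset_biUnion_of_mem Pred.fv hκ).trans hN₀)]
    exact hsol κ hκ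

theorem RunInv.not_satisfiable_of_mem {T : Finset (Typ ℕ × Typ ℕ)} {W : PSet}
    (h : RunInv P₀ N₀ N θ Q ∅) (hcl : CloseInv Q T W)
    (hT : (Typ.lin Lin.any, Typ.lin Lin.unl) ∈ T) : ¬ Satisfiable P₀ := by
  rintro ⟨s, hs⟩
  obtain ⟨t, _, ht⟩ := h.complete s hs
  rw [Finset.union_empty] at ht
  exact Typ.AboveAny.not_unl t
    (hcl.aboveAny t (fun κ hκ => ((mem_Sat.1 ht).2 κ hκ).2) _ _ hT (.any t))

/-- The invariant of the solver, which in a final configuration states its correctness. -/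
def Config.Inv (P₀ : PSet) (N₀ : Finset (Kind × ℕ)) : Config → Prop
  | .run N θ P Q => RunInv P₀ N₀ N θ P Q
  | .close θ Q T W => (∃ N, RunInv P₀ N₀ N θ Q ∅) ∧ CloseInv Q T W
  | .done θ Q => Satisfiable P₀ ∧ Sat P₀ = composeSet N₀ P₀ (Sat Q) θ
  | .fail => ¬ Satisfiable P₀

theorem Step.inv (hN₀ : P₀.fv ⊆ N₀) {c c' : Config} (h : Step P₀ c c') (hc : c.Inv P₀ N₀) :
    c'.Inv P₀ N₀ := by
  cases h with
  | row hπ hμ hr hwf => exact RunInv.step hc hπ hμ hr hwf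
  | row_fail hπ hμ hr => exact RunInv.not_satisfiable_of_none hc hπ hr
  | row_dup hπ hμ hr hwf => exact fun hsat => hwf (RunInv.wf_of_satisfiable hc hN₀ hπ hμ hr hsat)
  | row_done => exact ⟨⟨_, hc⟩, CloseInv.init _⟩
  | close_lin hτ =>
    obtain ⟨⟨N, hrun⟩, hcl⟩ := hc
    exact ⟨⟨N, hrun⟩, hcl.step (by simpa using hrun.directed) hτ⟩
  | close_sub | close_lack => exact ⟨hc.1, hc.2.erase (by simp)⟩
  | accept hT =>
    obtain ⟨⟨N, hrun⟩, hcl⟩ := hc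
    have hsol := hcl.solves_canonicalSubst (by simpa using hrun.directed) hrun.solved hT
    exact ⟨hrun.satisfiable (canonicalSubst_wf _) hsol fun _ => rfl, hrun.sat_eq hN₀⟩
  | reject hT =>
    obtain ⟨⟨N, hrun⟩, hcl⟩ := hc
    exact hrun.not_satisfiable_of_mem hcl hT

theorem inv_of_reachable (hd : P₀.Directed) (hwf : P₀.WF) (hN₀ : P₀.fv ⊆ N₀) {c : Config}
    (h : Relation.ReflTransGen (Step P₀) (solveInit N₀ P₀) c) : c.Inv P₀ N₀ := by
  induction h with
  | refl => exact RunInv.init hd hwf hN₀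
  | tail _ hstep ih => exact hstep.inv hN₀ ih

end Correctness

/-! ## Termination -/

section Progress

theorem exists_fresh_row (N : Finset (Kind × ℕ)) : ∃ μ, (Kind.row, μ) ∉ N := by
  obtain ⟨μ, hμ⟩ := Infinite.exists_notMem_finset (N.image Prod.snd)
  exact ⟨μ, fun h => hμ (Finset.mem_image_of_mem Prod.snd h)⟩

theorem Step.exists_or_final (P₀ : PSet) (c : Config) :
    (∃ c', Step P₀ c c') ∨ c = .fail ∨ ∃ θ Q, c = .done θ Q := by
  cases c with
  | run N θ P Q =>
    left
    rcases Q.eq_empty_or_nonempty with rfl | ⟨π, hπ⟩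
    · exact ⟨_, .row_done⟩
    · obtain ⟨μ, hμ⟩ := exists_fresh_row N
      obtain ⟨_ | ⟨θ', P', Q'⟩, hr⟩ := RowStep.exists_result θ P (Q.erase π) μ π
      · exact ⟨_, .row_fail hπ hμ hr⟩
      · by_cases hwf : (PSet.subst θ' P₀).WF
        · exact ⟨_, .row hπ hμ hr hwf⟩
        · exact ⟨_, .row_dup hπ hμ hr hwf⟩
  | close θ Q T W =>
    left
    rcases W.eq_empty_or_nonempty with rfl | ⟨π, hπ⟩
    · by_cases hT : (Typ.lin Lin.any, Typ.lin Lin.unl) ∈ T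
      · exact ⟨_, .reject hT⟩
      · exact ⟨_, .accept hT⟩
    · cases π with
      | lin τ₁ τ₂ => exact ⟨_, .close_lin hπ⟩
      | sub R₁ R₂ => exact ⟨_, .close_sub hπ⟩
      | lack R L => exact ⟨_, .close_lack hπ⟩
  | done θ Q => exact .inr (.inr ⟨θ, Q, rfl⟩)
  | fail => exact .inr (.inl rfl)

end Progress

section LabelCount

variable {P₀ : PSet} {θ δ : Subst ℕ ℕ}

/-- The number of labels in the images of the row variables of `P₀`, which grows whenever the row
solver adds labels to a row variable. -/
def labelCount (P₀ : PSet) (θ : Subst ℕ ℕ) : ℕ :=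
  ∑ μ ∈ P₀.rowVars, (θ.row μ).labels.card

theorem Row.card_labels_le {R : Row ℕ} (h : R.WF) {L : Finset ℕ}
    (hL : ∀ e ∈ R.labels, e.1 ∈ L) : R.labels.card ≤ L.card := by
  rw [← Multiset.card_map Prod.fst, ← Multiset.toFinset_card_of_nodup h]
  refine Finset.card_le_card fun ℓ hℓ => ?_
  obtain ⟨e, he, rfl⟩ := Multiset.mem_map.1 (Multiset.mem_toFinset.1 hℓ)
  exact hL e he

theorem labelCount_le (hwf : (PSet.subst θ P₀).WF) (hθ : θ.LabelsIn P₀.subLabels) :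
    labelCount P₀ θ ≤ P₀.rowVars.card * P₀.subLabels.card :=
  Finset.sum_le_card_nsmul _ _ _ fun μ hμ =>
    Row.card_labels_le (hwf.wfOn.2 μ (PSet.mem_rowVars.1 hμ)) (hθ μ)

theorem Subst.card_labels_comp_row (δ θ : Subst ℕ ℕ) (μ : ℕ) :
    ((δ.comp θ).row μ).labels.card =
      (θ.row μ).labels.card + (θ.row μ).tail.elim 0 fun ν => (δ.row ν).labels.card := by
  change ((θ.row μ).subst δ).labels.card = _
  rw [Row.subst_labels]
  cases (θ.row μ).tail <;> simp [CRow.subst]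

theorem labelCount_mono (P₀ : PSet) (δ θ : Subst ℕ ℕ) :
    labelCount P₀ θ ≤ labelCount P₀ (δ.comp θ) :=
  Finset.sum_le_sum fun μ _ => (Subst.card_labels_comp_row δ θ μ).symm ▸ Nat.le_add_right _ _

theorem labelCount_lt {μ₀ μ₂ : ℕ} (hμ₀ : μ₀ ∈ P₀.rowVars) (ht : (θ.row μ₀).tail = some μ₂)
    (hδ : 0 < (δ.row μ₂).labels.card) : labelCount P₀ θ < labelCount P₀ (δ.comp θ) := by
  refine Finset.sum_lt_sum
    (fun μ _ => (Subst.card_labels_comp_row δ θ μ).symm ▸ Nat.le_add_right _ _) ⟨μ₀, hμ₀, ?_⟩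
  rw [Subst.card_labels_comp_row, ht]
  exact Nat.lt_add_of_pos_right hδ

end LabelCount

section Accessibility

variable {P₀ P Q X P₁ Q₁ : PSet} {N₀ N : Finset (Kind × ℕ)} {θ δ : Subst ℕ ℕ} {π : Pred ℕ}

theorem acc_fail (P₀ : PSet) : Acc (fun c' c => Step P₀ c c') .fail :=
  ⟨_, fun _ h => nomatch h⟩

theorem acc_done (P₀ : PSet) (θ : Subst ℕ ℕ) (Q : PSet) :
    Acc (fun c' c => Step P₀ c c') (.done θ Q) :=
  ⟨_, fun _ h => nomatch h⟩

theorem acc_close (P₀ : PSet) (θ : Subst ℕ ℕ) (Q : PSet) (T : Finset (Typ ℕ × Typ ℕ))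
    (W : PSet) : Acc (fun c' c => Step P₀ c c') (.close θ Q T W) := by
  induction hn : W.card using Nat.strong_induction_on generalizing T W with
  | _ n ih =>
    subst hn
    refine ⟨_, fun c' h => ?_⟩
    cases h with
    | close_lin h | close_sub h | close_lack h =>
      exact ih _ (Finset.card_erase_lt_of_mem h) _ _ rfl
    | accept => exact acc_done _ _ _
    | reject => exact acc_fail _

theorem RunInv.labelCount_lt_or (h : RunInv P₀ N₀ N θ P Q) (hπ : π ∈ Q)
    (hupd : Update π δ X P (Q.erase π) P₁ Q₁) :
    labelCount P₀ θ < labelCount P₀ (δ.comp θ) ∨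
      labelCount P₀ θ = labelCount P₀ (δ.comp θ) ∧ Q₁.card < Q.card := by
  cases hupd with
  | keep =>
    exact (labelCount_mono P₀ δ θ).lt_or_eq.imp_right fun heq =>
      ⟨heq, Finset.card_image_le.trans_lt (Finset.card_erase_lt_of_mem hπ)⟩
  | reset hδ =>
    obtain ⟨R₁, R₂, μ₂, rfl, htail, hcard⟩ := hδ
    obtain ⟨μ₀, hμ₀, ht⟩ := (h.traced _ (Finset.mem_union_right _ hπ)).2.2 μ₂ htail
    exact .inl (labelCount_lt hμ₀ ht hcard)

theorem RunInv.acc (h : RunInv P₀ N₀ N θ P Q) :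
    Acc (fun c' c => Step P₀ c c') (.run N θ P Q) := by
  induction hk : P₀.rowVars.card * P₀.subLabels.card - labelCount P₀ θ
    using Nat.strong_induction_on generalizing N θ P Q with
  | _ k ihk =>
    induction hn : Q.card using Nat.strong_induction_on generalizing N θ P Q with
    | _ n ihn =>
      subst hk hn
      refine ⟨_, fun c' hstep => ?_⟩
      cases hstep with
      | row hπ hμ hr hwf =>
        have h' := h.step hπ hμ hr hwf
        obtain ⟨δ, X, -, rfl, hupd⟩ := hr.reduce
        rcases h.labelCount_lt_or hπ hupd with hlt | ⟨heq, hcard⟩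
        · have hle := labelCount_le h'.wf h'.labelsIn
          exact ihk _ (by omega) h' rfl
        · exact ihn _ hcard h' (by rw [heq]) rfl
      | row_fail => exact acc_fail _
      | row_dup => exact acc_fail _
      | row_done => exact acc_close _ _ _ _ _

end Accessibility

end Qeff

theorem mainTheorem7_general (P : Qeff.PSet) (hd : P.Directed) (hwf : P.WF)
    (N : Finset (Qeff.Kind × ℕ)) (hN : P.fv ⊆ N) :
    Qeff.SolveTerminates N P ∧
    (Qeff.SolveFails N P → ¬ Qeff.Satisfiable P) ∧
    (∀ (θ : Qeff.Subst ℕ ℕ) (Q : Qeff.PSet), Qeff.SolveReturns N P θ Q →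
      Qeff.Satisfiable P ∧ Qeff.Sat P = Qeff.composeSet N P (Qeff.Sat Q) θ) :=
  ⟨⟨(Qeff.RunInv.init hd hwf hN).acc, fun c _ => Qeff.Step.exists_or_final P c⟩,
    fun h => Qeff.inv_of_reachable hd hwf hN h,
    fun _ _ h => Qeff.inv_of_reachable hd hwf hN h⟩

theorem mainTheorem7 (P : Qeff.PSet) (hgen : Qeff.Generated P) (hwf : P.WF)
    (N : Finset (Qeff.Kind × ℕ)) (hN : P.fv ⊆ N) :
    Qeff.SolveTerminates N P ∧
    (Qeff.SolveFails N P → ¬ Qeff.Satisfiable P) ∧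
    (∀ (θ : Qeff.Subst ℕ ℕ) (Q : Qeff.PSet), Qeff.SolveReturns N P θ Q →
      Qeff.Satisfiable P ∧ Qeff.Sat P = Qeff.composeSet N P (Qeff.Sat Q) θ) :=
  mainTheorem7_general P hgen.directed hwf N hN
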